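/- Let $0<q<1$ and $[n]=(q^n-q^{-n})/(q-q^{-1})$. Let $U_q(\mathfrak{su}_2)$ be generated by $e,f,k^{\pm1}$ with $kek^{-1}=qe$, $kfk^{-1}=q^{-1}f$, $[e,f]=(k^2-k^{-2})/(q-q^{-1})$. Let $\mathbb C[SU_q(2)]$ be the unital $*$-algebra generated by $a,b$ with relations $ba=qab$, $b^*a=qab^*$, $bb^*=b^*b$, $a^*a+q^2b^*b=1$, $aa^*+bb^*=1$, with coproduct $\Delta t_{mn}=\sum_k t_{mk}\otimes t_{kn}$ for the matrix $(t_{mn})=\begin{pmatrix}a&b\\-qb^*&a^*\end{pmatrix}$. It has a Haar state $h$: a linear functional with $h(1)=1$, $(h\otimes\mathrm{id})\Delta(t)=h(t)1$, and $h(t^*t)>0$ for $t\ne0$. Let $\partial$ be the left action of $U_q(\mathfrak{su}_2)$ on $\mathbb C[SU_q(2)]$ for which $\partial(k)$ is an algebra automorphism, $\partial(x)(st)=\partial(x)s\,\partial(k)t+\partial(k^{-1})s\,\partial(x)t$ for $x=e,f$, and $$\partial(k):\ a,\,b\mapsto q^{1/2}a,\,q^{1/2}b,\quad a^*,\,b^*\mapsto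 q^{-1/2}a^*,\,q^{-1/2}b^*,$$ $$\partial(e):\ a,b\mapsto 0,\ a^*\mapsto qb,\ b^*\mapsto -a,\qquad \partial(f):\ a^*,b^*\mapsto 0,\ a\mapsto -b^*,\ b\mapsto q^{-1}a^*.$$ (This is $\pi_{q,l}(x)$ acting on the index $m$ of the $h$-orthonormal Peter–Weyl basis $|l,m,n\rangle$.) The standard Podleś sphere is the $*$-algebra $\mathbb C[S^2_q]=\{t\in\mathbb C[SU_q(2)]:\partial(k)t=t\}$. Let $\Sigma=\mathbb C^2$ with the spin-$\frac12$ representation $\pi$ in the basis $|\tfrac12,\tfrac12\rangle,|\tfrac12,-\tfrac12\rangle$: $\pi(e)=\begin{pmatrix}0&1\\0&0\end{pmatrix}$, $\pi(f)=\begin{pmatrix}0&0\\1&0\end{pmatrix}$, $\pi(k)=\mathrm{diag}(q^{1/2},q^{-1/2})$. Let $\mathbf H^{\mathfrak h}$ be the Hilbert space completion of the space of invariant spinors $$\mathcal S=\{\Psi\in\mathbb C[SU_q(2)]\otimes\Sigma:(\partial(k)\otimes\pi(k))\Psi=\Psi\}$$ for the inner product $\langle\Phi,\Psi\rangle=\sum_i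 h(\varphi_i^*\psi_i)$. The projected algebraic Dirac operator is $$\mathfrak D_q=[2]\,\partial\begin{pmatrix}0&q^{-1/2}k^{-1}f\\ q^{1/2}k^{-1}e&0\end{pmatrix}$$ on $\mathcal S$. It is the image $(\theta\otimes\sigma)\Omega'$, acting through $\partial\otimes\mathrm{id}$, of the canonical element $\Omega$ of the adjoint representation with its weight-zero term omitted; the remaining terms are given by $\theta|1,1\rangle=k^{-1}e$, $\theta|1,-1\rangle=-k^{-1}f$ and $\sigma\langle1,1|=\begin{pmatrix}0&0\\q^{1/2}[2]&0\end{pmatrix}$, $\sigma\langle1,-1|=\begin{pmatrix}0&-q^{-1/2}[2]\\0&0\end{pmatrix}$. Then, on $\mathcal S$, $\mathfrak D_q=[2]\,\partial\begin{pmatrix}0&f\\e&0\end{pmatrix}$. Left multiplication extends to a $*$-representation $\rho$ of $\mathbb C[S^2_q]$ by bounded operators on $\mathbf H^{\mathfrak h}$, $\gamma=\mathrm{diag}(1,-1)$ extends to a bounded operator, $\mathfrak D_q$ is closable, and with its closure, again written $\mathfrak D_q$, the triple $(\mathbb C[S^2_q],\mathfrak D_q,\mathbf H^{\mathfrak h})$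 is an even spectral triple with chirality $\gamma$: $\mathbf H^{\mathfrak h}$ is separable; $\rho$ is faithful; $\mathfrak D_q$ is densely defined and self-adjoint with compact resolvent; for every $t\in\mathbb C[S^2_q]$, $\rho(t)$ preserves the domain of $\mathfrak D_q$ and $[\mathfrak D_q,\rho(t)]$ extends to a bounded operator; and $\gamma=\gamma^*$, $\gamma^2=1$, $\gamma\rho(t)=\rho(t)\gamma$, and $\gamma$ preserves the domain of $\mathfrak D_q$ with $\gamma\mathfrak D_q+\mathfrak D_q\gamma=0$ there. There is an orthonormal basis of eigenvectors of $\mathfrak D_q$; the eigenvalues are $\pm[2][n]$, $n=1,2,3,\dots$, each of multiplicity $2n$, so they grow exponentially. The triple is $0$-summable: $(1+\mathfrak D_q^2)^{-p/2}$ is of trace class for every real $p>0$. -/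

import Mathlib

open scoped ComplexOrder TensorProduct

noncomputable section

namespace QSphere

/-! ## The deformation parameter `q ∈ (0,1)` -/

/-- The parameter space: `q` is a real number with `0 < q < 1`. -/
abbrev Param := Set.Ioo (0 : ℝ) 1

/-- `q` as a complex number. -/
def qc (q : Param) : ℂ := ((q : ℝ) : ℂ)

/-- `q^{1/2}` as a complex number. -/
def qh (q : Param) : ℂ := ((Real.sqrt (q : ℝ) : ℝ) : ℂ)

/-- The `q`-number `[n] = (q^n - q^{-n}) / (q - q^{-1})`. -/
def qnum (q : Param) (n : ℕ) : ℝ :=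
  ((q : ℝ) ^ n - ((q : ℝ) ^ n)⁻¹) / ((q : ℝ) - (q : ℝ)⁻¹)

/-- The `q`-number `[n]` as a complex number. -/
def qnumc (q : Param) (n : ℕ) : ℂ := ((qnum q n : ℝ) : ℂ)

lemma qh_mul_qh (q : Param) : qh q * qh q = qc q := by
  rw [qh, qc, ← Complex.ofReal_mul, Real.mul_self_sqrt q.2.1.le]

lemma qh_ne (q : Param) : qh q ≠ 0 := by
  have : 0 < Real.sqrt (q : ℝ) := Real.sqrt_pos.2 q.2.1
  simpa [qh] using this.ne'

lemma qc_ne (q : Param) : qc q ≠ 0 := by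
  simpa [qc] using q.2.1.ne'

lemma star_qc (q : Param) : (starRingEnd ℂ) (qc q) = qc q := Complex.conj_ofReal _

lemma qc_sub_inv_ne (q : Param) : qc q - (qc q)⁻¹ ≠ 0 := by
  have h0 := q.2.1
  have h1 := q.2.2
  intro h
  have h2 : qc q * qc q = 1 := by
    have := qc_ne q
    field_simp at h
    linear_combination h
  have h3 : (q : ℝ) * (q : ℝ) = 1 := by
    have : (((q : ℝ) * (q : ℝ) : ℝ) : ℂ) = ((1 : ℝ) : ℂ) := by
      push_cast
      exact h2
    exact_mod_cast this
  nlinarith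

/-! ## The quantized enveloping algebra `U_q(su_2)` -/

/-- Generators of `U_q(su_2)`. -/
inductive UGen | e | f | k | kinv

/-- Relations of `U_q(su_2)`: `k k⁻¹ = k⁻¹ k = 1`, `k e k⁻¹ = q e`, `k f k⁻¹ = q⁻¹ f`,
`e f - f e = (k² - k⁻²) / (q - q⁻¹)`. -/
inductive URel (q : Param) : FreeAlgebra ℂ UGen → FreeAlgebra ℂ UGen → Prop
  | k_kinv : URel q (FreeAlgebra.ι ℂ .k * FreeAlgebra.ι ℂ .kinv) 1
  | kinv_k : URel q (FreeAlgebra.ι ℂ .kinv * FreeAlgebra.ι ℂ .k) 1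
  | k_e : URel q (FreeAlgebra.ι ℂ .k * FreeAlgebra.ι ℂ .e * FreeAlgebra.ι ℂ .kinv)
      (qc q • FreeAlgebra.ι ℂ .e)
  | k_f : URel q (FreeAlgebra.ι ℂ .k * FreeAlgebra.ι ℂ .f * FreeAlgebra.ι ℂ .kinv)
      ((qc q)⁻¹ • FreeAlgebra.ι ℂ .f)
  | e_f : URel q
      (FreeAlgebra.ι ℂ .e * FreeAlgebra.ι ℂ .f - FreeAlgebra.ι ℂ .f * FreeAlgebra.ι ℂ .e)
      ((qc q - (qc q)⁻¹)⁻¹ • (FreeAlgebra.ι ℂ .k * FreeAlgebra.ι ℂ .k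
        - FreeAlgebra.ι ℂ .kinv * FreeAlgebra.ι ℂ .kinv))

/-- The algebra `U_q(su_2)`. -/
def Uq (q : Param) : Type := RingQuot (URel q)

instance (q : Param) : Ring (Uq q) := inferInstanceAs (Ring (RingQuot (URel q)))
instance (q : Param) : Algebra ℂ (Uq q) := inferInstanceAs (Algebra ℂ (RingQuot (URel q)))

/-- The class of a generator in `U_q(su_2)`. -/
def Uq.of (q : Param) (x : UGen) : Uq q :=
  RingQuot.mkAlgHom ℂ (URel q) (FreeAlgebra.ι ℂ x)

/-- The universal property of `U_q(su_2)`. -/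
def Uq.lift (q : Param) {B : Type*} [Ring B] [Algebra ℂ B] (g : UGen → B)
    (h : ∀ ⦃x y⦄, URel q x y → FreeAlgebra.lift ℂ g x = FreeAlgebra.lift ℂ g y) :
    Uq q →ₐ[ℂ] B :=
  RingQuot.liftAlgHom ℂ ⟨FreeAlgebra.lift ℂ g, h⟩

lemma Uq.lift_of (q : Param) {B : Type*} [Ring B] [Algebra ℂ B] (g : UGen → B)
    (h : ∀ ⦃x y⦄, URel q x y → FreeAlgebra.lift ℂ g x = FreeAlgebra.lift ℂ g y) (x : UGen) :
    Uq.lift q g h (Uq.of q x) = g x := by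
  have := RingQuot.liftAlgHom_mkAlgHom_apply (S := ℂ) (FreeAlgebra.lift ℂ g) h
    (FreeAlgebra.ι ℂ x)
  rw [FreeAlgebra.lift_ι_apply] at this
  exact this

/-! ## The coordinate algebra `ℂ[SU_q(2)]` -/

/-- Generators `a, a^*, b, b^*` of `ℂ[SU_q(2)]`. -/
inductive SUGen | a | as | b | bs

/-- Relations of `ℂ[SU_q(2)]`: `ba = qab`, `b^*a = qab^*`, their adjoints `a^*b^* = qb^*a^*`,
`a^*b = qba^*`, and `bb^* = b^*b`, `a^*a + q²b^*b = 1`, `aa^* + bb^* = 1`. -/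
inductive SURel (q : Param) : FreeAlgebra ℂ SUGen → FreeAlgebra ℂ SUGen → Prop
  | b_a : SURel q (FreeAlgebra.ι ℂ .b * FreeAlgebra.ι ℂ .a)
      (qc q • (FreeAlgebra.ι ℂ .a * FreeAlgebra.ι ℂ .b))
  | bs_a : SURel q (FreeAlgebra.ι ℂ .bs * FreeAlgebra.ι ℂ .a)
      (qc q • (FreeAlgebra.ι ℂ .a * FreeAlgebra.ι ℂ .bs))
  | as_bs : SURel q (FreeAlgebra.ι ℂ .as * FreeAlgebra.ι ℂ .bs)
      (qc q • (FreeAlgebra.ι ℂ .bs * FreeAlgebra.ι ℂ .as))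
  | as_b : SURel q (FreeAlgebra.ι ℂ .as * FreeAlgebra.ι ℂ .b)
      (qc q • (FreeAlgebra.ι ℂ .b * FreeAlgebra.ι ℂ .as))
  | b_bs : SURel q (FreeAlgebra.ι ℂ .b * FreeAlgebra.ι ℂ .bs)
      (FreeAlgebra.ι ℂ .bs * FreeAlgebra.ι ℂ .b)
  | as_a : SURel q (FreeAlgebra.ι ℂ .as * FreeAlgebra.ι ℂ .a
      + (qc q * qc q) • (FreeAlgebra.ι ℂ .bs * FreeAlgebra.ι ℂ .b)) 1
  | a_as : SURel q (FreeAlgebra.ι ℂ .a * FreeAlgebra.ι ℂ .as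
      + FreeAlgebra.ι ℂ .b * FreeAlgebra.ι ℂ .bs) 1

/-- The algebra `ℂ[SU_q(2)]`. -/
def SUq (q : Param) : Type := RingQuot (SURel q)

namespace SUq

variable (q : Param)

instance : Ring (SUq q) := inferInstanceAs (Ring (RingQuot (SURel q)))
instance : Algebra ℂ (SUq q) := inferInstanceAs (Algebra ℂ (RingQuot (SURel q)))

/-- The quotient map from the free algebra onto `ℂ[SU_q(2)]`. -/
def mk : FreeAlgebra ℂ SUGen →ₐ[ℂ] SUq q := RingQuot.mkAlgHom ℂ (SURel q)

lemma mk_rel {x y : FreeAlgebra ℂ SUGen} (h : SURel q x y) : mk q x = mk q y :=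
  RingQuot.mkAlgHom_rel ℂ h

/-- The class of a generator in `ℂ[SU_q(2)]`. -/
def of (x : SUGen) : SUq q := mk q (FreeAlgebra.ι ℂ x)

lemma rel_b_a : of q .b * of q .a = qc q • (of q .a * of q .b) := by
  simpa only [of, map_mul, map_smul] using mk_rel q SURel.b_a

lemma rel_bs_a : of q .bs * of q .a = qc q • (of q .a * of q .bs) := by
  simpa only [of, map_mul, map_smul] using mk_rel q SURel.bs_a

lemma rel_as_bs : of q .as * of q .bs = qc q • (of q .bs * of q .as) := by
  simpa only [of, map_mul, map_smul] using mk_rel q SURel.as_bs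

lemma rel_as_b : of q .as * of q .b = qc q • (of q .b * of q .as) := by
  simpa only [of, map_mul, map_smul] using mk_rel q SURel.as_b

lemma rel_b_bs : of q .b * of q .bs = of q .bs * of q .b := by
  simpa only [of, map_mul] using mk_rel q SURel.b_bs

lemma rel_as_a : of q .as * of q .a = 1 - (qc q * qc q) • (of q .bs * of q .b) := by
  rw [eq_sub_iff_add_eq]
  simpa only [of, map_add, map_smul, map_mul, map_one] using mk_rel q SURel.as_a

lemma rel_a_as : of q .a * of q .as = 1 - of q .bs * of q .b := by
  rw [eq_sub_iff_add_eq, ← rel_b_bs]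
  simpa only [of, map_add, map_mul, map_one] using mk_rel q SURel.a_as

variable {q}

/-- The universal property of `ℂ[SU_q(2)]`. -/
def lift {B : Type*} [Ring B] [Algebra ℂ B] (g : SUGen → B)
    (h : ∀ ⦃x y⦄, SURel q x y → FreeAlgebra.lift ℂ g x = FreeAlgebra.lift ℂ g y) :
    SUq q →ₐ[ℂ] B :=
  RingQuot.liftAlgHom ℂ ⟨FreeAlgebra.lift ℂ g, h⟩

lemma lift_of {B : Type*} [Ring B] [Algebra ℂ B] (g : SUGen → B)
    (h : ∀ ⦃x y⦄, SURel q x y → FreeAlgebra.lift ℂ g x = FreeAlgebra.lift ℂ g y) (x : SUGen) :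
    lift h (g := g) (of q x) = g x := by
  have := RingQuot.liftAlgHom_mkAlgHom_apply (S := ℂ) (FreeAlgebra.lift ℂ g) h
    (FreeAlgebra.ι ℂ x)
  rw [FreeAlgebra.lift_ι_apply] at this
  exact this

@[elab_as_elim]
lemma induction {p : SUq q → Prop} (hs : ∀ z : ℂ, p (algebraMap ℂ _ z)) (hg : ∀ x, p (of q x))
    (hm : ∀ s t, p s → p t → p (s * t)) (ha : ∀ s t, p s → p t → p (s + t)) (t : SUq q) :
    p t := by
  obtain ⟨x, rfl⟩ := RingQuot.mkAlgHom_surjective ℂ (SURel q) t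
  induction x with
  | grade0 z => rw [AlgHom.commutes]; exact hs z
  | grade1 x => exact hg x
  | mul x y hx hy => rw [map_mul]; exact hm _ _ hx hy
  | add x y hx hy => rw [map_add]; exact ha _ _ hx hy

/-! ### The involution -/

/-- The opposite algebra with conjugated scalars, the target of the involution. -/
def ConjOp (q : Param) : Type := (SUq q)ᵐᵒᵖ

instance : Ring (ConjOp q) := inferInstanceAs (Ring (SUq q)ᵐᵒᵖ)

/-- The identity map onto the opposite algebra. -/
def toConjOp (q : Param) (x : SUq q) : ConjOp q := MulOpposite.op x

/-- The identity map from the opposite algebra. -/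
def ofConjOp (x : ConjOp q) : SUq q := MulOpposite.unop x

instance : Algebra ℂ (ConjOp q) :=
  RingHom.toAlgebra' (S := ConjOp q)
    (((algebraMap ℂ (SUq q)ᵐᵒᵖ).comp (starRingEnd ℂ) : ℂ →+* (SUq q)ᵐᵒᵖ))
    (fun c x => Algebra.commutes (A := (SUq q)ᵐᵒᵖ) (starRingEnd ℂ c) x)

lemma ofConjOp_algebraMap (z : ℂ) :
    ofConjOp (algebraMap ℂ (ConjOp q) z) = algebraMap ℂ (SUq q) (starRingEnd ℂ z) := rfl

lemma ofConjOp_mul (x y : ConjOp q) : ofConjOp (x * y) = ofConjOp y * ofConjOp x := rfl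
lemma ofConjOp_add (x y : ConjOp q) : ofConjOp (x + y) = ofConjOp x + ofConjOp y := rfl
lemma ofConjOp_one : ofConjOp (1 : ConjOp q) = 1 := rfl
lemma ofConjOp_toConjOp (x : SUq q) : ofConjOp (toConjOp q x) = x := rfl
lemma ofConjOp_inj {x y : ConjOp q} (h : ofConjOp x = ofConjOp y) : x = y :=
  MulOpposite.unop_injective h

lemma ofConjOp_smul (z : ℂ) (x : ConjOp q) :
    ofConjOp (z • x) = (starRingEnd ℂ z) • ofConjOp x := by
  rw [Algebra.smul_def, ofConjOp_mul, ofConjOp_algebraMap, Algebra.smul_def, Algebra.commutes]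

/-- The involution on generators. -/
def starGen : SUGen → SUGen
  | .a => .as
  | .as => .a
  | .b => .bs
  | .bs => .b

/-- The involution, as an algebra homomorphism to the opposite conjugate algebra. -/
def starHom (q : Param) : SUq q →ₐ[ℂ] ConjOp q :=
  lift (fun x => toConjOp q (of q (starGen x))) (by
    intro x y h
    apply ofConjOp_inj
    cases h <;>
      simp only [map_mul, map_add, map_smul, map_one, FreeAlgebra.lift_ι_apply, ofConjOp_mul,
        ofConjOp_add, ofConjOp_smul, ofConjOp_one, ofConjOp_toConjOp, starGen, star_qc]
    · exact rel_as_bs q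
    · exact rel_as_b q
    · exact rel_b_a q
    · exact rel_bs_a q
    · exact rel_b_bs q
    · rw [rel_as_a]; simp
    · rw [rel_a_as, rel_b_bs]; simp)

instance : Star (SUq q) := ⟨fun t => ofConjOp (starHom q t)⟩

lemma star_def (t : SUq q) : star t = ofConjOp (starHom q t) := rfl

lemma star_of (x : SUGen) : star (of q x) = of q (starGen x) := by
  rw [star_def, starHom, lift_of, ofConjOp_toConjOp]

lemma star_mul_aux (s t : SUq q) : star (s * t) = star t * star s := by
  simp only [star_def, map_mul, ofConjOp_mul]

lemma star_add_aux (s t : SUq q) : star (s + t) = star s + star t := by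
  simp only [star_def, map_add, ofConjOp_add]

lemma star_algebraMap_aux (z : ℂ) :
    star (algebraMap ℂ (SUq q) z) = algebraMap ℂ (SUq q) (starRingEnd ℂ z) := by
  rw [star_def, AlgHom.commutes, ofConjOp_algebraMap]

/-- `ℂ[SU_q(2)]` is a `*`-ring; on generators the involution exchanges `a, a^*` and `b, b^*`. -/
instance : StarRing (SUq q) where
  star_involutive t := by
    induction t using SUq.induction with
    | hs z => rw [star_algebraMap_aux, star_algebraMap_aux, Complex.conj_conj]
    | hg x => rw [star_of, star_of]; cases x <;> rfl
    | hm s t hs ht => rw [star_mul_aux, star_mul_aux, hs, ht]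
    | ha s t hs ht => rw [star_add_aux, star_add_aux, hs, ht]
  star_mul := star_mul_aux
  star_add := star_add_aux

instance : StarModule ℂ (SUq q) where
  star_smul z t := by
    rw [star_def, map_smul, ofConjOp_smul]; rfl

/-! ### The coproduct -/

/-- The coproduct on generators, `Δ(t_{mn}) = ∑_k t_{mk} ⊗ t_{kn}` for the matrix
`(t_{mn}) = ((a, b), (-q b^*, a^*))`. -/
def comulGen (q : Param) : SUGen → SUq q ⊗[ℂ] SUq q
  | .a => of q .a ⊗ₜ of q .a - qc q • (of q .b ⊗ₜ of q .bs)
  | .b => of q .a ⊗ₜ of q .b + of q .b ⊗ₜ of q .as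
  | .as => of q .as ⊗ₜ of q .as - qc q • (of q .bs ⊗ₜ of q .b)
  | .bs => of q .bs ⊗ₜ of q .a + of q .as ⊗ₜ of q .bs

/-- The coproduct `Δ : ℂ[SU_q(2)] → ℂ[SU_q(2)] ⊗ ℂ[SU_q(2)]`. -/
def comul (q : Param) : SUq q →ₐ[ℂ] SUq q ⊗[ℂ] SUq q :=
  lift (comulGen q) (by
    intro x y h
    cases h <;>
      simp only [map_mul, map_add, map_smul, map_one, FreeAlgebra.lift_ι_apply, comulGen,
        mul_add, add_mul, mul_sub, sub_mul, smul_mul_assoc, mul_smul_comm,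
        Algebra.TensorProduct.tmul_mul_tmul, rel_b_a, rel_bs_a, rel_as_bs, rel_as_b, rel_b_bs,
        rel_as_a, rel_a_as, TensorProduct.tmul_sub, TensorProduct.sub_tmul,
        TensorProduct.tmul_smul, ← TensorProduct.smul_tmul', Algebra.TensorProduct.one_def] <;>
      module)

/-! ### The left action of `U_q(su_2)` -/

/-- The automorphism scaling `a, b` by `s` and `a^*, b^*` by `s⁻¹ = r`. -/
def scale (q : Param) (s r : ℂ) (h : s * r = 1) : SUq q →ₐ[ℂ] SUq q :=
  lift (fun x => match x with
    | .a => s • of q .a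
    | .b => s • of q .b
    | .as => r • of q .as
    | .bs => r • of q .bs) (by
    intro x y hxy
    have h2 : r * s = 1 := by rw [mul_comm, h]
    cases hxy <;>
      simp only [map_mul, map_add, map_smul, map_one, FreeAlgebra.lift_ι_apply,
        smul_mul_assoc, mul_smul_comm, smul_smul, h, h2, one_smul,
        rel_b_a, rel_bs_a, rel_as_bs, rel_as_b, rel_b_bs, rel_as_a, rel_a_as] <;>
      first | done | module | (match_scalars; linear_combination qc q * h))

/-- The action of `k`: the automorphism `a, b ↦ q^{1/2} a, q^{1/2} b`. -/
def actK (q : Param) : SUq q →ₐ[ℂ] SUq q :=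
  scale q (qh q) (qh q)⁻¹ (mul_inv_cancel₀ (qh_ne q))

/-- The action of `k⁻¹`. -/
def actKinv (q : Param) : SUq q →ₐ[ℂ] SUq q :=
  scale q (qh q)⁻¹ (qh q) (inv_mul_cancel₀ (qh_ne q))

/-- The homomorphism `t ↦ ((∂(k⁻¹)t, ∂(e)t), (0, ∂(k)t))`, which encodes
`∂(e)(st) = ∂(e)s ∂(k)t + ∂(k⁻¹)s ∂(e)t`, with `∂(e)a = ∂(e)b = 0`, `∂(e)a^* = q b`,
`∂(e)b^* = -a`. -/
def matE (q : Param) : SUq q →ₐ[ℂ] Matrix (Fin 2) (Fin 2) (SUq q) :=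
  lift (fun x => match x with
    | .a => !![(qh q)⁻¹ • of q .a, 0; 0, qh q • of q .a]
    | .b => !![(qh q)⁻¹ • of q .b, 0; 0, qh q • of q .b]
    | .as => !![qh q • of q .as, qc q • of q .b; 0, (qh q)⁻¹ • of q .as]
    | .bs => !![qh q • of q .bs, -of q .a; 0, (qh q)⁻¹ • of q .bs]) (by
    intro x y hxy
    have h0 := qh_ne q
    cases hxy <;> ext i j <;> fin_cases i <;> fin_cases j <;>
      simp [Matrix.mul_apply, Fin.sum_univ_two, smul_smul,
        rel_b_a, rel_bs_a, rel_as_bs, rel_as_b, rel_b_bs, rel_as_a, rel_a_as, ← qh_mul_qh, h0] <;>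
      (match_scalars <;> field_simp <;> ring))

/-- The homomorphism `t ↦ ((∂(k⁻¹)t, ∂(f)t), (0, ∂(k)t))`, which encodes
`∂(f)(st) = ∂(f)s ∂(k)t + ∂(k⁻¹)s ∂(f)t`, with `∂(f)a^* = ∂(f)b^* = 0`, `∂(f)a = -b^*`,
`∂(f)b = q⁻¹ a^*`. -/
def matF (q : Param) : SUq q →ₐ[ℂ] Matrix (Fin 2) (Fin 2) (SUq q) :=
  lift (fun x => match x with
    | .a => !![(qh q)⁻¹ • of q .a, -of q .bs; 0, qh q • of q .a]
    | .b => !![(qh q)⁻¹ • of q .b, (qc q)⁻¹ • of q .as; 0, qh q • of q .b]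
    | .as => !![qh q • of q .as, 0; 0, (qh q)⁻¹ • of q .as]
    | .bs => !![qh q • of q .bs, 0; 0, (qh q)⁻¹ • of q .bs]) (by
    intro x y hxy
    have h0 := qh_ne q
    cases hxy <;> ext i j <;> fin_cases i <;> fin_cases j <;>
      simp [Matrix.mul_apply, Fin.sum_univ_two, smul_smul,
        rel_b_a, rel_bs_a, rel_as_bs, rel_as_b, rel_b_bs, rel_as_a, rel_a_as, ← qh_mul_qh, h0] <;>
      (match_scalars <;> field_simp <;> ring))

/-- The action of `e`. -/
def actE (q : Param) : SUq q →ₗ[ℂ] SUq q where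
  toFun t := matE q t 0 1
  map_add' s t := by rw [map_add]; rfl
  map_smul' z t := by rw [map_smul]; rfl

/-- The action of `f`. -/
def actF (q : Param) : SUq q →ₗ[ℂ] SUq q where
  toFun t := matF q t 0 1
  map_add' s t := by rw [map_add]; rfl
  map_smul' z t := by rw [map_smul]; rfl

lemma matE_diag (t : SUq q) :
    matE q t 1 0 = 0 ∧ matE q t 0 0 = actKinv q t ∧ matE q t 1 1 = actK q t := by
  induction t using SUq.induction with
  | hs z => simp [AlgHom.commutes, Matrix.algebraMap_matrix_apply]
  | hg x => cases x <;> simp [matE, actK, actKinv, scale, lift_of]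
  | hm s t hs ht =>
    obtain ⟨h1, h2, h3⟩ := hs
    obtain ⟨h4, h5, h6⟩ := ht
    simp [Matrix.mul_apply, Fin.sum_univ_two, h1, h2, h3, h4, h5, h6]
  | ha s t hs ht =>
    obtain ⟨h1, h2, h3⟩ := hs
    obtain ⟨h4, h5, h6⟩ := ht
    simp [h1, h2, h3, h4, h5, h6]

lemma matF_diag (t : SUq q) :
    matF q t 1 0 = 0 ∧ matF q t 0 0 = actKinv q t ∧ matF q t 1 1 = actK q t := by
  induction t using SUq.induction with
  | hs z => simp [AlgHom.commutes, Matrix.algebraMap_matrix_apply]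
  | hg x => cases x <;> simp [matF, actK, actKinv, scale, lift_of]
  | hm s t hs ht =>
    obtain ⟨h1, h2, h3⟩ := hs
    obtain ⟨h4, h5, h6⟩ := ht
    simp [Matrix.mul_apply, Fin.sum_univ_two, h1, h2, h3, h4, h5, h6]
  | ha s t hs ht =>
    obtain ⟨h1, h2, h3⟩ := hs
    obtain ⟨h4, h5, h6⟩ := ht
    simp [h1, h2, h3, h4, h5, h6]

lemma actE_mul (s t : SUq q) : actE q (s * t) = actE q s * actK q t + actKinv q s * actE q t := by
  change matE q (s * t) 0 1 = matE q s 0 1 * _ + _ * matE q t 0 1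
  rw [map_mul, Matrix.mul_apply, Fin.sum_univ_two, (matE_diag s).2.1, (matE_diag t).2.2, add_comm]

lemma actF_mul (s t : SUq q) : actF q (s * t) = actF q s * actK q t + actKinv q s * actF q t := by
  change matF q (s * t) 0 1 = matF q s 0 1 * _ + _ * matF q t 0 1
  rw [map_mul, Matrix.mul_apply, Fin.sum_univ_two, (matF_diag s).2.1, (matF_diag t).2.2, add_comm]

lemma actE_algebraMap (z : ℂ) : actE q (algebraMap ℂ _ z) = 0 := by
  change matE q _ 0 1 = 0
  rw [AlgHom.commutes, Matrix.algebraMap_matrix_apply]; simp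

lemma actF_algebraMap (z : ℂ) : actF q (algebraMap ℂ _ z) = 0 := by
  change matF q _ 0 1 = 0
  rw [AlgHom.commutes, Matrix.algebraMap_matrix_apply]; simp

lemma actE_of (x : SUGen) : actE q (of q x) =
    match x with
    | .a => 0
    | .b => 0
    | .as => qc q • of q .b
    | .bs => -of q .a := by
  change matE q _ 0 1 = _
  rw [matE, lift_of]; cases x <;> rfl

lemma actF_of (x : SUGen) : actF q (of q x) =
    match x with
    | .a => -of q .bs
    | .b => (qc q)⁻¹ • of q .as
    | .as => 0
    | .bs => 0 := by
  change matF q _ 0 1 = _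
  rw [matF, lift_of]; cases x <;> rfl

lemma actK_of (x : SUGen) : actK q (of q x) =
    match x with
    | .a => qh q • of q .a
    | .b => qh q • of q .b
    | .as => (qh q)⁻¹ • of q .as
    | .bs => (qh q)⁻¹ • of q .bs := by
  rw [actK, scale, lift_of]

lemma actKinv_of (x : SUGen) : actKinv q (of q x) =
    match x with
    | .a => (qh q)⁻¹ • of q .a
    | .b => (qh q)⁻¹ • of q .b
    | .as => qh q • of q .as
    | .bs => qh q • of q .bs := by
  rw [actKinv, scale, lift_of]

lemma actK_actKinv (t : SUq q) : actK q (actKinv q t) = t := by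
  have h0 := qh_ne q
  induction t using SUq.induction with
  | hs z => simp
  | hg x => cases x <;> simp [actK_of, actKinv_of, smul_smul, h0]
  | hm s t hs ht => rw [map_mul, map_mul, hs, ht]
  | ha s t hs ht => rw [map_add, map_add, hs, ht]

lemma actKinv_actK (t : SUq q) : actKinv q (actK q t) = t := by
  have h0 := qh_ne q
  induction t using SUq.induction with
  | hs z => simp
  | hg x => cases x <;> simp [actK_of, actKinv_of, smul_smul, h0]
  | hm s t hs ht => rw [map_mul, map_mul, hs, ht]
  | ha s t hs ht => rw [map_add, map_add, hs, ht]

lemma actK_actE (t : SUq q) : actK q (actE q t) = qc q • actE q (actK q t) := by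
  have h0 := qh_ne q
  induction t using SUq.induction with
  | hs z => simp [actE_algebraMap]
  | hg x =>
    cases x <;> simp [actK_of, actE_of, smul_smul, h0, ← qh_mul_qh]
  | hm s t hs ht =>
    simp only [map_mul, map_add, actE_mul, actK_actKinv, actKinv_actK, hs, ht, smul_add,
      smul_mul_assoc, mul_smul_comm]
  | ha s t hs ht => simp only [map_add, hs, ht, smul_add]

lemma actK_actF (t : SUq q) : actK q (actF q t) = (qc q)⁻¹ • actF q (actK q t) := by
  have h0 := qh_ne q
  induction t using SUq.induction with
  | hs z => simp [actF_algebraMap]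
  | hg x =>
    cases x <;> simp [actK_of, actF_of, smul_smul, h0, ← qh_mul_qh]
  | hm s t hs ht =>
    simp only [map_mul, map_add, actF_mul, actK_actKinv, actKinv_actK, hs, ht, smul_add,
      smul_mul_assoc, mul_smul_comm]
  | ha s t hs ht => simp only [map_add, hs, ht, smul_add]

lemma actE_actKinv (t : SUq q) : actE q (actKinv q t) = qc q • actKinv q (actE q t) := by
  have := congrArg (actKinv q) (actK_actE (actKinv q t))
  rwa [actKinv_actK, actK_actKinv, map_smul] at this

lemma actF_actKinv (t : SUq q) : actF q (actKinv q t) = (qc q)⁻¹ • actKinv q (actF q t) := by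
  have := congrArg (actKinv q) (actK_actF (actKinv q t))
  rwa [actKinv_actK, actK_actKinv, map_smul] at this

lemma actE_actF_comm (t : SUq q) :
    actE q (actF q t) - actF q (actE q t) =
      (qc q - (qc q)⁻¹)⁻¹ • (actK q (actK q t) - actKinv q (actKinv q t)) := by
  have h0 := qc_ne q
  have hh := qh_ne q
  have h1 := qc_sub_inv_ne q
  induction t using SUq.induction with
  | hs z => simp [actE_algebraMap, actF_algebraMap]
  | hg x =>
    cases x <;> simp [actK_of, actE_of, actF_of, actKinv_of, smul_smul, h0, qh_mul_qh,
      ← mul_inv, ← sub_smul, h1]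
    all_goals
      rw [← neg_sub (qc q) (qc q)⁻¹, mul_neg, inv_mul_cancel₀ h1]
      simp
  | hm s t hs ht =>
    have e1 : actE q (actF q s) = actF q (actE q s) +
      (qc q - (qc q)⁻¹)⁻¹ • (actK q (actK q s) - actKinv q (actKinv q s)) := by
      rw [← hs]; abel
    have e2 : actE q (actF q t) = actF q (actE q t) +
      (qc q - (qc q)⁻¹)⁻¹ • (actK q (actK q t) - actKinv q (actKinv q t)) := by
      rw [← ht]; abel
    simp only [map_mul, map_add, actE_mul, actF_mul, e1, e2, actE_actKinv, actF_actKinv,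
      actK_actE, actK_actF, smul_mul_assoc, mul_smul_comm, add_mul, mul_add, mul_sub, sub_mul]
    match_scalars <;> field_simp <;> ring
  | ha s t hs ht =>
    simp only [map_add]
    rw [add_sub_add_comm, hs, ht, add_sub_add_comm, smul_add]

/-- The left action `∂` of `U_q(su_2)` on `ℂ[SU_q(2)]`. -/
def act (q : Param) : Uq q →ₐ[ℂ] Module.End ℂ (SUq q) :=
  Uq.lift q (fun x => match x with
    | .e => actE q
    | .f => actF q
    | .k => (actK q).toLinearMap
    | .kinv => (actKinv q).toLinearMap) (by
    intro x y hxy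
    cases hxy <;> ext t <;>
      simp only [map_mul, map_sub, map_smul, map_one, FreeAlgebra.lift_ι_apply, Module.End.mul_apply,
        LinearMap.sub_apply, LinearMap.smul_apply, Module.End.one_apply, AlgHom.toLinearMap_apply]
    · exact actK_actKinv t
    · exact actKinv_actK t
    · rw [actK_actE, actK_actKinv]
    · rw [actK_actF, actK_actKinv]
    · exact actE_actF_comm t)

lemma act_e (t : SUq q) : act q (Uq.of q .e) t = actE q t := by rw [act, Uq.lift_of]
lemma act_f (t : SUq q) : act q (Uq.of q .f) t = actF q t := by rw [act, Uq.lift_of]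
lemma act_k (t : SUq q) : act q (Uq.of q .k) t = actK q t := by rw [act, Uq.lift_of]; rfl
lemma act_kinv (t : SUq q) : act q (Uq.of q .kinv) t = actKinv q t := by
  rw [act, Uq.lift_of]; rfl

lemma actK_star (t : SUq q) : actK q (star t) = star (actKinv q t) := by
  have hr : (starRingEnd ℂ) (qh q) = qh q := Complex.conj_ofReal _
  induction t using SUq.induction with
  | hs z => rw [AlgHom.commutes, star_algebraMap_aux, AlgHom.commutes]
  | hg x => cases x <;> simp [actK_of, actKinv_of, star_of, starGen, hr]
  | hm s t hs ht => rw [star_mul, map_mul, map_mul, star_mul, hs, ht]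
  | ha s t hs ht => rw [star_add, map_add, map_add, star_add, hs, ht]

/-! ### The Haar state -/

/-- A Haar state: a normalized functional that is positive (`h(t^*t) > 0` for `t ≠ 0`) and left
invariant (`(h ⊗ id)Δ(t) = h(t)1`). -/
structure IsHaarState (h : SUq q →ₗ[ℂ] ℂ) : Prop where
  map_one : h 1 = 1
  pos : ∀ t, t ≠ 0 → 0 < h (star t * t)
  left_invariant : ∀ t,
    TensorProduct.lid ℂ (SUq q) (TensorProduct.map h LinearMap.id (comul q t)) = h t • 1

open Classical in
/-- The Haar state of `ℂ[SU_q(2)]`. -/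
def haar (q : Param) : SUq q →ₗ[ℂ] ℂ :=
  if H : ∃ h : SUq q →ₗ[ℂ] ℂ, IsHaarState h then H.choose else 0

lemma haar_nonneg (t : SUq q) : 0 ≤ haar q (star t * t) := by
  unfold haar
  split_ifs with H
  · by_cases ht : t = 0
    · simp [ht]
    · exact (H.choose_spec.pos t ht).le
  · simp

lemma haar_conj (s t : SUq q) :
    (starRingEnd ℂ) (haar q (star t * s)) = haar q (star s * t) := by
  have key : ∀ z : ℂ, (z * haar q (star s * t) + (starRingEnd ℂ) z * haar q (star t * s)).im = 0 := by
    intro z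
    have h1 := (Complex.le_def.1 (haar_nonneg (s + z • t))).2
    have h2 := (Complex.le_def.1 (haar_nonneg s)).2
    have h3 := (Complex.le_def.1 (haar_nonneg (z • t))).2
    have h4 : star (s + z • t) * (s + z • t) = star s * s + star (z • t) * (z • t)
        + (z • (star s * t) + (starRingEnd ℂ) z • (star t * s)) := by
      rw [star_add, star_smul, add_mul, mul_add, mul_add, mul_smul_comm, smul_mul_assoc,
        smul_mul_assoc]
      simp only [starRingEnd_apply]
      abel
    rw [h4, map_add, map_add, map_add, map_smul, map_smul, smul_eq_mul, smul_eq_mul] at h1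
    simp only [Complex.add_im, Complex.zero_im] at h1 h2 h3 ⊢
    linarith
  have k1 := key 1
  have k2 := key Complex.I
  simp at k1 k2
  apply Complex.ext <;> simp <;> linarith

end SUq

/-! ## The Podleś sphere and its spinors -/

open SUq

/-- The standard Podleś sphere `ℂ[S²_q] = {t ∈ ℂ[SU_q(2)] : ∂(k)t = t}`. -/
def podles (q : Param) : StarSubalgebra ℂ (SUq q) where
  carrier := {t | act q (Uq.of q .k) t = t}
  mul_mem' {s t} hs ht := by
    simp only [Set.mem_ofPred_eq, act_k] at *
    rw [map_mul, hs, ht]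
  add_mem' {s t} hs ht := by
    simp only [Set.mem_ofPred_eq] at *
    rw [map_add, hs, ht]
  algebraMap_mem' z := by
    simp only [Set.mem_ofPred_eq, act_k]
    exact AlgHom.commutes _ z
  star_mem' {t} ht := by
    simp only [Set.mem_ofPred_eq, act_k] at *
    rw [actK_star]
    conv_lhs => rw [← ht, actKinv_actK]

/-- The representation `π_{1/2}` of `U_q(su_2)` on `Σ = ℂ²`, in the basis
`|1/2, 1/2⟩, |1/2, -1/2⟩`. -/
def spinRep (q : Param) : Uq q →ₐ[ℂ] Matrix (Fin 2) (Fin 2) ℂ :=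
  Uq.lift q (fun x => match x with
    | .e => !![0, 1; 0, 0]
    | .f => !![0, 0; 1, 0]
    | .k => !![qh q, 0; 0, (qh q)⁻¹]
    | .kinv => !![(qh q)⁻¹, 0; 0, qh q]) (by
    intro x y hxy
    have h0 := qh_ne q
    have h1 := qc_sub_inv_ne q
    cases hxy <;> ext i j <;> fin_cases i <;> fin_cases j <;>
      simp [Matrix.mul_apply, Fin.sum_univ_two, h0, qh_mul_qh, ← mul_inv, h1]
    · rw [← neg_sub (qc q) (qc q)⁻¹, mul_neg, inv_mul_cancel₀ h1])

/-- The space `ℂ[SU_q(2)] ⊗ Σ`, as pairs of coordinates in the basis of `Σ`. -/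
abbrev Spinors (q : Param) : Type := Fin 2 → SUq q

/-- The operator `∂(u) ⊗ π_{1/2}(v)` on `ℂ[SU_q(2)] ⊗ Σ`. -/
def tensorAct (q : Param) (u v : Uq q) : Spinors q →ₗ[ℂ] Spinors q where
  toFun ψ i := ∑ j, spinRep q v i j • act q u (ψ j)
  map_add' φ ψ := by
    ext i
    simp [Finset.sum_add_distrib]
  map_smul' z ψ := by
    ext i
    simp [smul_comm z]

/-- The operator `(∂ ⊗ id)(M)` on `ℂ[SU_q(2)] ⊗ Σ`, for
`M ∈ U_q(su_2) ⊗ B(Σ) = M_2(U_q(su_2))`. -/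
def matAct (q : Param) (M : Matrix (Fin 2) (Fin 2) (Uq q)) : Spinors q →ₗ[ℂ] Spinors q where
  toFun ψ i := ∑ j, act q (M i j) (ψ j)
  map_add' φ ψ := by
    ext i
    simp [Finset.sum_add_distrib]
  map_smul' z ψ := by
    ext i
    simp

/-- The `U_q(𝔥)`-invariant spinors, `{Ψ : (∂(k) ⊗ π_{1/2}(k))Ψ = Ψ}`. -/
def invSpinors (q : Param) : Submodule ℂ (Spinors q) :=
  LinearMap.eqLocus (tensorAct q (Uq.of q .k) (Uq.of q .k)) LinearMap.id

lemma mem_invSpinors (q : Param) (ψ : Spinors q) :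
    ψ ∈ invSpinors q ↔ qh q • actK q (ψ 0) = ψ 0 ∧ (qh q)⁻¹ • actK q (ψ 1) = ψ 1 := by
  rw [invSpinors, LinearMap.mem_eqLocus, funext_iff, Fin.forall_fin_two]
  simp [tensorAct, spinRep, Uq.lift_of, act_k]

/-- The type of `U_q(𝔥)`-invariant spinors. -/
def InvSpinors (q : Param) : Type := invSpinors q

instance (q : Param) : AddCommGroup (InvSpinors q) := inferInstanceAs (AddCommGroup (invSpinors q))
instance (q : Param) : Module ℂ (InvSpinors q) := inferInstanceAs (Module ℂ (invSpinors q))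

/-- The underlying element of `ℂ[SU_q(2)] ⊗ Σ`. -/
def InvSpinors.val {q : Param} : InvSpinors q →ₗ[ℂ] Spinors q := (invSpinors q).subtype

lemma InvSpinors.val_mem {q : Param} (ψ : InvSpinors q) : ψ.val ∈ invSpinors q := Subtype.prop _

/-- The inner product `⟨Φ, Ψ⟩ = ∑_i h(φ_i^* ψ_i)` given by the Haar state. -/
@[reducible]
def spinorCore (q : Param) : PreInnerProductSpace.Core ℂ (InvSpinors q) where
  inner φ ψ := ∑ i, haar q (star (φ.val i) * ψ.val i)
  conj_inner_symm φ ψ := by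
    rw [map_sum]
    exact Finset.sum_congr rfl fun i _ => haar_conj _ _
  re_inner_nonneg φ := by
    rw [map_sum]
    exact Finset.sum_nonneg fun i _ => (Complex.le_def.1 (haar_nonneg _)).1
  add_left φ ψ χ := by
    simp [add_mul, Finset.sum_add_distrib]
  smul_left φ ψ z := by
    simp [mul_add]

instance (q : Param) : SeminormedAddCommGroup (InvSpinors q) :=
  @InnerProductSpace.Core.toSeminormedAddCommGroup ℂ (InvSpinors q) _ _ _ (spinorCore q)

instance (q : Param) : InnerProductSpace ℂ (InvSpinors q) :=
  InnerProductSpace.ofCore (spinorCore q)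

/-- The Hilbert space `H^𝔥`, the completion of the invariant spinors. -/
abbrev HilbertInv (q : Param) : Type := UniformSpace.Completion (InvSpinors q)

/-- The inclusion of the invariant spinors in `H^𝔥`. -/
def toH (q : Param) : InvSpinors q →ₗ[ℂ] HilbertInv q :=
  (UniformSpace.Completion.toComplₗᵢ (𝕜 := ℂ) (E := InvSpinors q)).toLinearMap

/-- Multiplication of an invariant spinor by an element of the Podleś sphere from the left. -/
def podlesMul (q : Param) (t : podles q) : InvSpinors q →ₗ[ℂ] InvSpinors q where
  toFun ψ := ⟨fun i => (t : SUq q) * ψ.val i, by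
    have ht : actK q (t : SUq q) = t := by rw [← act_k]; exact t.2
    have h := (mem_invSpinors q _).1 ψ.val_mem
    rw [mem_invSpinors, map_mul, map_mul, ht, ← mul_smul_comm, ← mul_smul_comm, h.1, h.2]
    exact ⟨rfl, rfl⟩⟩
  map_add' φ ψ := Subtype.ext (funext fun i => by simp [mul_add]; rfl)
  map_smul' z ψ := Subtype.ext (funext fun i => by simp; rfl)

/-- The chirality `Diag(1, -1)` on invariant spinors. -/
def chirality (q : Param) : InvSpinors q →ₗ[ℂ] InvSpinors q where
  toFun ψ := ⟨![ψ.val 0, -ψ.val 1], by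
    have h := (mem_invSpinors q _).1 ψ.val_mem
    rw [mem_invSpinors]
    simp [h.1, h.2]⟩
  map_add' φ ψ := Subtype.ext (by
    funext i
    fin_cases i
    · rfl
    · exact neg_add _ _)
  map_smul' z ψ := Subtype.ext (by
    funext i
    fin_cases i
    · rfl
    · exact (smul_neg z (ψ.val 1)).symm)

/-! ## The Dirac operator -/

/-- The covariant basis `θ|1,1⟩, θ|1,0⟩, θ|1,-1⟩` of the quantum Lie algebra in `U_q(su_2)`. -/
def theta (q : Param) : Fin 3 → Uq q :=
  ![Uq.of q .kinv * Uq.of q .e,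
    ((Real.sqrt (qnum q 2) : ℂ))⁻¹ • ((qc q)⁻¹ • (Uq.of q .f * Uq.of q .e)
      - qc q • (Uq.of q .e * Uq.of q .f)),
    -(Uq.of q .kinv * Uq.of q .f)]

/-- The covariant basis `ψ_1, ψ_0, ψ_{-1}` of the space `Ψ_q` in `B(Σ)`. -/
def psi (q : Param) : Fin 3 → Matrix (Fin 2) (Fin 2) ℂ :=
  ![!![0, qh q; 0, 0],
    -((Real.sqrt (qnum q 2) : ℂ))⁻¹ • !![(qc q)⁻¹, 0; 0, -qc q],
    !![0, 0; -(qh q)⁻¹, 0]]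

/-- The module isomorphism `σ` from the dual basis `⟨1,1|, ⟨1,0|, ⟨1,-1|` to `Ψ_q`. -/
def sigma (q : Param) : Fin 3 → Matrix (Fin 2) (Fin 2) ℂ :=
  ![-(qc q * qnumc q 2) • psi q 2, qnumc q 2 • psi q 1,
    -((qc q)⁻¹ * qnumc q 2) • psi q 0]

/-- The element `u ⊗ N` of `U_q(su_2) ⊗ B(Σ) = M_2(U_q(su_2))`. -/
def elemTensor {q : Param} (u : Uq q) (N : Matrix (Fin 2) (Fin 2) ℂ) :
    Matrix (Fin 2) (Fin 2) (Uq q) := N.map fun z => z • u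

/-- The projected algebraic Dirac element `(θ ⊗ σ)(Ω')`, where `Ω' = pΩ` omits the zero-weight
term of `Ω = ∑_n |1,n⟩ ⊗ ⟨1,n|`. -/
def diracElem (q : Param) : Matrix (Fin 2) (Fin 2) (Uq q) :=
  elemTensor (theta q 0) (sigma q 0) + elemTensor (theta q 2) (sigma q 2)

lemma diracElem_eq (q : Param) : diracElem q = qnumc q 2 •
    !![0, (qh q)⁻¹ • (Uq.of q .kinv * Uq.of q .f); qh q • (Uq.of q .kinv * Uq.of q .e), 0] := by
  have h0 := qh_ne q
  ext i j
  fin_cases i <;> fin_cases j <;>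
    simp [diracElem, elemTensor, theta, sigma, psi, smul_smul, ← qh_mul_qh]
  all_goals
    congr 1
    field_simp

lemma diracElem_act (q : Param) (ψ : Spinors q) : matAct q (diracElem q) ψ =
    ![(qnumc q 2 * (qh q)⁻¹) • actKinv q (actF q (ψ 1)),
      (qnumc q 2 * qh q) • actKinv q (actE q (ψ 0))] := by
  rw [diracElem_eq]
  ext i
  fin_cases i <;> simp [matAct, act_e, act_f, act_kinv, smul_smul]

/-- The algebraic Dirac operator `(∂ ⊗ id)((θ ⊗ σ)(Ω'))` on invariant spinors. -/
def dirac (q : Param) : InvSpinors q →ₗ[ℂ] InvSpinors q where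
  toFun ψ := ⟨matAct q (diracElem q) ψ.val, by
    have h0 := qh_ne q
    have h := (mem_invSpinors q _).1 ψ.val_mem
    have h1 : actK q (ψ.val 0) = (qh q)⁻¹ • ψ.val 0 := by
      conv_rhs => rw [← h.1, smul_smul, inv_mul_cancel₀ h0, one_smul]
    have h2 : actK q (ψ.val 1) = qh q • ψ.val 1 := by
      conv_rhs => rw [← h.2, smul_smul, mul_inv_cancel₀ h0, one_smul]
    rw [mem_invSpinors, diracElem_act]
    simp only [Matrix.cons_val_zero, Matrix.cons_val_one, map_smul, actK_actKinv]
    have hF : actKinv q (actK q (actF q (ψ.val 1))) = (qh q)⁻¹ • actKinv q (actF q (ψ.val 1)) := by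
      rw [actK_actF, h2, map_smul, map_smul, map_smul, smul_smul, ← qh_mul_qh, mul_inv,
        inv_mul_cancel_right₀ h0]
    have hE : actKinv q (actK q (actE q (ψ.val 0))) = qh q • actKinv q (actE q (ψ.val 0)) := by
      rw [actK_actE, h1, map_smul, map_smul, map_smul, smul_smul, ← qh_mul_qh,
        mul_inv_cancel_right₀ h0]
    rw [actKinv_actK] at hF hE
    constructor
    · conv_lhs => rw [hF]
      rw [smul_smul, smul_smul]
      congr 1
      field_simp
    · conv_lhs => rw [hE]
      rw [smul_smul, smul_smul]
      congr 1
      field_simp⟩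
  map_add' φ ψ := Subtype.ext (by simp; rfl)
  map_smul' z ψ := Subtype.ext (by simp; rfl)

/-- The graph of the algebraic Dirac operator with domain the invariant spinors, in
`H^𝔥 × H^𝔥`. -/
def diracGraph (q : Param) : Submodule ℂ (HilbertInv q × HilbertInv q) :=
  LinearMap.range ((toH q).prod (toH q ∘ₗ dirac q))

/-! ## Spectral triples -/

/-- An even spectral triple `(A, D, H)` with chirality `γ`. -/
structure IsEvenSpectralTriple {A H : Type*} [Ring A] [StarRing A] [Algebra ℂ A]
    [NormedAddCommGroup H] [InnerProductSpace ℂ H] [CompleteSpace H]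
    (ρ : A →⋆ₐ[ℂ] (H →L[ℂ] H)) (D : H →ₗ.[ℂ] H) (γ : H →L[ℂ] H) : Prop where
  separable : TopologicalSpace.SeparableSpace H
  faithful : Function.Injective ρ
  dense_domain : Dense (D.domain : Set H)
  selfAdjoint : IsSelfAdjoint D
  /-- `ρ(t)` preserves the domain of `D`, and `[D, ρ(t)]` extends to a bounded operator. -/
  commutator : ∀ t : A, ∃ C : H →L[ℂ] H, ∀ x : D.domain, ∃ hx : ρ t x ∈ D.domain,
    D ⟨ρ t x, hx⟩ - ρ t (D x) = C x
  /-- `D` has compact resolvent: `(D + i)⁻¹` is a compact operator. -/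
  compact_resolvent : ∃ R : H →L[ℂ] H, IsCompactOperator R ∧
    (∀ x : H, ∃ hx : R x ∈ D.domain, D ⟨R x, hx⟩ + Complex.I • R x = x) ∧
    (∀ x : D.domain, R (D x + Complex.I • (x : H)) = x)
  chirality_selfAdjoint : IsSelfAdjoint γ
  chirality_sq : γ * γ = 1
  chirality_comm : ∀ t : A, γ * ρ t = ρ t * γ
  chirality_anticomm : ∀ x : D.domain, ∃ hx : γ x ∈ D.domain, γ (D x) + D ⟨γ x, hx⟩ = 0

universe u

/-- For a self-adjoint operator `D`, the operator `(1 + D²)^{-p/2}` is of trace class: `D` has an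
orthonormal basis of eigenvectors, and `∑ (1 + λ²)^{-p/2} < ∞` over the eigenvalues, counted with
multiplicity. -/
def PowerTraceClass {H : Type u} [NormedAddCommGroup H] [InnerProductSpace ℂ H] [CompleteSpace H]
    (D : H →ₗ.[ℂ] H) (p : ℝ) : Prop :=
  ∃ (ι : Type u) (v : HilbertBasis ι ℂ H) (ev : ι → ℝ),
    (∀ i, ∃ hi : v i ∈ D.domain, D ⟨v i, hi⟩ = (ev i : ℂ) • v i) ∧
    Summable fun i => (1 + ev i ^ 2) ^ (-p / 2)

/-- `D` is `0`-summable: `(1 + D²)^{-p/2}` is of trace class for every `p > 0`. -/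
def IsZeroSummable {H : Type u} [NormedAddCommGroup H] [InnerProductSpace ℂ H] [CompleteSpace H]
    (D : H →ₗ.[ℂ] H) : Prop :=
  ∀ p : ℝ, 0 < p → PowerTraceClass D p

end QSphere

end

open QSphere

/-! The proof makes the Peter–Weyl decomposition explicit. The monomials a^i b^j are highest weight
vectors for ∂: ∂(e) kills them and ∂(k) scales them by q^{(i+j)/2}. The vectors ∂(f)^m(a^i b^j) with
m ≤ i+j span ℂ[SU_q(2)] (`span_pw`), because the span of all ∂(f)^m(a^i b^j) is stable under right
multiplication by the generators (`lowered_eq_top`).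

A Haar state is written down as a weighted trace `haarFun` in a representation on functions on ℕ ×
ℤ. There ∂(e), ∂(f), ∂(k) are implemented by operators, so that `haarFun` of ∂(e)t or ∂(f)t is a
telescoping series with sum zero. Invariance makes ∂(e) and ∂(f) mutually adjoint; with the
commutation relation of e and f this makes the Peter–Weyl vectors orthogonal with strictly positive
norms, which is positivity of the state (`haarFun_pos`). Left invariance follows since Δ intertwines
∂ with ∂ ⊗ id, and uniqueness from the transposition automorphism, so `haar` is this functional
(`haar_eq`).

On invariant spinors the two components have weights -1/2 and 1/2. For t = a^i b^j with i+j = 2n+1,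
the vectors ∂(f)^{n+1} t and ∂(f)^n t have these weights, and ∂(e)∂(f)^{n+1} t = [n+1]² ∂(f)^n t. On
this pair the Dirac operator is a 2×2 matrix with eigenvalues ±[2][n+1]; the 2n+2 choices of (i,j)
give the multiplicity. The eigenspinors span all invariant spinors (`span_eigSpinor`), so their
normalizations form a Hilbert basis, and the closure of the Dirac operator is the maximal diagonal
operator in that basis (`diagGraph_eq_closure`). Self-adjointness is then Parseval's identity;
compact resolvent and 0-summability follow from [n+1] ≥ q^{-n}.

Left multiplications are bounded because of a^*a + q²b^*b = 1 and aa^* + bb^* = 1. By the twisted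
Leibniz rule the commutator with t in the Podleś sphere consists of left multiplications by
multiples of ∂(e)t and ∂(f)t, hence is bounded too. -/

noncomputable section

namespace QSphere

namespace SUq

variable {q : Param}

/-! ### Monomials in `a`, `b` and the spanning set `∂(f)^m (a^i b^j)` -/

/-- The highest weight vector `a^i b^j`. -/
def mono (q : Param) (i j : ℕ) : SUq q := of q .a ^ i * of q .b ^ j

lemma actK_pow_a (i : ℕ) : actK q (of q .a ^ i) = qh q ^ i • of q .a ^ i := by
  rw [map_pow, actK_of]; simp [smul_pow]

lemma actK_pow_b (i : ℕ) : actK q (of q .b ^ i) = qh q ^ i • of q .b ^ i := by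
  rw [map_pow, actK_of]; simp [smul_pow]

lemma actKinv_pow_a (i : ℕ) : actKinv q (of q .a ^ i) = (qh q)⁻¹ ^ i • of q .a ^ i := by
  rw [map_pow, actKinv_of]; simp [smul_pow]

lemma actKinv_pow_b (i : ℕ) : actKinv q (of q .b ^ i) = (qh q)⁻¹ ^ i • of q .b ^ i := by
  rw [map_pow, actKinv_of]; simp [smul_pow]

lemma actK_mono (i j : ℕ) : actK q (mono q i j) = qh q ^ (i + j) • mono q i j := by
  rw [mono, map_mul, actK_pow_a, actK_pow_b, smul_mul_smul_comm, pow_add]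

lemma actKinv_of_actK {t : SUq q} {z : ℂ} (hz : z ≠ 0) (h : actK q t = z • t) :
    actKinv q t = z⁻¹ • t := by
  have := congrArg (actKinv q) h
  rw [actKinv_actK, map_smul] at this
  conv_rhs => rw [this, smul_smul, inv_mul_cancel₀ hz, one_smul]

lemma actE_pow_a (i : ℕ) : actE q (of q .a ^ i) = 0 := by
  induction i with
  | zero => simpa using actE_algebraMap (q := q) 1
  | succ i ih => rw [pow_succ, actE_mul, ih, actE_of]; simp

lemma actE_pow_b (i : ℕ) : actE q (of q .b ^ i) = 0 := by
  induction i with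
  | zero => simpa using actE_algebraMap (q := q) 1
  | succ i ih => rw [pow_succ, actE_mul, ih, actE_of]; simp

lemma actE_mono (i j : ℕ) : actE q (mono q i j) = 0 := by
  rw [mono, actE_mul, actE_pow_a, actE_pow_b]; simp

lemma b_pow_mul_a (k : ℕ) : of q .b ^ k * of q .a = qc q ^ k • (of q .a * of q .b ^ k) := by
  induction k with
  | zero => simp
  | succ k ih =>
    rw [pow_succ, mul_assoc, rel_b_a, mul_smul_comm, ← mul_assoc, ih, smul_mul_assoc, mul_assoc,
      smul_smul, pow_succ, mul_comm (qc q)]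

lemma qh_pos_real (q : Param) : 0 < Real.sqrt (q : ℝ) := Real.sqrt_pos.2 q.2.1

/-- Only the sign of the coefficient matters later: positivity rules out cancellation when
coefficients are added in `mono_mul_bs_mem`. The same applies to `actF_pow_a`. -/
lemma actF_pow_b (j : ℕ) : ∃ c : ℝ, 0 < c ∧
    actF q (of q .b ^ (j + 1)) = (c : ℂ) • (of q .b ^ j * of q .as) := by
  have hu := qh_pos_real q
  have hq := q.2.1
  induction j with
  | zero => exact ⟨(q : ℝ)⁻¹, inv_pos.2 hq, by simp [actF_of, qc]⟩
  | succ j ih =>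
    obtain ⟨c, hc, h⟩ := ih
    refine ⟨Real.sqrt q * q * c + (Real.sqrt q)⁻¹ ^ (j + 1) * (q : ℝ)⁻¹, by positivity, ?_⟩
    rw [pow_succ, actF_mul, h, actF_of, actK_of, actKinv_pow_b]
    simp only [smul_mul_assoc, mul_smul_comm, mul_assoc, rel_as_b, smul_smul]
    rw [← mul_assoc (of q .b ^ j), ← pow_succ, ← add_smul]
    congr 1
    simp only [qh, qc]; push_cast; ring

lemma actF_pow_a (i : ℕ) : ∃ d : ℝ, 0 < d ∧
    actF q (of q .a ^ (i + 1)) = -(d : ℂ) • (of q .a ^ i * of q .bs) := by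
  have hu := qh_pos_real q
  have hq := q.2.1
  induction i with
  | zero => exact ⟨1, one_pos, by simp [actF_of]⟩
  | succ i ih =>
    obtain ⟨d, hd, h⟩ := ih
    refine ⟨Real.sqrt q * q * d + (Real.sqrt q)⁻¹ ^ (i + 1), by positivity, ?_⟩
    rw [pow_succ, actF_mul, h, actF_of, actK_of, actKinv_pow_a]
    simp only [smul_mul_assoc, mul_smul_comm, mul_assoc, rel_bs_a, smul_smul, mul_neg]
    rw [← mul_assoc (of q .a ^ i), ← pow_succ, ← neg_smul, ← add_smul]
    congr 1
    simp only [qh, qc]; push_cast; ring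

/-- Moving one a past b^j and using aa^* = 1 - bb^* trades a factor a^* for a factor b^*. -/
lemma mul_mono_as (i j : ℕ) : mono q (i + 1) j * of q .as =
    (qc q ^ j)⁻¹ • (mono q i j - mono q i (j + 1) * of q .bs) := by
  have h0 : qc q ^ j ≠ 0 := pow_ne_zero _ (qc_ne q)
  have h : of q .a * of q .b ^ j = (qc q ^ j)⁻¹ • (of q .b ^ j * of q .a) := by
    rw [b_pow_mul_a, smul_smul, inv_mul_cancel₀ h0, one_smul]
  rw [mono, pow_succ, mul_assoc (of q .a ^ i), h, mul_smul_comm, smul_mul_assoc, mul_assoc,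
    mul_assoc, rel_a_as, mul_sub, mul_sub, mul_one, ← rel_b_bs, mono, mono, pow_succ]
  simp only [mul_assoc]

/-- The span of the vectors `∂(f)^m (a^i b^j)`. -/
def lowered (q : Param) : Submodule ℂ (SUq q) :=
  Submodule.span ℂ (Set.range fun x : ℕ × ℕ × ℕ => (actF q ^ x.2.2) (mono q x.1 x.2.1))

lemma mem_lowered (i j m : ℕ) : (actF q ^ m) (mono q i j) ∈ lowered q :=
  Submodule.subset_span ⟨(i, j, m), rfl⟩

lemma mono_mem_lowered (i j : ℕ) : mono q i j ∈ lowered q := mem_lowered i j 0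

lemma actF_mem_lowered {t : SUq q} (ht : t ∈ lowered q) : actF q t ∈ lowered q := by
  have : lowered q ≤ (lowered q).comap (actF q) := by
    refine Submodule.span_le.2 ?_
    rintro _ ⟨⟨i, j, m⟩, rfl⟩
    change actF q ((actF q ^ m) (mono q i j)) ∈ lowered q
    rw [← Module.End.mul_apply, ← pow_succ']
    exact mem_lowered i j (m + 1)
  exact this ht

lemma actF_pow_mem_lowered {t : SUq q} (ht : t ∈ lowered q) (m : ℕ) :
    (actF q ^ m) t ∈ lowered q := by
  induction m with
  | zero => exact ht
  | succ m ih => rw [pow_succ']; exact actF_mem_lowered ih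

/-- The product is solved for in the formula for ∂(f)(a^{i+1} b^j). If j > 0 the formula reads α a^i
b^{j-1} - β a^i b^j b^* with β a sum of two positive numbers, so β can be divided out; if j = 0
there is only one term. -/
lemma mono_mul_bs_mem (i j : ℕ) : mono q i j * of q .bs ∈ lowered q := by
  have hu := qh_pos_real q
  have hq := q.2.1
  obtain ⟨d, hd, h⟩ := actF_pow_a (q := q) i
  have hF := actF_mem_lowered (mono_mem_lowered (q := q) (i + 1) j)
  cases j with
  | zero =>
    simp only [mono, pow_zero, mul_one, h] at hF ⊢
    have hd' : -(d : ℂ) ≠ 0 := by simpa using hd.ne'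
    exact (Submodule.smul_mem_iff _ hd').1 hF
  | succ j =>
    obtain ⟨c, hc, h'⟩ := actF_pow_b (q := q) j
    have key : actF q (mono q (i + 1) (j + 1)) =
        (((Real.sqrt q)⁻¹ ^ (i + 1) * c * ((q : ℝ) ^ j)⁻¹ : ℝ) : ℂ) • mono q i j -
        ((d * Real.sqrt q ^ (j + 1) + (Real.sqrt q)⁻¹ ^ (i + 1) * c * ((q : ℝ) ^ j)⁻¹ : ℝ) : ℂ) •
          (mono q i (j + 1) * of q .bs) := by
      have hb : of q .bs * of q .b ^ (j + 1) = of q .b ^ (j + 1) * of q .bs :=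
        (Commute.pow_left (rel_b_bs q) (j + 1)).eq.symm
      rw [mono, actF_mul, h, h', actKinv_pow_a, actK_pow_b, smul_mul_smul_comm,
        smul_mul_smul_comm, mul_assoc, hb, ← mul_assoc, ← mul_assoc]
      change _ • (mono q i (j + 1) * _) + _ • (mono q (i + 1) j * _) = _
      rw [mul_mono_as]
      simp only [qh, qc]; push_cast
      module
    have hpos : ((d * Real.sqrt q ^ (j + 1) +
        (Real.sqrt q)⁻¹ ^ (i + 1) * c * ((q : ℝ) ^ j)⁻¹ : ℝ) : ℂ) ≠ 0 := by
      rw [Complex.ofReal_ne_zero]; positivity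
    refine (Submodule.smul_mem_iff _ hpos).1 ?_
    have h1 := Submodule.smul_mem (lowered q)
      (((Real.sqrt q)⁻¹ ^ (i + 1) * c * ((q : ℝ) ^ j)⁻¹ : ℝ) : ℂ) (mono_mem_lowered i j)
    rw [key] at hF
    exact (Submodule.sub_mem_iff_right _ h1).1 hF

lemma mono_mul_as_mem (i j : ℕ) : mono q i j * of q .as ∈ lowered q := by
  cases i with
  | succ i =>
    rw [mul_mono_as]
    exact Submodule.smul_mem _ _ (sub_mem (mono_mem_lowered i j) (mono_mul_bs_mem i (j + 1)))
  | zero =>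
    obtain ⟨c, hc, h⟩ := actF_pow_b (q := q) j
    have hF := actF_mem_lowered (mono_mem_lowered (q := q) 0 (j + 1))
    simp only [mono, pow_zero, one_mul, h] at hF ⊢
    exact (Submodule.smul_mem_iff _ (by simpa using hc.ne')).1 hF

/-! ### Weights -/

lemma actK_actF_pow {t : SUq q} {n : ℤ} (h : actK q t = qh q ^ n • t) (m : ℕ) :
    actK q ((actF q ^ m) t) = qh q ^ (n - 2 * m) • (actF q ^ m) t := by
  have h0 := qh_ne q
  induction m with
  | zero => simpa using h
  | succ m ih =>
    rw [pow_succ', Module.End.mul_apply, actK_actF, ih, map_smul, smul_smul, ← qh_mul_qh]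
    congr 1
    rw [Nat.cast_succ, mul_add, ← sub_sub, zpow_sub₀ h0 (n - 2 * m)]
    field_simp
    rfl

lemma actKinv_actF_pow {t : SUq q} {n : ℤ} (h : actK q t = qh q ^ n • t) (m : ℕ) :
    actKinv q ((actF q ^ m) t) = (qh q ^ (n - 2 * m))⁻¹ • (actF q ^ m) t :=
  actKinv_of_actK (zpow_ne_zero _ (qh_ne q)) (actK_actF_pow h m)

lemma actK_mono' (i j : ℕ) : actK q (mono q i j) = qh q ^ ((i + j : ℕ) : ℤ) • mono q i j := by
  rw [zpow_natCast, actK_mono]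

/-- Right multiplication by a generator `y` annihilated by `∂(f)`. -/
lemma actF_pow_mul {y : SUq q} {z : ℂ} (hK : actK q y = z • y) (hF : actF q y = 0)
    (t : SUq q) (m : ℕ) : (actF q ^ m) (t * y) = z ^ m • ((actF q ^ m) t * y) := by
  induction m with
  | zero => simp
  | succ m ih =>
    rw [pow_succ', Module.End.mul_apply, ih, map_smul, actF_mul, hF, hK, mul_zero, add_zero,
      mul_smul_comm, smul_smul, pow_succ]
    rfl

/-- Right multiplication by a generator `x` with `∂(f)x = y`, `∂(f)y = 0`. -/
lemma actF_pow_mul_succ {x y : SUq q} {z w : ℂ} (hx : actK q x = z • x) (hy : actK q y = w • y)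
    (hxy : actF q x = y) (hF : actF q y = 0) {t : SUq q} {n : ℤ} (h : actK q t = qh q ^ n • t)
    (m : ℕ) : ∃ r : ℂ, (actF q ^ (m + 1)) (t * x) =
      z ^ (m + 1) • ((actF q ^ (m + 1)) t * x) + r • ((actF q ^ m) t * y) := by
  induction m with
  | zero =>
    refine ⟨(qh q ^ n)⁻¹, ?_⟩
    simp [actF_mul, hx, hxy, actKinv_of_actK (zpow_ne_zero _ (qh_ne q)) h]
  | succ m ih =>
    obtain ⟨r, hr⟩ := ih
    refine ⟨z ^ (m + 1) * (qh q ^ (n - 2 * (m + 1 : ℕ)))⁻¹ + r * w, ?_⟩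
    rw [pow_succ', Module.End.mul_apply, hr, map_add, map_smul, map_smul, actF_mul, actF_mul, hF,
      hx, hy, hxy, actKinv_actF_pow h, ← Module.End.mul_apply, ← Module.End.mul_apply, ← pow_succ',
      ← pow_succ']
    simp only [mul_smul_comm, smul_mul_assoc, mul_zero, add_zero]
    module

/-- Since ∂(f) kills y, ∂(f)^m(t)·y is a nonzero multiple of ∂(f)^m(ty), which reduces the claim to
m = 0. -/
lemma lowered_mul_lower {y : SUq q} {z : ℂ} (hz : z ≠ 0) (hK : actK q y = z • y)
    (hF : actF q y = 0) (hy : ∀ i j, mono q i j * y ∈ lowered q) (i j m : ℕ) :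
    (actF q ^ m) (mono q i j) * y ∈ lowered q := by
  have := actF_pow_mem_lowered (hy i j) m
  rw [actF_pow_mul hK hF] at this
  exact (Submodule.smul_mem_iff _ (pow_ne_zero _ hz)).1 this

/-- Expanding ∂(f)^{m+1}(tx) gives the wanted product plus a multiple of ∂(f)^m(t)·y, and the latter
is covered by `lowered_mul_lower`. -/
lemma lowered_mul_raise {x y : SUq q} {z w : ℂ} (hz : z ≠ 0) (hw : w ≠ 0)
    (hx : actK q x = z • x) (hy : actK q y = w • y)
    (hxy : actF q x = y) (hF : actF q y = 0) (hm : ∀ i j, mono q i j * y ∈ lowered q)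
    (hm' : ∀ i j, mono q i j * x ∈ lowered q) (i j m : ℕ) :
    (actF q ^ m) (mono q i j) * x ∈ lowered q := by
  cases m with
  | zero => exact hm' i j
  | succ m =>
    obtain ⟨r, hr⟩ := actF_pow_mul_succ hx hy hxy hF (actK_mono' i j) m
    have h1 := actF_pow_mem_lowered (hm' i j) (m + 1)
    have h2 := Submodule.smul_mem _ r (lowered_mul_lower hw hy hF hm i j m)
    rw [hr] at h1
    exact (Submodule.smul_mem_iff _ (pow_ne_zero _ hz)).1 ((Submodule.add_mem_iff_left _ h2).1 h1)

lemma lowered_mul_of (x : SUGen) (i j m : ℕ) :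
    (actF q ^ m) (mono q i j) * of q x ∈ lowered q := by
  have h0 := qh_ne q
  have hbs : ∀ i j, mono q i j * -of q .bs ∈ lowered q := fun i j => by
    rw [mul_neg]; exact neg_mem (mono_mul_bs_mem i j)
  have has : ∀ i j, mono q i j * ((qc q)⁻¹ • of q .as) ∈ lowered q := fun i j => by
    rw [mul_smul_comm]; exact Submodule.smul_mem _ _ (mono_mul_as_mem i j)
  cases x with
  | as =>
    exact lowered_mul_lower (inv_ne_zero h0) (actK_of _) (actF_of _) mono_mul_as_mem i j m
  | bs =>
    exact lowered_mul_lower (inv_ne_zero h0) (actK_of _) (actF_of _) mono_mul_bs_mem i j m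
  | a =>
    refine lowered_mul_raise (y := -of q .bs) h0 (inv_ne_zero h0) (actK_of _) ?_ (actF_of _) ?_ hbs
      ?_ i j m
    · rw [map_neg, actK_of, smul_neg]
    · rw [map_neg, actF_of, neg_zero]
    · intro i j
      rw [mono, mul_assoc, b_pow_mul_a, mul_smul_comm, ← mul_assoc, ← pow_succ]
      exact Submodule.smul_mem _ _ (mono_mem_lowered (i + 1) j)
  | b =>
    refine lowered_mul_raise (y := (qc q)⁻¹ • of q .as) h0 (inv_ne_zero h0) (actK_of _) ?_
      (actF_of _) ?_ has ?_ i j m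
    · rw [map_smul, actK_of, smul_comm]
    · rw [map_smul, actF_of, smul_zero]
    · intro i j
      rw [mono, mul_assoc, ← pow_succ]
      exact mono_mem_lowered i (j + 1)

/-- The span contains 1 and is a right ideal, as right multiplication by each generator preserves
it. -/
lemma lowered_eq_top (q : Param) : lowered q = ⊤ := by
  have h : ∀ t s : SUq q, s ∈ lowered q → s * t ∈ lowered q := by
    intro t
    induction t using SUq.induction with
    | hs z =>
      intro s hs
      rw [← Algebra.commutes, ← Algebra.smul_def]
      exact Submodule.smul_mem _ _ hs
    | hg x =>
      intro s hs
      have : lowered q ≤ (lowered q).comap (LinearMap.mulRight ℂ (of q x)) := by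
        refine Submodule.span_le.2 ?_
        rintro _ ⟨⟨i, j, m⟩, rfl⟩
        exact lowered_mul_of x i j m
      exact this hs
    | hm s t hs ht => intro r hr; rw [← mul_assoc]; exact ht _ (hs _ hr)
    | ha s t hs ht => intro r hr; rw [mul_add]; exact add_mem (hs _ hr) (ht _ hr)
  rw [eq_top_iff]
  intro t _
  have := h t 1 (by simpa [mono] using mono_mem_lowered (q := q) 0 0)
  rwa [one_mul] at this

lemma actF_pow_mul_of_ab {t : SUq q} {d : ℕ} (hK : actK q t = qh q ^ d • t)
    (hF : (actF q ^ (d + 1)) t = 0) {x : SUGen} (hx : x = .a ∨ x = .b) :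
    (actF q ^ (d + 1 + 1)) (t * of q x) = 0 := by
  have hF' : (actF q ^ (d + 1 + 1)) t = 0 := by
    rw [pow_succ', Module.End.mul_apply, hF, map_zero]
  rw [← zpow_natCast] at hK
  rcases hx with rfl | rfl
  · obtain ⟨r, hr⟩ := actF_pow_mul_succ (y := -of q .bs) (w := (qh q)⁻¹) (actK_of .a)
      (by rw [map_neg, actK_of, smul_neg]) (actF_of _) (by rw [map_neg, actF_of, neg_zero])
      hK (d + 1)
    rw [hr, hF, hF']; simp
  · obtain ⟨r, hr⟩ := actF_pow_mul_succ (y := (qc q)⁻¹ • of q .as) (w := (qh q)⁻¹) (actK_of .b)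
      (by rw [map_smul, actK_of, smul_comm]) (actF_of _) (by rw [map_smul, actF_of, smul_zero])
      hK (d + 1)
    rw [hr, hF, hF']; simp

/-- A highest weight vector of degree d generates a chain of at most d + 1 vectors; each extra
factor a or b, being killed by ∂(f)², lengthens the chain by at most one. -/
lemma actF_pow_mono (i j : ℕ) : (actF q ^ (i + j + 1)) (mono q i j) = 0 := by
  induction j with
  | zero =>
    induction i with
    | zero => simpa [mono] using actF_algebraMap (q := q) 1
    | succ i ih =>
      have : mono q (i + 1) 0 = mono q i 0 * of q .a := by simp [mono, pow_succ]
      rw [this]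
      exact actF_pow_mul_of_ab (actK_mono i 0) ih (Or.inl rfl)
  | succ j ih =>
    have : mono q i (j + 1) = mono q i j * of q .b := by rw [mono, mono, pow_succ, mul_assoc]
    rw [this]
    exact actF_pow_mul_of_ab (actK_mono i j) ih (Or.inr rfl)

/-! ### Raising along a lowering chain -/

/-- The coefficient `[m][d + 1 - m]` in `∂(e)∂(f)^m t` for a highest weight vector `t` of weight
`d / 2`. -/
def casimirCoeff (q : Param) (d : ℤ) (m : ℕ) : ℝ :=
  ((q : ℝ) ^ (m : ℤ) - ((q : ℝ) ^ (m : ℤ))⁻¹) *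
    ((q : ℝ) ^ (d + 1 - m) - ((q : ℝ) ^ (d + 1 - m))⁻¹) / ((q : ℝ) - (q : ℝ)⁻¹) ^ 2

lemma sub_inv_neg_of_pos {n : ℤ} (hn : 0 < n) : (q : ℝ) ^ n - ((q : ℝ) ^ n)⁻¹ < 0 := by
  have h1 : (q : ℝ) ^ n < 1 := zpow_lt_one₀ q.2.1 q.2.2 hn
  have h2 : 1 < ((q : ℝ) ^ n)⁻¹ := (one_lt_inv₀ (zpow_pos q.2.1 n)).2 h1
  linarith

/-- This is [m+1][d-m] = [m][d+1-m] + [d-2m]; the last term is the value of (k² - k⁻²)/(q - q⁻¹) on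
the m-th vector of the chain. -/
lemma casimirCoeff_succ (d : ℤ) (m : ℕ) : casimirCoeff q d (m + 1) = casimirCoeff q d m +
    ((q : ℝ) ^ (d - 2 * m) - ((q : ℝ) ^ (d - 2 * m))⁻¹) / ((q : ℝ) - (q : ℝ)⁻¹) := by
  have hq := q.2.1.ne'
  have h1 : (q : ℝ) - (q : ℝ)⁻¹ ≠ 0 := by
    simpa using (sub_inv_neg_of_pos (q := q) (n := 1) one_pos).ne
  have e1 : d + 1 - ((m + 1 : ℕ) : ℤ) = d - m := by push_cast; ring
  have e2 : d - 2 * (m : ℤ) = d - m - m := by ring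
  have e3 : d + 1 - (m : ℤ) = d - m + 1 := by ring
  rw [casimirCoeff, casimirCoeff, e1, e2, e3, zpow_sub₀ hq (d - m), zpow_add₀ hq, Nat.cast_succ,
    zpow_add₀ hq, zpow_one]
  have hx : (q : ℝ) ^ (m : ℤ) ≠ 0 := zpow_ne_zero _ hq
  have hy : (q : ℝ) ^ (d - m) ≠ 0 := zpow_ne_zero _ hq
  generalize (q : ℝ) ^ (m : ℤ) = x at *
  generalize (q : ℝ) ^ (d - m) = y at *
  rw [div_add_div _ _ (pow_ne_zero 2 h1) h1, div_eq_div_iff (pow_ne_zero 2 h1)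
    (mul_ne_zero (pow_ne_zero 2 h1) h1)]
  field_simp
  ring

/-- Commuting ∂(e) past one ∂(f) adds the scalar by which [e,f] acts at the current weight, which is
the increment in `casimirCoeff_succ`. -/
lemma actE_actF_pow {t : SUq q} {d : ℤ} (hE : actE q t = 0) (hK : actK q t = qh q ^ d • t)
    (m : ℕ) : actE q ((actF q ^ (m + 1)) t) =
      (casimirCoeff q d (m + 1) : ℂ) • (actF q ^ m) t := by
  have h0 := qh_ne q
  have step : ∀ m : ℕ, actF q (actE q ((actF q ^ m) t)) =
      (casimirCoeff q d m : ℂ) • (actF q ^ m) t →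
      actE q ((actF q ^ (m + 1)) t) = (casimirCoeff q d (m + 1) : ℂ) • (actF q ^ m) t := by
    intro m h
    rw [pow_succ', Module.End.mul_apply,
      ← sub_add_cancel (actE q (actF q ((actF q ^ m) t))) (actF q (actE q ((actF q ^ m) t))),
      actE_actF_comm, h, actK_actF_pow hK, map_smul, actK_actF_pow hK, actKinv_actF_pow hK,
      map_smul, actKinv_actF_pow hK, smul_smul, smul_smul, ← mul_inv, ← mul_zpow, qh_mul_qh,
      ← sub_smul, smul_smul, ← add_smul, casimirCoeff_succ]
    congr 1
    simp only [qc]; push_cast; ring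
  induction m with
  | zero => exact step 0 (by simp [hE, casimirCoeff])
  | succ m ih =>
    refine step (m + 1) ?_
    rw [ih, map_smul, ← Module.End.mul_apply, ← pow_succ']

lemma casimirCoeff_pos {d : ℤ} {m : ℕ} (hm : 0 < m) (hd : (m : ℤ) ≤ d) :
    0 < casimirCoeff q d m := by
  have h1 := sub_inv_neg_of_pos (q := q) (n := m) (by exact_mod_cast hm)
  have h2 := sub_inv_neg_of_pos (q := q) (n := d + 1 - m) (by omega)
  have h3 := sub_inv_neg_of_pos (q := q) (n := 1) one_pos
  rw [zpow_one] at h3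
  exact div_pos (mul_pos_of_neg_of_neg h1 h2) (sq_pos_of_neg h3)

/-- At the middle of a chain of even length both q-numbers coincide. This perfect square is why the
Dirac eigenvalues are ±[2][n+1]. -/
lemma casimirCoeff_self (n : ℕ) : casimirCoeff q (2 * n + 1 : ℕ) (n + 1) = qnum q (n + 1) ^ 2 := by
  have : ((2 * n + 1 : ℕ) : ℤ) + 1 - ((n + 1 : ℕ) : ℤ) = (n + 1 : ℕ) := by push_cast; ring
  rw [casimirCoeff, this, qnum, zpow_natCast, div_pow, sq (_ ^ _ - _ : ℝ)]

/-! ### A representation on functions on `ℕ × ℤ` -/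

/-- The operator `a : e_{n,m} ↦ e_{n+1,m}`. -/
def opA : Module.End ℂ (ℕ → ℤ → ℂ) where
  toFun f n m := match n with
    | 0 => 0
    | n + 1 => f n m
  map_add' f g := by ext n m; cases n <;> simp
  map_smul' z f := by ext n m; cases n <;> simp

/-- The operator `e_{n,m} ↦ w_n e_{n-1,m+l}`, with `w_n` written at index `n - 1`. -/
def opLower (w : ℕ → ℂ) (l : ℤ) : Module.End ℂ (ℕ → ℤ → ℂ) where
  toFun f n m := w n * f (n + 1) (m - l)
  map_add' f g := by ext n m; simp [mul_add]
  map_smul' z f := by ext n m; simp [mul_left_comm]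

/-- The operator `e_{n,m} ↦ w_{n,m} e_{n,m+l}`, with `w` written at the target. -/
def opDiag (w : ℕ → ℤ → ℂ) (l : ℤ) : Module.End ℂ (ℕ → ℤ → ℂ) where
  toFun f n m := w n m * f n (m - l)
  map_add' f g := by ext n m; simp [mul_add]
  map_smul' z f := by ext n m; simp [mul_left_comm]

@[simp] lemma opA_zero (f : ℕ → ℤ → ℂ) (m : ℤ) : opA f 0 m = 0 := rfl
@[simp] lemma opA_succ (f : ℕ → ℤ → ℂ) (n : ℕ) (m : ℤ) : opA f (n + 1) m = f n m := rfl
@[simp] lemma opLower_apply (w : ℕ → ℂ) (l : ℤ) (f : ℕ → ℤ → ℂ) (n : ℕ) (m : ℤ) :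
    opLower w l f n m = w n * f (n + 1) (m - l) := rfl
@[simp] lemma opDiag_apply (w : ℕ → ℤ → ℂ) (l : ℤ) (f : ℕ → ℤ → ℂ) (n : ℕ) (m : ℤ) :
    opDiag w l f n m = w n m * f n (m - l) := rfl

/-- The representation on generators. -/
def repGen (q : Param) : SUGen → Module.End ℂ (ℕ → ℤ → ℂ)
  | .a => opA
  -- The basis is left unnormalized: `a` is a pure shift and `a^*` carries the whole factor 1 -
  -- q^{2(n+1)}, so no square roots appear.
  | .as => opLower (fun n => 1 - qc q ^ (2 * (n + 1))) 0
  | .b => opDiag (fun n _ => qc q ^ n) 1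
  | .bs => opDiag (fun n _ => qc q ^ n) (-1)

/-- The representation of `ℂ[SU_q(2)]` on functions on `ℕ × ℤ`. -/
def rep (q : Param) : SUq q →ₐ[ℂ] Module.End ℂ (ℕ → ℤ → ℂ) :=
  lift (repGen q) (by
    intro x y h
    cases h <;> ext f n m <;>
      simp only [map_mul, map_add, map_smul, map_one, FreeAlgebra.lift_ι_apply, repGen,
        Module.End.mul_apply, LinearMap.add_apply, LinearMap.smul_apply, Pi.add_apply,
        Pi.smul_apply, smul_eq_mul, Module.End.one_apply] <;>
      cases n <;> simp <;> ring)

lemma rep_of (x : SUGen) : rep q (of q x) = repGen q x := lift_of _ _ x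

/-- Translation in the second variable. -/
def shift (l : ℤ) : Module.End ℂ (ℕ → ℤ → ℂ) := opDiag (fun _ _ => 1) l

lemma shift_apply (l : ℤ) (f : ℕ → ℤ → ℂ) (n : ℕ) (m : ℤ) : shift l f n m = f n (m - l) := by
  simp [shift]

/-- Translation invariance in ℤ identifies the matrix elements that must cancel in the telescoping
sums below. -/
lemma rep_shift (t : SUq q) (l : ℤ) : rep q t * shift l = shift l * rep q t := by
  induction t using SUq.induction with
  | hs z => rw [AlgHom.commutes]; exact Algebra.commutes _ _
  | hg x =>
    rw [rep_of]
    ext f n m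
    cases x <;> cases n <;> simp [repGen, shift_apply, sub_right_comm] <;> simp [sub_add_eq_add_sub]
  | hm s t hs ht => rw [map_mul, mul_assoc, ht, ← mul_assoc, hs, mul_assoc]
  | ha s t hs ht => rw [map_add, add_mul, hs, ht, mul_add]

/-! ### Operators implementing the action -/

/-- The operator implementing `∂(k)`. -/
def opK (q : Param) (s : ℤ) : Module.End ℂ (ℕ → ℤ → ℂ) :=
  opDiag (fun n m => qh q ^ (s * (n + m))) 0

lemma rep_actK (t : SUq q) : rep q (actK q t) * opK q 1 = opK q 1 * rep q t := by
  have h0 := qh_ne q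
  induction t using SUq.induction with
  | hs z => rw [AlgHom.commutes, AlgHom.commutes]; exact Algebra.commutes _ _
  | hg x =>
    rw [actK_of]
    ext f n m
    cases x <;> cases n <;> simp [rep_of, repGen, opK, zpow_add₀, zpow_sub₀, h0] <;>
      field_simp <;> try ring
  | hm s t hs ht => rw [map_mul, map_mul, mul_assoc, ht, ← mul_assoc, hs, mul_assoc, map_mul]
  | ha s t hs ht => rw [map_add, map_add, add_mul, hs, ht, map_add, mul_add]

/-- The operator implementing `∂(f)`. -/
def opF (q : Param) : Module.End ℂ (ℕ → ℤ → ℂ) :=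
  opLower (fun n => -qh q / (1 - qc q ^ 2) * ((qc q ^ (n + 1))⁻¹ * (1 - qc q ^ (2 * (n + 1))))) (-1)

/-- The operator implementing `∂(e)`. -/
def opE (q : Param) : Module.End ℂ (ℕ → ℤ → ℂ) :=
  opDiag (fun n _ => -qh q / (1 - qc q ^ 2) * (qc q / qc q ^ n)) 1 * opA

lemma one_sub_qc_sq_ne (q : Param) : 1 - qc q ^ 2 ≠ 0 := by
  have h1 : (q : ℝ) ^ 2 < 1 := pow_lt_one₀ q.2.1.le q.2.2 two_ne_zero
  rw [qc, ← Complex.ofReal_pow, ← Complex.ofReal_one, ← Complex.ofReal_sub, Complex.ofReal_ne_zero]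
  linarith

lemma one_sub_qh_ne (q : Param) : 1 - qh q ^ 4 ≠ 0 := by
  have h : qh q ^ 4 = qc q ^ 2 := by rw [← qh_mul_qh]; ring
  rw [h]; exact one_sub_qc_sq_ne q

lemma qh_sq (q : Param) : qh q ^ 2 = qc q := by rw [sq, qh_mul_qh]

/-- The expression F·∂(k)t - ∂(k⁻¹)t·F satisfies the same twisted Leibniz rule as ∂(f), so agreement
on generators suffices. `rep_actE` rests on the same principle. -/
lemma rep_actF (t : SUq q) :
    rep q (actF q t) = opF q * rep q (actK q t) - rep q (actKinv q t) * opF q := by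
  have h0 := qh_ne q
  have h1 := one_sub_qh_ne q
  induction t using SUq.induction with
  | hs z =>
    rw [actF_algebraMap, AlgHom.commutes, AlgHom.commutes,
      AlgHom.commutes (actKinv q), AlgHom.commutes (rep q), map_zero, eq_comm,
      sub_eq_zero]
    exact (Algebra.commutes z (opF q)).symm
  | hg x =>
    rw [actF_of, actK_of, actKinv_of]
    ext f n m
    cases x <;> cases n <;>
      simp [rep_of, repGen, opF, ← qh_mul_qh] <;> field_simp <;> ring
  | hm s t hs ht =>
    rw [actF_mul, map_add, map_mul, map_mul, hs, ht, map_mul, map_mul, map_mul, map_mul]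
    simp only [sub_mul, mul_sub, mul_assoc]
    abel
  | ha s t hs ht => rw [map_add, map_add, hs, ht]; simp only [map_add]; noncomm_ring

lemma rep_actE (t : SUq q) :
    rep q (actE q t) = opE q * rep q (actK q t) - rep q (actKinv q t) * opE q := by
  have h0 := qh_ne q
  have h1 := one_sub_qh_ne q
  induction t using SUq.induction with
  | hs z =>
    rw [actE_algebraMap, AlgHom.commutes, AlgHom.commutes,
      AlgHom.commutes (actKinv q), AlgHom.commutes (rep q), map_zero, eq_comm,
      sub_eq_zero]
    exact (Algebra.commutes z (opE q)).symm
  | hg x =>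
    rw [actE_of, actK_of, actKinv_of]
    ext f n m
    cases x <;> cases n <;>
      simp [rep_of, repGen, opE, ← qh_mul_qh] <;> field_simp <;> ring
  | hm s t hs ht =>
    rw [actE_mul, map_add, map_mul, map_mul, hs, ht, map_mul, map_mul, map_mul, map_mul]
    simp only [sub_mul, mul_sub, mul_assoc]
    abel
  | ha s t hs ht => rw [map_add, map_add, hs, ht]; simp only [map_add]; noncomm_ring

lemma norm_one_sub_qc_pow_le (n : ℕ) : ‖1 - qc q ^ n‖ ≤ 1 := by
  rw [qc, ← Complex.ofReal_pow, ← Complex.ofReal_one, ← Complex.ofReal_sub,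
    Complex.norm_real, Real.norm_of_nonneg (sub_nonneg.2 (pow_le_one₀ q.2.1.le q.2.2.le))]
  have := pow_pos q.2.1 n
  linarith

/-- A sup-norm bound makes all matrix elements uniformly bounded, so series weighted by powers of q
converge. -/
lemma rep_bounded (t : SUq q) : ∃ C : ℝ, 0 ≤ C ∧ ∀ (f : ℕ → ℤ → ℂ) (B : ℝ),
    (∀ n m, ‖f n m‖ ≤ B) → ∀ n m, ‖rep q t f n m‖ ≤ C * B := by
  have hq0 := q.2.1
  have hq1 := q.2.2
  induction t using SUq.induction with
  | hs z =>
    refine ⟨‖z‖, norm_nonneg z, fun f B hf n m => ?_⟩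
    rw [AlgHom.commutes, Module.algebraMap_end_apply, Pi.smul_apply, Pi.smul_apply, norm_smul]
    exact mul_le_mul_of_nonneg_left (hf n m) (norm_nonneg z)
  | hg x =>
    refine ⟨1, zero_le_one, fun f B hf n m => ?_⟩
    have hB : 0 ≤ B := (norm_nonneg _).trans (hf 0 0)
    have hn : ‖qc q ^ n‖ ≤ 1 := by
      rw [norm_pow, qc, Complex.norm_real, Real.norm_of_nonneg hq0.le]
      exact pow_le_one₀ hq0.le hq1.le
    rw [rep_of]
    cases x with
    | a => cases n <;> simp [repGen, hB, hf]
    | as =>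
      simp only [repGen, opLower_apply, norm_mul]
      exact mul_le_mul (norm_one_sub_qc_pow_le _) (hf _ _) (norm_nonneg _) zero_le_one
    | b =>
      simp only [repGen, opDiag_apply, norm_mul]
      exact mul_le_mul hn (hf _ _) (norm_nonneg _) zero_le_one
    | bs =>
      simp only [repGen, opDiag_apply, norm_mul]
      exact mul_le_mul hn (hf _ _) (norm_nonneg _) zero_le_one
  | hm s t hs ht =>
    obtain ⟨C, hC, h⟩ := hs
    obtain ⟨D, hD, h'⟩ := ht
    refine ⟨C * D, mul_nonneg hC hD, fun f B hf n m => ?_⟩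
    rw [map_mul, Module.End.mul_apply, mul_assoc]
    exact h _ _ (h' f B hf) n m
  | ha s t hs ht =>
    obtain ⟨C, hC, h⟩ := hs
    obtain ⟨D, hD, h'⟩ := ht
    refine ⟨C + D, add_nonneg hC hD, fun f B hf n m => ?_⟩
    rw [map_add, LinearMap.add_apply, Pi.add_apply, Pi.add_apply, add_mul]
    exact norm_add_le_of_le (h f B hf n m) (h' f B hf n m)

/-- The indicator function of a point of `ℕ × ℤ`. -/
def delta (k : ℕ) (l : ℤ) : ℕ → ℤ → ℂ := fun n m => if n = k ∧ m = l then 1 else 0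

lemma norm_delta_le (k : ℕ) (l : ℤ) (n : ℕ) (m : ℤ) : ‖delta k l n m‖ ≤ 1 := by
  rw [delta]; split_ifs <;> simp

lemma shift_delta (s : ℤ) (k : ℕ) (l : ℤ) : shift s (delta k l) = delta k (l + s) := by
  ext n m; simp [shift_apply, delta, sub_eq_iff_eq_add]

lemma rep_delta_shift (t : SUq q) (s : ℤ) (k : ℕ) (l : ℤ) (n : ℕ) (m : ℤ) :
    rep q t (delta k (l + s)) n (m + s) = rep q t (delta k l) n m := by
  rw [← shift_delta, ← Module.End.mul_apply, rep_shift, Module.End.mul_apply, shift_apply,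
    add_sub_cancel_right]

lemma opK_delta (s : ℤ) (k : ℕ) (l : ℤ) :
    opK q s (delta k l) = qh q ^ (s * (k + l)) • delta k l := by
  ext n m
  simp only [opK, opDiag_apply, delta, sub_zero, Pi.smul_apply, smul_eq_mul]
  split_ifs with h
  · rw [h.1, h.2]
  · simp

lemma rep_actK_delta (t : SUq q) (k : ℕ) (l : ℤ) (n : ℕ) (m : ℤ) :
    rep q (actK q t) (delta k l) n m =
      qh q ^ ((n + m) - (k + l) : ℤ) * rep q t (delta k l) n m := by
  have h := congrArg (fun T : Module.End ℂ (ℕ → ℤ → ℂ) => T (delta k l) n m) (rep_actK t)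
  simp only [Module.End.mul_apply, opK_delta, map_smul, Pi.smul_apply, smul_eq_mul, one_mul] at h
  simp only [opK, opDiag_apply, sub_zero, one_mul] at h
  have h0 : qh q ^ ((k : ℤ) + l) ≠ 0 := zpow_ne_zero _ (qh_ne q)
  rw [zpow_sub₀ (qh_ne q), div_mul_eq_mul_div, eq_div_iff h0, ← h, mul_comm]

lemma rep_actKinv_delta (t : SUq q) (k : ℕ) (l : ℤ) (n : ℕ) (m : ℤ) :
    rep q (actKinv q t) (delta k l) n m =
      qh q ^ ((k + l) - (n + m) : ℤ) * rep q t (delta k l) n m := by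
  have h := rep_actK_delta (actKinv q t) k l n m
  rw [actK_actKinv] at h
  have h0 : qh q ^ ((n + m) - (k + l) : ℤ) ≠ 0 := zpow_ne_zero _ (qh_ne q)
  rw [h, ← mul_assoc, ← zpow_add₀ (qh_ne q)]
  simp

/-! ### The Haar functional -/

lemma norm_qc (q : Param) : ‖qc q‖ = q := by
  rw [qc, Complex.norm_real, Real.norm_of_nonneg q.2.1.le]

lemma summable_of_norm_le_geometric {f : ℕ → ℂ} (C : ℝ) (h : ∀ n, ‖f n‖ ≤ C * (q : ℝ) ^ n) :
    Summable f :=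
  Summable.of_norm_bounded ((summable_geometric_of_lt_one q.2.1.le q.2.2).mul_left C) h

lemma summable_rep_diag (t : SUq q) :
    Summable fun n : ℕ => qc q ^ (2 * n) * rep q t (delta n 0) n 0 := by
  obtain ⟨C, hC, h⟩ := rep_bounded t
  refine summable_of_norm_le_geometric (q := q) C fun n => ?_
  rw [norm_mul, norm_pow, norm_qc, mul_comm]
  refine mul_le_mul (by simpa using h _ 1 (norm_delta_le n 0) n 0) ?_
    (pow_nonneg q.2.1.le _) hC
  exact pow_le_pow_of_le_one q.2.1.le q.2.2.le (by omega)

/-- The functional `h(t) = (1 - q²) ∑_n q^{2n} ⟨e_{n,0}, t e_{n,0}⟩`. -/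
def haarFun (q : Param) : SUq q →ₗ[ℂ] ℂ where
  toFun t := (1 - qc q ^ 2) * ∑' n : ℕ, qc q ^ (2 * n) * rep q t (delta n 0) n 0
  map_add' s t := by
    rw [← mul_add, ← (summable_rep_diag s).tsum_add (summable_rep_diag t)]
    simp [mul_add]
  map_smul' z t := by
    rw [map_smul]
    simp only [LinearMap.smul_apply, Pi.smul_apply, smul_eq_mul, mul_left_comm _ z, tsum_mul_left,
      RingHom.id_apply]

lemma haarFun_apply (t : SUq q) : haarFun q t =
    (1 - qc q ^ 2) * ∑' n : ℕ, qc q ^ (2 * n) * rep q t (delta n 0) n 0 := rfl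

lemma haarFun_one : haarFun q 1 = 1 := by
  rw [haarFun_apply]
  have h : ‖qc q ^ 2‖ < 1 := by
    rw [norm_pow, norm_qc]; exact pow_lt_one₀ q.2.1.le q.2.2 two_ne_zero
  have : ∀ n : ℕ, qc q ^ (2 * n) * rep q 1 (delta n 0) n 0 = (qc q ^ 2) ^ n := by
    intro n; simp [delta, pow_mul]
  simp_rw [this]
  rw [tsum_geometric_of_norm_lt_one h, mul_inv_cancel₀ (one_sub_qc_sq_ne q)]

lemma haarFun_actK (t : SUq q) : haarFun q (actK q t) = haarFun q t := by
  simp [haarFun_apply, rep_actK_delta]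

lemma tsum_eq_zero_of_telescope {f g : ℕ → ℂ} (hg : Summable g) (h0 : f 0 = g 0)
    (h : ∀ n, f (n + 1) = g (n + 1) - g n) : ∑' n, f n = 0 := by
  have hg' := (summable_nat_add_iff 1).2 hg
  have hf : Summable f := by
    rw [← summable_nat_add_iff 1]
    simp_rw [h]
    exact hg'.sub hg
  rw [hf.tsum_eq_zero_add, h0]
  simp_rw [h]
  rw [hg'.tsum_sub hg, hg.tsum_eq_zero_add]
  ring

lemma opF_delta_zero (l : ℤ) : opF q (delta 0 l) = 0 := by
  ext n m; simp [opF, delta]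

lemma opF_delta_succ (k : ℕ) (l : ℤ) : opF q (delta (k + 1) l) =
    (-qh q / (1 - qc q ^ 2) * ((qc q ^ (k + 1))⁻¹ * (1 - qc q ^ (2 * (k + 1))))) •
      delta k (l - 1) := by
  ext n m
  simp only [opF, opLower_apply, delta, Pi.smul_apply, smul_eq_mul, sub_neg_eq_add,
    add_left_inj, ← eq_sub_iff_add_eq]
  split_ifs with h
  · rw [h.1]
  · simp

/-- By `rep_actF` each diagonal entry is a difference of two off-diagonal matrix elements of t. The
weight q^{2n} is what makes the subtracted one at n + 1 equal to the other at n; at n = 0 it is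
absent because F kills e_{0,0}. -/
lemma haarFun_actF (t : SUq q) : haarFun q (actF q t) = 0 := by
  have h0 := qh_ne q
  have hc := qc_ne q
  have h1 := one_sub_qc_sq_ne q
  obtain ⟨C, hC, hb⟩ := rep_bounded t
  rw [haarFun_apply]
  refine mul_eq_zero_of_right _ (tsum_eq_zero_of_telescope
    (g := fun n => -qh q / (1 - qc q ^ 2) * (qc q ^ n * (1 - qc q ^ (2 * (n + 1)))) *
      rep q t (delta n 0) (n + 1) 1) ?_ ?_ ?_)
  · refine summable_of_norm_le_geometric (q := q) (‖-qh q / (1 - qc q ^ 2)‖ * C) fun n => ?_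
    have e1 := norm_one_sub_qc_pow_le (q := q) (2 * (n + 1))
    have e2 : ‖rep q t (delta n 0) (n + 1) 1‖ ≤ C := by
      simpa using hb _ 1 (norm_delta_le n 0) (n + 1) 1
    rw [norm_mul, norm_mul, norm_mul, norm_pow, norm_qc]
    have hq := pow_nonneg q.2.1.le n
    calc _ ≤ ‖-qh q / (1 - qc q ^ 2)‖ * ((q : ℝ) ^ n * 1) * C := by gcongr
      _ = _ := by ring
  · simp only [rep_actF, LinearMap.sub_apply, Module.End.mul_apply, opF_delta_zero, map_zero,
      sub_zero, Pi.sub_apply, Pi.zero_apply]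
    simp only [opF, opLower_apply, rep_actK_delta]
    norm_num [← qh_mul_qh]
    field_simp
  · intro n
    -- Translation by one turns the element from (n,-1) to (n+1,0) into the one from (n,0) to
    -- (n+1,1) that occurs in g.
    have hs := rep_delta_shift t 1 n (-1) (n + 1) 0
    rw [neg_add_cancel, zero_add] at hs
    simp only [rep_actF, LinearMap.sub_apply, Module.End.mul_apply, opF_delta_succ, map_smul,
      Pi.sub_apply, Pi.smul_apply, smul_eq_mul, rep_actKinv_delta, zero_sub, ← hs]
    simp only [opF, opLower_apply, rep_actK_delta]
    have e1 : ((n + 1 + 1 : ℕ) : ℤ) + (0 - -1) - (((n + 1 : ℕ) : ℤ) + 0) = 2 := by push_cast; ring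
    have e2 : ((n : ℕ) : ℤ) + -1 - (((n + 1 : ℕ) : ℤ) + 0) = -2 := by push_cast; ring
    rw [e1, e2, zpow_neg, zpow_ofNat, qh_sq, zero_sub, neg_neg]
    field_simp
    ring

lemma opE_delta (k : ℕ) (l : ℤ) : opE q (delta k l) =
    (-qh q / (1 - qc q ^ 2) * (qc q ^ k)⁻¹) • delta (k + 1) (l + 1) := by
  have hc := qc_ne q
  ext n m
  cases n with
  | zero => simp [opE, delta]
  | succ n =>
    simp only [opE, Module.End.mul_apply, opDiag_apply, opA_succ, delta, Pi.smul_apply,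
      smul_eq_mul, add_left_inj, sub_eq_iff_eq_add]
    split_ifs with h
    · rw [h.1]; field_simp; ring
    · simp

/-- The same telescoping with raised indices: the boundary term at n = 0 now comes from the second
summand, since the output of E vanishes at index 0. -/
lemma haarFun_actE (t : SUq q) : haarFun q (actE q t) = 0 := by
  have h0 := qh_ne q
  have hc := qc_ne q
  have h1 := one_sub_qc_sq_ne q
  obtain ⟨C, hC, hb⟩ := rep_bounded t
  rw [haarFun_apply]
  refine mul_eq_zero_of_right _ (tsum_eq_zero_of_telescope
    (g := fun n => qh q / (1 - qc q ^ 2) * (qc q ^ (n + 1)) *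
      rep q t (delta (n + 1) 1) n 0) ?_ ?_ ?_)
  · refine summable_of_norm_le_geometric (q := q) (‖qh q / (1 - qc q ^ 2)‖ * C) fun n => ?_
    have e2 : ‖rep q t (delta (n + 1) 1) n 0‖ ≤ C := by
      simpa using hb _ 1 (norm_delta_le (n + 1) 1) n 0
    rw [norm_mul, norm_mul, norm_pow, norm_qc]
    have hq := pow_nonneg q.2.1.le n
    have hq' : (q : ℝ) ^ (n + 1) ≤ q ^ n := pow_le_pow_of_le_one q.2.1.le q.2.2.le n.le_succ
    calc _ ≤ ‖qh q / (1 - qc q ^ 2)‖ * (q : ℝ) ^ n * C := by gcongr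
      _ = _ := by ring
  · simp only [rep_actE, LinearMap.sub_apply, Module.End.mul_apply, opE_delta, map_smul,
      Pi.sub_apply, Pi.smul_apply, smul_eq_mul, rep_actKinv_delta]
    simp [opE, ← qh_mul_qh]
    field_simp
  · intro n
    have hs := rep_delta_shift t 1 (n + 1) 0 n (-1)
    rw [neg_add_cancel, zero_add] at hs
    simp only [rep_actE, LinearMap.sub_apply, Module.End.mul_apply, opE_delta, map_smul,
      Pi.sub_apply, Pi.smul_apply, smul_eq_mul, rep_actKinv_delta]
    simp only [opE, Module.End.mul_apply, opDiag_apply, opA_succ, rep_actK_delta, zero_sub, zero_add,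
      hs]
    have e1 : ((n : ℕ) : ℤ) + -1 - (((n + 1 : ℕ) : ℤ) + 0) = -2 := by push_cast; ring
    have e2 : ((n + 1 + 1 : ℕ) : ℤ) + 1 - (((n + 1 : ℕ) : ℤ) + 0) = 2 := by push_cast; ring
    rw [e1, e2, zpow_neg, zpow_ofNat, qh_sq]
    field_simp
    ring

/-! ### Matrix elements of monomials -/

lemma rep_mono_delta (i j k : ℕ) (l : ℤ) :
    rep q (mono q i j) (delta k l) = qc q ^ (k * j) • delta (k + i) (l + j) := by
  have hA : ∀ (k : ℕ) (l : ℤ), opA (delta k l) = delta (k + 1) l := by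
    intro k l; ext n m; cases n <;> simp [delta]
  have hB : ∀ (k : ℕ) (l : ℤ),
      opDiag (fun n _ => qc q ^ n) 1 (delta k l) = qc q ^ k • delta k (l + 1) := by
    intro k l; ext n m
    simp only [opDiag_apply, delta, Pi.smul_apply, smul_eq_mul, sub_eq_iff_eq_add]
    split_ifs with h
    · rw [h.1]
    · simp
  have hb : rep q (of q .b ^ j) (delta k l) = qc q ^ (k * j) • delta k (l + j) := by
    induction j with
    | zero => simp
    | succ j ih =>
      rw [pow_succ', map_mul, Module.End.mul_apply, ih, map_smul, rep_of, repGen, hB, smul_smul,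
        ← pow_add, Nat.cast_succ, add_assoc]
      rfl
  rw [mono, map_mul, Module.End.mul_apply, hb, map_smul]
  congr 1
  induction i with
  | zero => simp
  | succ i ih => rw [pow_succ', map_mul, Module.End.mul_apply, ih, rep_of, repGen, hA, add_assoc]

/-- The adjoint monomial undoes the index shift of a^i b^j up to a positive weight. Hence distinct
monomials are orthogonal, and the norm of a monomial is a series of positive terms. -/
lemma rep_star_mono (i j : ℕ) : ∃ p : ℕ → ℝ, (∀ n, 0 < p n) ∧
    ∀ (f : ℕ → ℤ → ℂ) (n : ℕ) (m : ℤ),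
      rep q (star (mono q i j)) f n m = (p n : ℂ) * f (n + i) (m + j) := by
  have hq := q.2.1
  have ha : ∃ p : ℕ → ℝ, (∀ n, 0 < p n) ∧ ∀ (f : ℕ → ℤ → ℂ) (n : ℕ) (m : ℤ),
      rep q (of q .as ^ i) f n m = (p n : ℂ) * f (n + i) m := by
    induction i with
    | zero => exact ⟨fun _ => 1, fun _ => one_pos, fun f n m => by simp⟩
    | succ i ih =>
      obtain ⟨p, hp, h⟩ := ih
      refine ⟨fun n => p n * (1 - (q : ℝ) ^ (2 * (n + i + 1))), fun n => mul_pos (hp n) ?_,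
        fun f n m => ?_⟩
      · have := pow_lt_one₀ hq.le q.2.2 (n := 2 * (n + i + 1)) (by omega)
        linarith
      · rw [pow_succ, map_mul, Module.End.mul_apply, h, rep_of, repGen, opLower_apply, qc]
        push_cast
        rw [sub_zero, mul_assoc, add_assoc n i 1]
  obtain ⟨p, hp, h⟩ := ha
  have hb : ∀ (f : ℕ → ℤ → ℂ) (n : ℕ) (m : ℤ),
      rep q (of q .bs ^ j) f n m = (((q : ℝ) ^ (n * j) : ℝ) : ℂ) * f n (m + j) := by
    intro f n
    induction j with
    | zero => intro m; simp
    | succ j ih =>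
      intro m
      rw [pow_succ', map_mul, Module.End.mul_apply, rep_of, repGen, opDiag_apply, ih, qc]
      push_cast
      rw [← mul_assoc, ← pow_add, sub_neg_eq_add, add_assoc m 1, add_comm (1 : ℤ),
        mul_add_one, add_comm n]
  refine ⟨fun n => (q : ℝ) ^ (n * j) * p n, fun n => mul_pos (pow_pos hq _) (hp n), ?_⟩
  intro f n m
  rw [mono, star_mul, star_pow, star_pow, star_of, star_of, map_mul, Module.End.mul_apply]
  change rep q (of q .bs ^ j) (rep q (of q .as ^ i) f) n m = _
  rw [hb, h]
  push_cast
  ring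

lemma haarFun_star_mono_mul_mono_of_ne {i j i' j' : ℕ} (h : ¬(i = i' ∧ j = j')) :
    haarFun q (star (mono q i j) * mono q i' j') = 0 := by
  obtain ⟨p, -, hp⟩ := rep_star_mono (q := q) i j
  rw [haarFun_apply]
  refine mul_eq_zero_of_right _ ((tsum_congr fun n => ?_).trans tsum_zero)
  have hn : ¬(n + i = n + i' ∧ (0 : ℤ) + j = 0 + j') := by omega
  rw [map_mul, Module.End.mul_apply, hp, rep_mono_delta, Pi.smul_apply, Pi.smul_apply, delta,
    if_neg hn, smul_zero, mul_zero, mul_zero]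

lemma haarFun_star_mono_mul_mono_pos (i j : ℕ) :
    0 < haarFun q (star (mono q i j) * mono q i j) := by
  obtain ⟨p, hpos, hp⟩ := rep_star_mono (q := q) i j
  have hq := q.2.1
  have hs := summable_rep_diag (star (mono q i j) * mono q i j)
  have key : ∀ n : ℕ, qc q ^ (2 * n) * rep q (star (mono q i j) * mono q i j) (delta n 0) n 0 =
      (((q : ℝ) ^ (2 * n) * (p n * (q : ℝ) ^ (n * j)) : ℝ) : ℂ) := by
    intro n
    rw [map_mul, Module.End.mul_apply, hp, rep_mono_delta, qc]
    simp [delta]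
  rw [haarFun_apply]
  simp_rw [key] at hs ⊢
  rw [← Complex.ofReal_tsum, qc]
  have hs' := Complex.summable_ofReal.1 hs
  have h1 : (q : ℝ) ^ 2 < 1 := pow_lt_one₀ q.2.1.le q.2.2 two_ne_zero
  rw [← Complex.ofReal_pow, ← Complex.ofReal_one, ← Complex.ofReal_sub, ← Complex.ofReal_mul,
    ← Complex.ofReal_zero, Complex.real_lt_real]
  refine mul_pos (by linarith) (hs'.tsum_pos (fun n => ?_) 0 ?_)
  · have := hpos n; positivity
  · have := hpos 0; positivity

/-! ### Invariance and adjoints -/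

/-- The involution reverses products and exchanges ∂(k) with ∂(k⁻¹), so it carries the Leibniz rule
of ∂(e) to that of ∂(f); the factor -q is read off from the generators. -/
lemma star_actE (t : SUq q) : star (actE q t) = -(qc q • actF q (star t)) := by
  have hc := qc_ne q
  induction t using SUq.induction with
  | hs z => rw [star_algebraMap_aux, actE_algebraMap, actF_algebraMap]; simp
  | hg x =>
    cases x <;> simp [actE_of, actF_of, star_of, starGen, star_qc, smul_smul, hc]
  | hm s t hs ht =>
    have e : star (actKinv q s) = actK q (star s) := (actK_star s).symm
    have e' : star (actK q t) = actKinv q (star t) := by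
      rw [← actKinv_actK (star (actK q t)), actK_star, actKinv_actK]
    rw [actE_mul, star_add, star_mul, star_mul, hs, ht, e, e', star_mul, actF_mul]
    simp only [mul_neg, neg_mul, mul_smul_comm, smul_mul_assoc, smul_add, neg_add]
    rw [add_comm]
  | ha s t hs ht => rw [map_add, star_add, hs, ht, star_add, map_add, smul_add, neg_add]

/-- A linear functional invariant under the action `∂`. -/
structure IsActInvariant (h : SUq q →ₗ[ℂ] ℂ) : Prop where
  actK : ∀ t, h (actK q t) = h t
  actE : ∀ t, h (actE q t) = 0
  actF : ∀ t, h (actF q t) = 0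

lemma haarFun_isActInvariant (q : Param) : IsActInvariant (haarFun q) :=
  ⟨haarFun_actK, haarFun_actE, haarFun_actF⟩

namespace IsActInvariant

variable {h : SUq q →ₗ[ℂ] ℂ} (hh : IsActInvariant h)
include hh

lemma star_mul_actF (s t : SUq q) : h (star s * SUq.actF q t) = h (star (SUq.actE q s) * t) := by
  -- The factor ∂(k) is inserted so that the Leibniz term ∂(k⁻¹)∂(k)s^*·∂(f)t is exactly s^*∂(f)t;
  -- in the other term ∂(k) acts on the whole product and disappears under h.
  have h0 := hh.actF (SUq.actK q (star s) * t)
  rw [actF_mul, actKinv_actK, map_add] at h0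
  have e : SUq.actF q (SUq.actK q (star s)) = qc q • SUq.actK q (SUq.actF q (star s)) := by
    rw [actK_actF, smul_smul, mul_inv_cancel₀ (qc_ne q), one_smul]
  rw [e, smul_mul_assoc, ← map_mul, map_smul, hh.actK] at h0
  rw [star_actE, neg_mul, map_neg, smul_mul_assoc, map_smul]
  exact eq_neg_of_add_eq_zero_right h0

lemma star_mul_actE (s t : SUq q) : h (star s * SUq.actE q t) = h (star (SUq.actF q s) * t) := by
  have h0 := hh.actE (SUq.actK q (star s) * t)
  rw [actE_mul, actKinv_actK, map_add] at h0
  have e : SUq.actE q (SUq.actK q (star s)) =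
      (qc q)⁻¹ • SUq.actK q (SUq.actE q (star s)) := by
    rw [actK_actE, smul_smul, inv_mul_cancel₀ (qc_ne q), one_smul]
  have e' : star (SUq.actF q s) = -((qc q)⁻¹ • SUq.actE q (star s)) := by
    have := star_actE (star s)
    rw [star_star] at this
    rw [← star_star (SUq.actE q (star s)), this, star_neg, star_smul, Complex.star_def, star_qc,
      smul_neg, smul_smul, inv_mul_cancel₀ (qc_ne q), one_smul, neg_neg]
  rw [e, smul_mul_assoc, ← map_mul, map_smul, hh.actK] at h0
  rw [e', neg_mul, map_neg, smul_mul_assoc, map_smul]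
  exact eq_neg_of_add_eq_zero_right h0

/-- Lowering operators are moved across the pairing as raising operators until the shorter chain is
exhausted; one more ∂(e) then meets a highest weight vector. -/
lemma star_actF_pow_mul_of_ne {x y : SUq q} (hx : SUq.actE q x = 0) (hy : SUq.actE q y = 0)
    {d' : ℤ} (hy' : SUq.actK q y = qh q ^ d' • y)
    {m m' : ℕ} (hm : m ≠ m') :
    h (star ((SUq.actF q ^ m) x) * (SUq.actF q ^ m') y) = 0 := by
  induction m generalizing m' with
  | zero =>
    obtain ⟨n, rfl⟩ := Nat.exists_eq_succ_of_ne_zero hm.symm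
    rw [pow_succ', Module.End.mul_apply, hh.star_mul_actF, pow_zero, Module.End.one_apply, hx]
    simp
  | succ m ih =>
    rw [pow_succ' _ m, Module.End.mul_apply, ← hh.star_mul_actE]
    cases m' with
    | zero => rw [pow_zero (SUq.actF q), Module.End.one_apply, hy]; simp
    | succ m' =>
      rw [actE_actF_pow hy hy', mul_smul_comm, map_smul, ih (by omega), smul_zero]

lemma star_actF_pow_mul {x y : SUq q} (hy : SUq.actE q y = 0)
    {d : ℤ} (hy' : SUq.actK q y = qh q ^ d • y) (m : ℕ) :
    h (star ((SUq.actF q ^ m) x) * (SUq.actF q ^ m) y) =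
      ((∏ l ∈ Finset.range m, casimirCoeff q d (l + 1) : ℝ) : ℂ) * h (star x * y) := by
  induction m with
  | zero => simp
  | succ m ih =>
    rw [pow_succ' _ m, Module.End.mul_apply, ← hh.star_mul_actE,
      ← pow_succ', actE_actF_pow hy hy', mul_smul_comm, map_smul, ih, Finset.prod_range_succ]
    push_cast
    rw [smul_eq_mul]
    ring

end IsActInvariant

/-! ### Peter–Weyl basis and positivity -/

/-- The index set of the Peter–Weyl basis `∂(f)^m (a^i b^j)`, `m ≤ i + j`. -/
abbrev PWIndex : Type := {x : ℕ × ℕ × ℕ // x.2.2 ≤ x.1 + x.2.1}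

/-- The Peter–Weyl basis vectors. -/
def pw (q : Param) (x : PWIndex) : SUq q := (actF q ^ x.1.2.2) (mono q x.1.1 x.1.2.1)

lemma span_pw (q : Param) : Submodule.span ℂ (Set.range (pw q)) = ⊤ := by
  rw [eq_top_iff, ← lowered_eq_top, lowered, Submodule.span_le]
  rintro _ ⟨⟨i, j, m⟩, rfl⟩
  by_cases hm : m ≤ i + j
  · exact Submodule.subset_span ⟨⟨(i, j, m), hm⟩, rfl⟩
  · obtain ⟨n, rfl⟩ := Nat.exists_eq_add_of_lt (not_le.1 hm)
    have : (actF q ^ (i + j + n + 1)) (mono q i j) = 0 := by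
      rw [show i + j + n + 1 = n + (i + j + 1) by ring, pow_add, Module.End.mul_apply,
        actF_pow_mono, map_zero]
    change (actF q ^ (i + j + n + 1)) (mono q i j) ∈ _
    rw [this]
    exact zero_mem _

lemma haarFun_star_pw_mul_of_ne {x y : PWIndex} (hxy : x ≠ y) :
    haarFun q (star (pw q x) * pw q y) = 0 := by
  obtain ⟨⟨i, j, m⟩, hm⟩ := x
  obtain ⟨⟨i', j', m'⟩, hm'⟩ := y
  by_cases h : m = m'
  · subst h
    rw [pw, pw, (haarFun_isActInvariant q).star_actF_pow_mul (actE_mono _ _) (actK_mono' _ _),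
      haarFun_star_mono_mul_mono_of_ne, mul_zero]
    rintro ⟨h1, h2⟩
    exact hxy (by subst h1 h2; rfl)
  · exact (haarFun_isActInvariant q).star_actF_pow_mul_of_ne (actE_mono _ _) (actE_mono _ _)
      (actK_mono' _ _) h

lemma haarFun_star_pw_mul_pos (x : PWIndex) : 0 < haarFun q (star (pw q x) * pw q x) := by
  obtain ⟨⟨i, j, m⟩, hm⟩ := x
  rw [pw, (haarFun_isActInvariant q).star_actF_pow_mul (actE_mono _ _) (actK_mono' _ _)]
  refine mul_pos ?_ (haarFun_star_mono_mul_mono_pos i j)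
  rw [← Complex.ofReal_zero, Complex.real_lt_real]
  refine Finset.prod_pos fun l hl => casimirCoeff_pos l.succ_pos ?_
  rw [Finset.mem_range] at hl
  dsimp only at hm hl
  change ((l + 1 : ℕ) : ℤ) ≤ ((i + j : ℕ) : ℤ)
  omega

/-- In the orthogonal Peter–Weyl basis the value is ∑ |c_x|² h(x^*x), with every h(x^*x) positive.
-/
lemma haarFun_pos {t : SUq q} (ht : t ≠ 0) : 0 < haarFun q (star t * t) := by
  have hmem : t ∈ Submodule.span ℂ (Set.range (pw q)) := by rw [span_pw]; trivial
  obtain ⟨c, rfl⟩ := (Finsupp.mem_span_range_iff_exists_finsupp).1 hmem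
  have key : haarFun q (star (c.sum fun x z => z • pw q x) * (c.sum fun x z => z • pw q x)) =
      ∑ x ∈ c.support, (star (c x) * c x) * haarFun q (star (pw q x) * pw q x) := by
    rw [Finsupp.sum, star_sum, Finset.sum_mul, map_sum]
    refine Finset.sum_congr rfl fun x hx => ?_
    rw [Finset.mul_sum, map_sum, Finset.sum_eq_single x]
    · rw [star_smul, smul_mul_smul_comm, map_smul, smul_eq_mul]
    · intro y _ hy
      rw [star_smul, smul_mul_smul_comm, map_smul, haarFun_star_pw_mul_of_ne hy.symm, smul_zero]
    · exact fun h => absurd hx h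
  rw [key]
  refine Finset.sum_pos (fun x hx => mul_pos ?_ (haarFun_star_pw_mul_pos x)) ?_
  · rw [Finsupp.mem_support_iff] at hx
    exact star_mul_self_pos (IsRegular.of_ne_zero hx)
  · rw [Finsupp.support_nonempty_iff]
    rintro rfl
    exact ht Finsupp.sum_zero_index

/-! ### Left invariance -/

lemma comul_of (x : SUGen) : comul q (of q x) = comulGen q x := lift_of _ _ x

/-- The action concerns the row index of t_{mn}, which Δ keeps in its first tensor factor; this is
why ∂ passes to ∂ ⊗ id. -/
lemma comul_actK (t : SUq q) :
    comul q (actK q t) = TensorProduct.map (actK q).toLinearMap LinearMap.id (comul q t) := by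
  have hmap : TensorProduct.map (actK q).toLinearMap LinearMap.id =
      (Algebra.TensorProduct.map (actK q) (AlgHom.id ℂ (SUq q))).toLinearMap := rfl
  rw [hmap]
  simp only [AlgHom.toLinearMap_apply]
  induction t using SUq.induction with
  | hs z => simp only [AlgHom.commutes]
  | hg x =>
    cases x <;>
      simp only [actK_of, comul_of, comulGen, map_smul, map_add, map_sub, AlgHom.id_apply,
        Algebra.TensorProduct.map_tmul, ← TensorProduct.smul_tmul'] <;>
      module
  | hm s t hs ht => simp only [map_mul, hs, ht]
  | ha s t hs ht => simp only [map_add, hs, ht]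

lemma comul_actKinv (t : SUq q) :
    comul q (actKinv q t) = TensorProduct.map (actKinv q).toLinearMap LinearMap.id (comul q t) := by
  have hid : (actKinv q).toLinearMap ∘ₗ (actK q).toLinearMap = LinearMap.id :=
    LinearMap.ext actKinv_actK
  conv_rhs => rw [← actK_actKinv t, comul_actK, ← LinearMap.comp_apply, ← TensorProduct.map_comp,
    hid, LinearMap.id_comp, TensorProduct.map_id, LinearMap.id_apply]

lemma map_actF_mul (x y : SUq q ⊗[ℂ] SUq q) :
    TensorProduct.map (actF q) LinearMap.id (x * y) =
      TensorProduct.map (actF q) LinearMap.id x *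
        TensorProduct.map (actK q).toLinearMap LinearMap.id y +
      TensorProduct.map (actKinv q).toLinearMap LinearMap.id x *
        TensorProduct.map (actF q) LinearMap.id y := by
  induction x with
  | zero => simp
  | add x x' hx hx' => simp only [add_mul, map_add, hx, hx']; abel
  | tmul s t =>
    induction y with
    | zero => simp
    | add y y' hy hy' => simp only [mul_add, map_add, hy, hy']; abel
    | tmul s' t' =>
      simp [Algebra.TensorProduct.tmul_mul_tmul, actF_mul, TensorProduct.add_tmul]

lemma comul_actF (t : SUq q) :
    comul q (actF q t) = TensorProduct.map (actF q) LinearMap.id (comul q t) := by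
  have hc := qc_ne q
  induction t using SUq.induction with
  | hs z =>
    rw [actF_algebraMap, AlgHom.commutes, Algebra.TensorProduct.algebraMap_apply,
      TensorProduct.map_tmul, actF_algebraMap]
    simp
  | hg x =>
    cases x <;>
      simp only [actF_of, comul_of, comulGen, map_smul, map_add, map_sub, map_neg, map_zero,
        LinearMap.id_apply, TensorProduct.map_tmul, TensorProduct.neg_tmul, TensorProduct.zero_tmul,
        ← TensorProduct.smul_tmul'] <;>
      (match_scalars <;> field_simp)
  | hm s t hs ht => rw [actF_mul, map_add, map_mul, map_mul, hs, ht, comul_actK,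
      comul_actKinv, map_mul, map_actF_mul]
  | ha s t hs ht => simp only [map_add, hs, ht]

/-- The map `h ⊗ id` composed with the coproduct. -/
def leftConv (h : SUq q →ₗ[ℂ] ℂ) : SUq q →ₗ[ℂ] SUq q :=
  (TensorProduct.lid ℂ (SUq q)).toLinearMap ∘ₗ
    TensorProduct.map h LinearMap.id ∘ₗ (comul q).toLinearMap

lemma leftConv_apply (h : SUq q →ₗ[ℂ] ℂ) (t : SUq q) : leftConv h t =
    TensorProduct.lid ℂ (SUq q) (TensorProduct.map h LinearMap.id (comul q t)) := rfl

/-- It suffices to test on ∂(f)^m(a^i b^j). For m > 0 both sides vanish by invariance under ∂(f);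
for m = 0 and i + j > 0 both are fixed under multiplication by q^{(i+j)/2} ≠ 1, hence zero; only t =
1 remains. -/
lemma haarFun_left_invariant (t : SUq q) : leftConv (haarFun q) t = haarFun q t • 1 := by
  have hF : haarFun q ∘ₗ actF q = 0 := LinearMap.ext haarFun_actF
  have hK : haarFun q ∘ₗ (actK q).toLinearMap = haarFun q := LinearMap.ext haarFun_actK
  suffices h : leftConv (haarFun q) = (haarFun q).smulRight 1 from LinearMap.congr_fun h t
  refine LinearMap.ext_on_range (lowered_eq_top q) ?_
  rintro ⟨i, j, m⟩
  rw [LinearMap.smulRight_apply]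
  cases m with
  | succ m =>
    rw [pow_succ', Module.End.mul_apply, haarFun_actF, zero_smul, leftConv_apply, comul_actF,
      ← LinearMap.comp_apply, ← TensorProduct.map_comp, hF]
    simp
  | zero =>
    change leftConv (haarFun q) (mono q i j) = haarFun q (mono q i j) • 1
    by_cases hd : i + j = 0
    · obtain ⟨rfl, rfl⟩ : i = 0 ∧ j = 0 := by omega
      simp [mono, leftConv_apply, haarFun_one, Algebra.TensorProduct.one_def]
    · have hu : qh q ^ (i + j) ≠ 1 := by
        rw [qh, ← Complex.ofReal_pow, Ne, Complex.ofReal_eq_one]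
        refine (pow_lt_one₀ (Real.sqrt_nonneg _) ?_ hd).ne
        rw [Real.sqrt_lt' one_pos, one_pow]
        exact q.2.2
      have h1 : qh q ^ (i + j) • haarFun q (mono q i j) = haarFun q (mono q i j) := by
        rw [← map_smul, ← actK_mono, haarFun_actK]
      have h2 : qh q ^ (i + j) • leftConv (haarFun q) (mono q i j) =
          leftConv (haarFun q) (mono q i j) := by
        rw [← map_smul, ← actK_mono, leftConv_apply, comul_actK, ← LinearMap.comp_apply,
          ← TensorProduct.map_comp, hK, LinearMap.id_comp, leftConv_apply]
      have h3 : ∀ {M : Type} [AddCommGroup M] [Module ℂ M] (x : M),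
          qh q ^ (i + j) • x = x → x = 0 := by
        intro M _ _ x hx
        have : (qh q ^ (i + j) - 1) • x = 0 := by rw [sub_smul, hx, one_smul, sub_self]
        exact (smul_eq_zero.1 this).resolve_left (sub_ne_zero.2 hu)
      rw [h3 _ h1, h3 _ h2, zero_smul]

lemma haarFun_isHaarState (q : Param) : IsHaarState (haarFun q) :=
  ⟨haarFun_one, fun _ ht => haarFun_pos ht, haarFun_left_invariant⟩

/-! ### Uniqueness of the Haar state -/

/-- The automorphism transposing the matrix `(t_{mn})`. -/
def transpose (q : Param) : SUq q →ₐ[ℂ] SUq q :=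
  lift (fun x => match x with
    | .a => of q .a
    | .as => of q .as
    | .b => -(qc q • of q .bs)
    | .bs => -((qc q)⁻¹ • of q .b)) (by
    intro x y hxy
    have hc := qc_ne q
    cases hxy <;>
      simp only [map_mul, map_add, map_smul, map_one, FreeAlgebra.lift_ι_apply, smul_neg, neg_mul,
        mul_neg, neg_neg, smul_mul_assoc, mul_smul_comm, smul_smul, rel_b_a, rel_bs_a, rel_as_bs,
        rel_as_b, rel_b_bs, rel_as_a, rel_a_as] <;>
      (match_scalars <;> field_simp <;> ring))

lemma transpose_of (x : SUGen) : transpose q (of q x) =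
    match x with
    | .a => of q .a
    | .as => of q .as
    | .b => -(qc q • of q .bs)
    | .bs => -((qc q)⁻¹ • of q .b) := by
  rw [transpose, lift_of]

/-- Transposing the matrix reverses the order in the coproduct, so composition with `transpose`
turns left invariance into right invariance. -/
lemma comul_transpose (t : SUq q) : comul q (transpose q t) =
    Algebra.TensorProduct.comm ℂ (SUq q) (SUq q)
      (Algebra.TensorProduct.map (transpose q) (transpose q) (comul q t)) := by
  have hc := qc_ne q
  induction t using SUq.induction with
  | hs z => simp only [AlgHom.commutes, AlgEquiv.commutes]
  | hg x =>
    cases x <;>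
      simp only [transpose_of, comul_of, comulGen, map_smul, map_add, map_sub, map_neg,
        Algebra.TensorProduct.map_tmul, TensorProduct.neg_tmul, TensorProduct.tmul_neg,
        TensorProduct.tmul_smul, ← TensorProduct.smul_tmul',
        Algebra.TensorProduct.comm_tmul] <;>
      (match_scalars <;> field_simp)
  | hm s t hs ht => simp only [map_mul, hs, ht]
  | ha s t hs ht => simp only [map_add, hs, ht]

lemma lid_map_eq (h g : SUq q →ₗ[ℂ] ℂ) (x : SUq q ⊗[ℂ] SUq q) :
    g (TensorProduct.lid ℂ (SUq q) (TensorProduct.map h LinearMap.id x)) =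
      TensorProduct.lid ℂ ℂ (TensorProduct.map h g x) := by
  induction x with
  | zero => simp
  | add x y hx hy => simp only [map_add, hx, hy]
  | tmul s t => simp

lemma transpose_transpose (t : SUq q) : transpose q (transpose q t) = t := by
  have hc := qc_ne q
  induction t using SUq.induction with
  | hs z => simp only [AlgHom.commutes]
  | hg x => cases x <;> simp [transpose_of, smul_smul, hc]
  | hm s t hs ht => simp only [map_mul, hs, ht]
  | ha s t hs ht => simp only [map_add, hs, ht]

lemma lid_map_transpose (h g : SUq q →ₗ[ℂ] ℂ) (x : SUq q ⊗[ℂ] SUq q) :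
    TensorProduct.lid ℂ ℂ (TensorProduct.map h (g ∘ₗ (transpose q).toLinearMap) x) =
      TensorProduct.lid ℂ ℂ (TensorProduct.map g (h ∘ₗ (transpose q).toLinearMap)
        (Algebra.TensorProduct.comm ℂ (SUq q) (SUq q)
          (Algebra.TensorProduct.map (transpose q) (transpose q) x))) := by
  induction x with
  | zero => simp
  | add x y hx hy => simp only [map_add, hx, hy]
  | tmul s t => simp [transpose_transpose, mul_comm]

/-- The usual comparison of a left with a right invariant functional: the pairing of h ⊗ (`haarFun`
∘ `transpose`) with Δt is computed on either leg. -/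
lemma eq_haarFun_transpose {h : SUq q →ₗ[ℂ] ℂ} (h1 : h 1 = 1)
    (hl : ∀ t, leftConv h t = h t • 1) (t : SUq q) : h t = haarFun q (transpose q t) := by
  have e1 := congrArg (haarFun q ∘ₗ (transpose q).toLinearMap) (hl t)
  have e2 := congrArg (h ∘ₗ (transpose q).toLinearMap)
    (haarFun_left_invariant (transpose q t))
  rw [leftConv_apply, lid_map_eq] at e1 e2
  rw [lid_map_transpose, ← comul_transpose, e2] at e1
  simpa [h1, haarFun_one] using e1.symm

/-- `haar` is an arbitrary choice, so uniqueness is needed to compute with it. Any Haar state equals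
`haarFun` ∘ `transpose`, and so does `haarFun`; positivity plays no part in the comparison. -/
lemma haar_eq (q : Param) : haar q = haarFun q := by
  have H : ∃ h : SUq q →ₗ[ℂ] ℂ, IsHaarState h := ⟨_, haarFun_isHaarState q⟩
  have e : haar q = H.choose := dif_pos H
  ext t
  rw [e, eq_haarFun_transpose H.choose_spec.map_one H.choose_spec.left_invariant,
    ← eq_haarFun_transpose haarFun_one haarFun_left_invariant]

lemma haar_isHaarState (q : Param) : IsHaarState (haar q) := by
  rw [haar_eq]; exact haarFun_isHaarState q

lemma haar_isActInvariant (q : Param) : IsActInvariant (haar q) := by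
  rw [haar_eq]; exact haarFun_isActInvariant q

end SUq

/-! ## Diagonal unbounded operators -/

section Diagonal

variable {H : Type*} [NormedAddCommGroup H] [InnerProductSpace ℂ H] {ι : Type*}

/-- The graph of the maximal operator that is diagonal with eigenvalues `ev` in the basis `v`. -/
def diagGraph (v : ι → H) (ev : ι → ℝ) : Submodule ℂ (H × H) where
  carrier := {x | ∀ i, inner ℂ (v i) x.2 = ev i * inner ℂ (v i) x.1}
  add_mem' {x y} hx hy i := by
    rw [Prod.snd_add, Prod.fst_add, inner_add_right, inner_add_right, hx i, hy i, mul_add]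
  zero_mem' i := by simp
  smul_mem' z x hx i := by
    rw [Prod.smul_snd, Prod.smul_fst, inner_smul_right, inner_smul_right, hx i, mul_left_comm]

lemma mem_diagGraph {v : ι → H} {ev : ι → ℝ} {x : H × H} :
    x ∈ diagGraph v ev ↔ ∀ i, inner ℂ (v i) x.2 = ev i * inner ℂ (v i) x.1 := Iff.rfl

lemma isClosed_diagGraph (v : ι → H) (ev : ι → ℝ) : IsClosed (diagGraph v ev : Set (H × H)) := by
  have : (diagGraph v ev : Set (H × H)) =
      ⋂ i, {x | inner ℂ (v i) x.2 = ev i * inner ℂ (v i) x.1} := by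
    ext x; simp [mem_diagGraph]
  rw [this]
  exact isClosed_iInter fun i => isClosed_eq (by fun_prop) (by fun_prop)

variable (v : HilbertBasis ι ℂ H) (ev : ι → ℝ)

lemma eq_zero_of_inner_eq_zero {x : H} (h : ∀ i, inner ℂ (v i) x = 0) : x = 0 := by
  have h' := v.hasSum_repr x
  simp only [v.repr_apply_apply, h, zero_smul] at h'
  exact h'.unique hasSum_zero

lemma mem_diagGraph_basis (i : ι) : (v i, (ev i : ℂ) • v i) ∈ diagGraph v ev := by
  classical
  intro j
  rw [inner_smul_right]
  by_cases h : j = i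
  · rw [h]
  · rw [v.orthonormal.2 h]; simp

/-- The self-adjoint operator with eigenvalues `ev` in the basis `v`. -/
def diagOp : H →ₗ.[ℂ] H := (diagGraph v ev).toLinearPMap

lemma diagOp_graph : (diagOp v ev).graph = diagGraph v ev := by
  refine Submodule.toLinearPMap_graph_eq _ fun x hx h0 => eq_zero_of_inner_eq_zero v fun i => ?_
  rw [hx i, h0, inner_zero_right, mul_zero]

lemma mem_diagOp_domain {x y : H} (h : (x, y) ∈ diagGraph v ev) :
    ∃ hx : x ∈ (diagOp v ev).domain, diagOp v ev ⟨x, hx⟩ = y := by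
  rw [← diagOp_graph, LinearPMap.mem_graph_iff] at h
  obtain ⟨z, hz, h⟩ := h
  dsimp only at hz h
  subst hz
  exact ⟨z.2, h⟩

lemma diagOp_mem_graph (x : (diagOp v ev).domain) : ((x : H), diagOp v ev x) ∈ diagGraph v ev := by
  rw [← diagOp_graph]; exact LinearPMap.mem_graph _ x

lemma diagOp_basis (i : ι) : ∃ hi : v i ∈ (diagOp v ev).domain,
    diagOp v ev ⟨v i, hi⟩ = (ev i : ℂ) • v i :=
  mem_diagOp_domain v ev (mem_diagGraph_basis v ev i)

lemma diagOp_dense : Dense ((diagOp v ev).domain : Set H) := by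
  have h : Dense (Submodule.span ℂ (Set.range v) : Set H) := by
    rw [Submodule.dense_iff_topologicalClosure_eq_top, v.dense_span]
  refine h.mono (Submodule.span_le.2 ?_)
  rintro _ ⟨i, rfl⟩
  exact (diagOp_basis v ev i).1

/-- The partial sums of the two expansions of (x, y) combine graph vectors of basis elements, so
they lie in G and converge to (x, y). -/
lemma diagGraph_eq_closure {G : Submodule ℂ (H × H)} (hG : G ≤ diagGraph v ev)
    (hv : ∀ i, (v i, (ev i : ℂ) • v i) ∈ G) : diagGraph v ev = G.topologicalClosure := by
  refine le_antisymm ?_ (Submodule.topologicalClosure_minimal _ hG (isClosed_diagGraph _ _))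
  rintro ⟨x, y⟩ hxy
  have hx := v.hasSum_repr x
  have hy := v.hasSum_repr y
  refine mem_closure_of_tendsto (hx.prodMk_nhds hy) (Filter.Eventually.of_forall fun s => ?_)
  have : (∑ i ∈ s, v.repr x i • v i, ∑ i ∈ s, v.repr y i • v i) =
      ∑ i ∈ s, v.repr x i • (v i, (ev i : ℂ) • v i) := by
    rw [Prod.ext_iff, Prod.fst_sum, Prod.snd_sum]
    refine ⟨rfl, Finset.sum_congr rfl fun i _ => ?_⟩
    rw [Prod.smul_snd, smul_smul, v.repr_apply_apply, v.repr_apply_apply, mul_comm, ← hxy i]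
  rw [this]
  exact sum_mem fun i _ => Submodule.smul_mem _ _ (hv i)

/-- Testing the adjoint relation on basis vectors gives the diagonal condition, and Parseval's
identity with real eigenvalues gives the converse. -/
lemma diagOp_isSelfAdjoint [CompleteSpace H] : IsSelfAdjoint (diagOp v ev) := by
  rw [LinearPMap.isSelfAdjoint_def]
  apply LinearPMap.eq_of_eq_graph
  rw [LinearPMap.adjoint_graph_eq_graph_adjoint (diagOp_dense v ev), diagOp_graph]
  ext ⟨x, y⟩
  rw [Submodule.mem_adjoint_iff]
  constructor
  · intro h i
    have := h _ _ (mem_diagGraph_basis v ev i)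
    rw [inner_smul_left, Complex.conj_ofReal] at this
    exact (sub_eq_zero.1 this).symm
  · intro h a b hab
    rw [sub_eq_zero, ← v.tsum_inner_mul_inner b x, ← v.tsum_inner_mul_inner a y]
    refine tsum_congr fun i => ?_
    rw [h i, ← inner_conj_symm b, hab i, map_mul, Complex.conj_ofReal, inner_conj_symm]
    ring

lemma isCompactOperator_rankOne (x y : H) :
    IsCompactOperator (InnerProductSpace.rankOne ℂ x y : H →L[ℂ] H) := by
  have h : IsCompactOperator (id : ℂ → ℂ) :=
    (isCompactOperator_id_iff_finiteDimensional (𝕜 := ℂ) (E := ℂ)).2 inferInstance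
  rw [InnerProductSpace.rankOne_def']
  exact (h.comp_clm (innerSL ℂ y)).clm_comp (ContinuousLinearMap.toSpanSingleton ℂ x)

lemma ofReal_add_I_ne_zero (r : ℝ) : (r : ℂ) + Complex.I ≠ 0 := by
  intro h
  simpa using congrArg Complex.im h

lemma norm_inv_add_I (r : ℝ) : ‖((r : ℂ) + Complex.I)⁻¹‖ = (1 + r ^ 2) ^ (-1 / 2 : ℝ) := by
  have h : ‖(r : ℂ) + Complex.I‖ = Real.sqrt (1 + r ^ 2) := by
    rw [← one_mul Complex.I, ← Complex.ofReal_one, Complex.norm_add_mul_I]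
    congr 1
    ring
  rw [norm_inv, h, Real.sqrt_eq_rpow, ← Real.rpow_neg (by positivity)]
  norm_num

/-- The summability is that of |λ + i|⁻¹, so the resolvent is a norm-convergent sum of rank-one
operators. -/
lemma diagOp_compact_resolvent [CompleteSpace H]
    (hs : Summable fun i => (1 + ev i ^ 2) ^ (-1 / 2 : ℝ)) :
    ∃ R : H →L[ℂ] H, IsCompactOperator R ∧
    (∀ x : H, ∃ hx : R x ∈ (diagOp v ev).domain, diagOp v ev ⟨R x, hx⟩ + Complex.I • R x = x) ∧
    (∀ x : (diagOp v ev).domain, R (diagOp v ev x + Complex.I • (x : H)) = x) := by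
  classical
  let T : ι → H →L[ℂ] H := fun i =>
    ((ev i : ℂ) + Complex.I)⁻¹ • InnerProductSpace.rankOne ℂ (v i) (v i)
  have hT : Summable T := by
    refine Summable.of_norm ?_
    refine hs.congr fun i => ?_
    rw [norm_smul, InnerProductSpace.norm_rankOne, v.orthonormal.1, norm_inv_add_I]
    simp
  have hR : ∀ x i, inner ℂ (v i) ((∑' i, T i) x) =
      ((ev i : ℂ) + Complex.I)⁻¹ * inner ℂ (v i) x := by
    intro x i
    have h1 : HasSum (fun j => T j x) ((∑' i, T i) x) :=
      hT.hasSum.mapL (ContinuousLinearMap.apply ℂ H x)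
    have h2 := h1.mapL (innerSL ℂ (v i))
    have h3 : innerSL ℂ (v i) (T i x) = ((ev i : ℂ) + Complex.I)⁻¹ * inner ℂ (v i) x := by
      simp [T, inner_self_eq_norm_sq_to_K, v.orthonormal.1]
    have h4 : ∀ j, j ≠ i → innerSL ℂ (v i) (T j x) = 0 := fun j hj => by
      simp [T, v.orthonormal.2 hj.symm]
    rw [← h3]
    exact h2.unique (hasSum_single i h4)
  refine ⟨∑' i, T i, ?_, fun x => ?_, fun x => ?_⟩
  · refine isCompactOperator_of_tendsto hT.hasSum (Filter.Eventually.of_forall fun s => ?_)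
    have : ∑ i ∈ s, T i ∈ compactOperator (RingHom.id ℂ) H H :=
      sum_mem fun i _ => Submodule.smul_mem _ _ (isCompactOperator_rankOne (v i) (v i))
    exact this
  · have h := ofReal_add_I_ne_zero
    obtain ⟨hx, e⟩ := mem_diagOp_domain v ev
      (x := (∑' i, T i) x) (y := x - Complex.I • (∑' i, T i) x) (fun i => by
        dsimp only
        rw [inner_sub_right, inner_smul_right, hR]
        have := h (ev i)
        field_simp
        ring)
    exact ⟨hx, by rw [e, sub_add_cancel]⟩
  · rw [← sub_eq_zero]
    refine eq_zero_of_inner_eq_zero v fun i => ?_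
    rw [inner_sub_right, hR, inner_add_right, inner_smul_right, diagOp_mem_graph v ev x i,
      ← add_mul, inv_mul_cancel_left₀ (ofReal_add_I_ne_zero _), sub_self]

end Diagonal

open SUq

variable {q : Param}

/-! ## Left multiplication is bounded -/

namespace SUq

lemma re_haar_nonneg (x : SUq q) : 0 ≤ (haar q (star x * x)).re :=
  (Complex.le_def.1 (haar_nonneg x)).1

/-- In the Haar norm, ‖ax‖² + q²‖bx‖² = ‖x‖² and ‖a^*x‖² + ‖b^*x‖² = ‖x‖², while ‖bx‖ = ‖b^*x‖; so
the generators are contractions. All of ℂ[SU_q(2)] is covered because ∂(e)t and ∂(f)t generally lie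
outside the Podleś sphere. -/
lemma exists_re_haar_mul_le (s : SUq q) : ∃ C : ℝ, 0 ≤ C ∧ ∀ x,
    (haar q (star (s * x) * (s * x))).re ≤ C * (haar q (star x * x)).re := by
  have hq := q.2.1
  induction s using SUq.induction with
  | hs z =>
    refine ⟨‖z‖ ^ 2, sq_nonneg _, fun x => le_of_eq ?_⟩
    rw [← Algebra.smul_def, star_smul, smul_mul_smul_comm, map_smul, Complex.star_def,
      ← Complex.normSq_eq_conj_mul_self, Complex.normSq_eq_norm_sq, smul_eq_mul,
      Complex.re_ofReal_mul]
  | hg x =>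
    have e : ∀ (g : SUGen) (x : SUq q), star (of q g * x) * (of q g * x) =
        star x * (of q (starGen g) * of q g) * x := by
      intro g x
      rw [star_mul, star_of]
      simp only [mul_assoc]
    have hbb : ∀ y : SUq q,
        star y * (of q .bs * of q .b) * y = star (of q .b * y) * (of q .b * y) :=
      fun y => (e .b y).symm
    have hbb' : ∀ y : SUq q,
        star y * (of q .bs * of q .b) * y = star (of q .bs * y) * (of q .bs * y) :=
      fun y => by rw [e]; exact congrArg (fun t => star y * t * y) (rel_b_bs q).symm
    have ha : ∀ y : SUq q, (haar q (star (of q .a * y) * (of q .a * y))).re =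
        (haar q (star y * y)).re -
          (q : ℝ) ^ 2 * (haar q (star (of q .b * y) * (of q .b * y))).re := by
      intro y
      rw [e .a, starGen, rel_as_a, mul_sub, sub_mul, mul_one, mul_smul_comm, smul_mul_assoc, hbb,
        map_sub, map_smul, Complex.sub_re, smul_eq_mul, qc, ← Complex.ofReal_mul,
        Complex.re_ofReal_mul, sq]
    have has : ∀ y : SUq q, (haar q (star (of q .as * y) * (of q .as * y))).re =
        (haar q (star y * y)).re - (haar q (star (of q .bs * y) * (of q .bs * y))).re := by
      intro y
      rw [e .as, starGen, rel_a_as, mul_sub, sub_mul, mul_one, hbb', map_sub, Complex.sub_re]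
    cases x with
    | a =>
      refine ⟨1, zero_le_one, fun y => ?_⟩
      have := mul_nonneg (sq_nonneg (q : ℝ)) (re_haar_nonneg (of q .b * y))
      rw [ha]; linarith
    | as =>
      refine ⟨1, zero_le_one, fun y => ?_⟩
      have := re_haar_nonneg (of q .bs * y)
      rw [has]; linarith
    | b =>
      refine ⟨1, zero_le_one, fun y => ?_⟩
      have := re_haar_nonneg (of q .as * y)
      rw [← hbb, hbb']
      linarith [has y]
    | bs =>
      refine ⟨1, zero_le_one, fun y => ?_⟩
      have := re_haar_nonneg (of q .as * y)
      linarith [has y]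
  | hm s t hs ht =>
    obtain ⟨C, hC, h⟩ := hs
    obtain ⟨D, hD, h'⟩ := ht
    refine ⟨C * D, mul_nonneg hC hD, fun x => ?_⟩
    rw [mul_assoc, mul_assoc C]
    exact (h _).trans (mul_le_mul_of_nonneg_left (h' x) hC)
  | ha s t hs ht =>
    obtain ⟨C, hC, h⟩ := hs
    obtain ⟨D, hD, h'⟩ := ht
    refine ⟨2 * (C + D), by positivity, fun x => ?_⟩
    -- The parallelogram law with this nonnegative term dropped accounts for the factor 2.
    have hn := re_haar_nonneg (s * x - t * x)
    have e : star ((s + t) * x) * ((s + t) * x) = 2 • (star (s * x) * (s * x)) +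
        2 • (star (t * x) * (t * x)) - star (s * x - t * x) * (s * x - t * x) := by
      rw [add_mul, star_add, star_sub]
      noncomm_ring
    rw [e, map_sub, map_add, map_nsmul, map_nsmul, Complex.sub_re, Complex.add_re]
    simp only [nsmul_eq_mul, Nat.cast_ofNat, Complex.mul_re, Complex.re_ofNat, Complex.im_ofNat,
      zero_mul, sub_zero]
    linarith [h x, h' x]

end SUq

/-! ## The inner product on invariant spinors -/

lemma InvSpinors.val_injective : Function.Injective (InvSpinors.val (q := q)) :=
  Subtype.val_injective

lemma inner_invSpinors (φ ψ : InvSpinors q) : inner ℂ φ ψ =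
    haar q (star (φ.val 0) * ψ.val 0) + haar q (star (φ.val 1) * ψ.val 1) :=
  Fin.sum_univ_two _

lemma norm_sq_invSpinors (ψ : InvSpinors q) : ‖ψ‖ ^ 2 =
    (haar q (star (ψ.val 0) * ψ.val 0)).re + (haar q (star (ψ.val 1) * ψ.val 1)).re := by
  rw [← Complex.add_re, ← inner_invSpinors, norm_sq_eq_re_inner (𝕜 := ℂ)]
  rfl

lemma inner_toH (φ ψ : InvSpinors q) : inner ℂ (toH q φ) (toH q ψ) = inner ℂ φ ψ :=
  UniformSpace.Completion.inner_coe φ ψ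

lemma norm_toH (ψ : InvSpinors q) : ‖toH q ψ‖ = ‖ψ‖ := UniformSpace.Completion.norm_coe ψ

lemma denseRange_toH (q : Param) : DenseRange (toH q) := UniformSpace.Completion.denseRange_coe

lemma actK_val_zero (ψ : InvSpinors q) : actK q (ψ.val 0) = (qh q)⁻¹ • ψ.val 0 := by
  have h := ((mem_invSpinors q _).1 ψ.val_mem).1
  conv_rhs => rw [← h, smul_smul, inv_mul_cancel₀ (qh_ne q), one_smul]

lemma actK_val_one (ψ : InvSpinors q) : actK q (ψ.val 1) = qh q • ψ.val 1 := by
  have h := ((mem_invSpinors q _).1 ψ.val_mem).2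
  conv_rhs => rw [← h, smul_smul, mul_inv_cancel₀ (qh_ne q), one_smul]

/-- After ∂(f) or ∂(e) the components have weight -1/2 or 1/2, so ∂(k⁻¹) is the scalar q^{1/2} or
q^{-1/2} and cancels the prefactor. -/
lemma dirac_val (ψ : InvSpinors q) : (dirac q ψ).val =
    ![qnumc q 2 • actF q (ψ.val 1), qnumc q 2 • actE q (ψ.val 0)] := by
  have h0 := qh_ne q
  have hF : actK q (actF q (ψ.val 1)) = (qh q)⁻¹ • actF q (ψ.val 1) := by
    rw [actK_actF, actK_val_one, map_smul, smul_smul, ← qh_mul_qh, mul_inv,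
      inv_mul_cancel_right₀ h0]
  have hE : actK q (actE q (ψ.val 0)) = qh q • actE q (ψ.val 0) := by
    rw [actK_actE, actK_val_zero, map_smul, smul_smul, ← qh_mul_qh, mul_inv_cancel_right₀ h0]
  have hF' := actKinv_of_actK (inv_ne_zero h0) hF
  have hE' := actKinv_of_actK h0 hE
  change matAct q (diracElem q) ψ.val = _
  rw [diracElem_act, hF', hE', smul_smul, smul_smul, inv_inv, inv_mul_cancel_right₀ h0,
    mul_inv_cancel_right₀ h0]

lemma dirac_val_zero (ψ : InvSpinors q) : (dirac q ψ).val 0 = qnumc q 2 • actF q (ψ.val 1) := by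
  rw [dirac_val]; rfl

lemma dirac_val_one (ψ : InvSpinors q) : (dirac q ψ).val 1 = qnumc q 2 • actE q (ψ.val 0) := by
  rw [dirac_val]; rfl

lemma star_qnumc (n : ℕ) : star (qnumc q n) = qnumc q n := Complex.conj_ofReal _

lemma inner_dirac (φ ψ : InvSpinors q) : inner ℂ φ (dirac q ψ) = inner ℂ (dirac q φ) ψ := by
  have h := haar_isActInvariant q
  rw [inner_invSpinors, inner_invSpinors, dirac_val_zero, dirac_val_one, dirac_val_zero,
    dirac_val_one, star_smul, star_smul, star_qnumc, mul_smul_comm, mul_smul_comm, smul_mul_assoc,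
    smul_mul_assoc, map_smul, map_smul, map_smul, map_smul, h.star_mul_actF, h.star_mul_actE,
    add_comm]

lemma podlesMul_val (t : podles q) (ψ : InvSpinors q) (i : Fin 2) :
    (podlesMul q t ψ).val i = (t : SUq q) * ψ.val i := rfl

lemma chirality_val (ψ : InvSpinors q) : (chirality q ψ).val = ![ψ.val 0, -ψ.val 1] := rfl

lemma inner_podlesMul (t : podles q) (φ ψ : InvSpinors q) :
    inner ℂ (podlesMul q (star t) φ) ψ = inner ℂ φ (podlesMul q t ψ) := by
  rw [inner_invSpinors, inner_invSpinors]
  simp only [podlesMul_val, star_mul, StarMemClass.coe_star, star_star, mul_assoc]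

lemma inner_chirality (φ ψ : InvSpinors q) :
    inner ℂ (chirality q φ) ψ = inner ℂ φ (chirality q ψ) := by
  rw [inner_invSpinors, inner_invSpinors]
  simp [chirality_val]

lemma chirality_chirality (ψ : InvSpinors q) : chirality q (chirality q ψ) = ψ := by
  apply InvSpinors.val_injective
  ext i
  fin_cases i <;> simp [chirality_val]

lemma chirality_podlesMul (t : podles q) (ψ : InvSpinors q) :
    chirality q (podlesMul q t ψ) = podlesMul q t (chirality q ψ) := by
  apply InvSpinors.val_injective
  ext i
  fin_cases i <;> simp [chirality_val, podlesMul_val]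

lemma chirality_dirac (ψ : InvSpinors q) :
    chirality q (dirac q ψ) + dirac q (chirality q ψ) = 0 := by
  apply InvSpinors.val_injective
  ext i
  fin_cases i <;> simp [chirality_val, dirac_val]

/-! ## Extension of bounded operators to the completion -/

/-- A linear operator on invariant spinors that is bounded for the norm. -/
def IsBddOp (T : InvSpinors q →ₗ[ℂ] InvSpinors q) : Prop := ∃ C : ℝ, ∀ ψ, ‖T ψ‖ ≤ C * ‖ψ‖

/-- The extension of a bounded operator to the completion. -/
def extendOp (T : InvSpinors q →ₗ[ℂ] InvSpinors q) : HilbertInv q →L[ℂ] HilbertInv q :=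
  (toH q ∘ₗ T).extendOfNorm (toH q)

lemma extendOp_toH {T : InvSpinors q →ₗ[ℂ] InvSpinors q} (hT : IsBddOp T) (ψ : InvSpinors q) :
    extendOp T (toH q ψ) = toH q (T ψ) := by
  obtain ⟨C, hC⟩ := hT
  refine LinearMap.extendOfNorm_eq (denseRange_toH q) ⟨C, fun x => ?_⟩ ψ
  rw [LinearMap.comp_apply, norm_toH, norm_toH]
  exact hC x

lemma clm_ext_toH {S T : HilbertInv q →L[ℂ] HilbertInv q}
    (h : ∀ ψ, S (toH q ψ) = T (toH q ψ)) : S = T :=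
  ContinuousLinearMap.ext fun x =>
    congrFun ((denseRange_toH q).equalizer S.continuous T.continuous (funext h)) x

lemma isBddOp_of_sq {T : InvSpinors q →ₗ[ℂ] InvSpinors q} {C : ℝ} (hC : 0 ≤ C)
    (h : ∀ ψ, ‖T ψ‖ ^ 2 ≤ C * ‖ψ‖ ^ 2) : IsBddOp T := by
  refine ⟨Real.sqrt C, fun ψ => abs_le_of_sq_le_sq' ?_ (by positivity) |>.2⟩
  rw [mul_pow, Real.sq_sqrt hC]
  exact h ψ

lemma isBddOp_podlesMul (t : podles q) : IsBddOp (podlesMul q t) := by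
  obtain ⟨C, hC, h⟩ := exists_re_haar_mul_le (t : SUq q)
  refine isBddOp_of_sq hC fun ψ => ?_
  rw [norm_sq_invSpinors, norm_sq_invSpinors, podlesMul_val, podlesMul_val]
  linarith [h (ψ.val 0), h (ψ.val 1)]

lemma isBddOp_chirality (q : Param) : IsBddOp (chirality q) := by
  refine isBddOp_of_sq zero_le_one fun ψ => le_of_eq ?_
  rw [norm_sq_invSpinors, norm_sq_invSpinors, chirality_val]
  simp

/-! ### Bounded commutators -/

/-- The commutator of the Dirac operator with left multiplication. -/
def diracComm (t : podles q) : InvSpinors q →ₗ[ℂ] InvSpinors q :=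
  dirac q ∘ₗ podlesMul q t - podlesMul q t ∘ₗ dirac q

/-- As ∂(k⁻¹) fixes t, the Leibniz term t·∂(x)ψ_i cancels in the commutator, and in the other term
∂(k) acts on ψ_i by a scalar. -/
lemma diracComm_val (t : podles q) (ψ : InvSpinors q) :
    (diracComm t ψ).val 0 = ((qnumc q 2 * qh q) • actF q (t : SUq q)) * ψ.val 1 ∧
    (diracComm t ψ).val 1 = ((qnumc q 2 * (qh q)⁻¹) • actE q (t : SUq q)) * ψ.val 0 := by
  have ht : actK q (t : SUq q) = (1 : ℂ) • (t : SUq q) := by rw [← act_k, one_smul]; exact t.2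
  have ht' := actKinv_of_actK one_ne_zero ht
  rw [inv_one, one_smul] at ht'
  have hv : ∀ i, (diracComm t ψ).val i =
      (dirac q (podlesMul q t ψ)).val i - (podlesMul q t (dirac q ψ)).val i := fun i => by
    rw [diracComm, LinearMap.sub_apply, map_sub]; rfl
  constructor
  · rw [hv, dirac_val_zero, podlesMul_val, podlesMul_val, dirac_val_zero, actF_mul,
      actK_val_one, ht']
    simp only [mul_smul_comm, smul_mul_assoc, smul_add]
    module
  · rw [hv, dirac_val_one, podlesMul_val, podlesMul_val, dirac_val_one, actE_mul,
      actK_val_zero, ht']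
    simp only [mul_smul_comm, smul_mul_assoc, smul_add]
    module

lemma isBddOp_diracComm (t : podles q) : IsBddOp (diracComm t) := by
  obtain ⟨C, hC, h⟩ := exists_re_haar_mul_le ((qnumc q 2 * qh q) • actF q (t : SUq q))
  obtain ⟨D, hD, h'⟩ := exists_re_haar_mul_le ((qnumc q 2 * (qh q)⁻¹) • actE q (t : SUq q))
  refine isBddOp_of_sq (add_nonneg hC hD) fun ψ => ?_
  rw [norm_sq_invSpinors, norm_sq_invSpinors, (diracComm_val t ψ).1, (diracComm_val t ψ).2]
  have h0 := re_haar_nonneg (ψ.val 0)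
  have h1 := re_haar_nonneg (ψ.val 1)
  nlinarith [h (ψ.val 1), h' (ψ.val 0), mul_nonneg hC h0, mul_nonneg hD h1]

/-! ## The representation and the chirality -/

/-- Left multiplication by the Podleś sphere on the completion. -/
def podlesRep (q : Param) : podles q →⋆ₐ[ℂ] (HilbertInv q →L[ℂ] HilbertInv q) where
  toFun t := extendOp (podlesMul q t)
  map_one' := clm_ext_toH fun ψ => by
    have : podlesMul q 1 ψ = ψ := InvSpinors.val_injective (funext fun i => one_mul (ψ.val i))
    rw [extendOp_toH (isBddOp_podlesMul 1), this]
    rfl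
  map_mul' s t := clm_ext_toH fun ψ => by
    rw [extendOp_toH (isBddOp_podlesMul _), mul_apply_eq_comp,
      extendOp_toH (isBddOp_podlesMul _), extendOp_toH (isBddOp_podlesMul _)]
    congr 1
    exact InvSpinors.val_injective (funext fun i => mul_assoc _ _ _)
  map_zero' := clm_ext_toH fun ψ => by
    rw [extendOp_toH (isBddOp_podlesMul _)]
    have : podlesMul q 0 ψ = 0 := InvSpinors.val_injective (funext fun i => zero_mul _)
    rw [this, map_zero]; rfl
  map_add' s t := clm_ext_toH fun ψ => by
    rw [extendOp_toH (isBddOp_podlesMul _), add_apply,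
      extendOp_toH (isBddOp_podlesMul _), extendOp_toH (isBddOp_podlesMul _), ← map_add]
    congr 1
    exact InvSpinors.val_injective (funext fun i => add_mul _ _ _)
  commutes' z := clm_ext_toH fun ψ => by
    rw [extendOp_toH (isBddOp_podlesMul _), Algebra.algebraMap_eq_smul_one,
      Algebra.algebraMap_eq_smul_one, smul_apply,
      one_apply_eq_self, ← map_smul]
    congr 1
    exact InvSpinors.val_injective (funext fun i => by
      rw [podlesMul_val, map_smul]
      exact (smul_mul_assoc z (1 : SUq q) _).trans (by rw [one_mul]; rfl))
  map_star' t := by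
    rw [ContinuousLinearMap.star_eq_adjoint, ContinuousLinearMap.eq_adjoint_iff]
    intro x y
    refine (denseRange_toH q).induction_on₂ (isClosed_eq (by fun_prop) (by fun_prop)) ?_ x y
    intro φ ψ
    rw [extendOp_toH (isBddOp_podlesMul _), extendOp_toH (isBddOp_podlesMul _), inner_toH,
      inner_toH, inner_podlesMul]

lemma podlesRep_toH (t : podles q) (ψ : InvSpinors q) :
    podlesRep q t (toH q ψ) = toH q (podlesMul q t ψ) := extendOp_toH (isBddOp_podlesMul t) ψ

/-- The chirality on the completion. -/
def chiralityOp (q : Param) : HilbertInv q →L[ℂ] HilbertInv q := extendOp (chirality q)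

lemma chiralityOp_toH (ψ : InvSpinors q) : chiralityOp q (toH q ψ) = toH q (chirality q ψ) :=
  extendOp_toH (isBddOp_chirality q) ψ

lemma chiralityOp_isSelfAdjoint (q : Param) : IsSelfAdjoint (chiralityOp q) := by
  rw [ContinuousLinearMap.isSelfAdjoint_iff', eq_comm, ContinuousLinearMap.eq_adjoint_iff]
  intro x y
  refine (denseRange_toH q).induction_on₂ (isClosed_eq (by fun_prop) (by fun_prop)) ?_ x y
  intro φ ψ
  rw [chiralityOp_toH, chiralityOp_toH, inner_toH, inner_toH, inner_chirality]

lemma chiralityOp_sq (q : Param) : chiralityOp q * chiralityOp q = 1 :=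
  clm_ext_toH fun ψ => by
    rw [mul_apply_eq_comp, chiralityOp_toH, chiralityOp_toH, chirality_chirality]; rfl

lemma chiralityOp_comm (t : podles q) :
    chiralityOp q * podlesRep q t = podlesRep q t * chiralityOp q :=
  clm_ext_toH fun ψ => by
    rw [mul_apply_eq_comp, mul_apply_eq_comp, chiralityOp_toH, podlesRep_toH, podlesRep_toH,
      chiralityOp_toH, chirality_podlesMul]

namespace SUq

lemma eq_zero_of_re_haar {x : SUq q} (h : (haar q (star x * x)).re = 0) : x = 0 := by
  by_contra hx
  have := (Complex.lt_def.1 ((haar_isHaarState q).pos x hx)).1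
  rw [h] at this
  exact lt_irrefl _ this

end SUq

/-- Strict positivity of the Haar state makes the seminorm a norm, so the completion identifies no
two spinors. -/
lemma norm_eq_zero_invSpinors {ψ : InvSpinors q} (h : ‖ψ‖ = 0) : ψ = 0 := by
  have h' := norm_sq_invSpinors ψ
  have h0 := re_haar_nonneg (ψ.val 0)
  have h1 := re_haar_nonneg (ψ.val 1)
  rw [h, zero_pow two_ne_zero] at h'
  apply InvSpinors.val_injective
  rw [map_zero]
  exact funext (Fin.forall_fin_two.2
    ⟨eq_zero_of_re_haar (by linarith), eq_zero_of_re_haar (by linarith)⟩)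

lemma toH_injective (q : Param) : Function.Injective (toH q) := by
  rw [← LinearMap.ker_eq_bot, LinearMap.ker_eq_bot']
  intro ψ h
  apply norm_eq_zero_invSpinors
  rw [← norm_toH, h, norm_zero]

lemma podlesRep_injective (q : Param) : Function.Injective (podlesRep q) := by
  rw [injective_iff_map_eq_zero]
  intro t ht
  have key : ∀ x : SUq q, qh q • actK q x = x → (t : SUq q) * x = 0 := by
    intro x hx
    let ψ : InvSpinors q := ⟨![x, 0], by rw [mem_invSpinors]; simp [hx]⟩
    have h : podlesMul q t ψ = 0 := by
      apply toH_injective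
      rw [← podlesRep_toH, ht, map_zero]
      rfl
    exact congrFun (congrArg InvSpinors.val h) 0
  have h0 := qh_ne q
  have h1 := key (of q .as) (by rw [actK_of, smul_smul, mul_inv_cancel₀ h0, one_smul])
  have h2 := key (of q .bs) (by rw [actK_of, smul_smul, mul_inv_cancel₀ h0, one_smul])
  apply Subtype.ext
  -- As ta^* = 0 and tb^* = 0, multiplying a^*a + q²b^*b = 1 by t leaves t = 0.
  have h3 := congrArg (fun y => (t : SUq q) * y) (rel_as_a q)
  simp only [mul_sub, mul_smul_comm, ← mul_assoc, h1, h2, zero_mul, mul_one, smul_zero,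
    sub_zero] at h3
  exact h3.symm

/-! ## Weight spaces -/

namespace SUq

/-- The weight of a Peter–Weyl basis vector. -/
def PWIndex.weight (x : PWIndex) : ℤ := ((x.1.1 + x.1.2.1 : ℕ) : ℤ) - 2 * x.1.2.2

lemma actK_pw (x : PWIndex) : actK q (pw q x) = qh q ^ x.weight • pw q x :=
  actK_actF_pow (actK_mono' _ _) _

lemma haar_star_pw_mul_of_ne {x y : PWIndex} (hxy : x ≠ y) :
    haar q (star (pw q x) * pw q y) = 0 := by
  rw [haar_eq]; exact haarFun_star_pw_mul_of_ne hxy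

lemma haar_star_pw_mul_pos (x : PWIndex) : 0 < haar q (star (pw q x) * pw q x) := by
  rw [haar_eq]; exact haarFun_star_pw_mul_pos x

lemma qh_zpow_injective (q : Param) : Function.Injective fun n : ℤ => qh q ^ n := by
  intro m n h
  have h' : ((Real.sqrt q ^ m : ℝ) : ℂ) = ((Real.sqrt q ^ n : ℝ) : ℂ) := by
    push_cast; exact h
  have h1 : Real.sqrt q ≠ 1 := by
    rw [Ne, Real.sqrt_eq_one]; exact q.2.2.ne
  exact zpow_right_injective₀ (qh_pos_real q) h1 (Complex.ofReal_injective h')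

lemma star_qh_zpow (n : ℤ) : star (qh q ^ n) = qh q ^ n := by
  have : (starRingEnd ℂ) (qh q) = qh q := Complex.conj_ofReal _
  rw [Complex.star_def, map_zpow₀, this]

lemma haar_star_pw_mul_of_weight_ne {t : SUq q} {n : ℤ} (ht : actK q t = qh q ^ n • t)
    {x : PWIndex} (hx : x.weight ≠ n) : haar q (star (pw q x) * t) = 0 := by
  have h0 := qh_ne q
  have h := (haar_isActInvariant q).actK (star (pw q x) * t)
  rw [map_mul, ht, actK_star, actKinv_of_actK (zpow_ne_zero _ h0) (actK_pw x), star_smul, star_inv₀,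
    star_qh_zpow, smul_mul_smul_comm, map_smul, smul_eq_mul, ← zpow_neg, ← zpow_add₀ h0] at h
  have h1 : qh q ^ (-x.weight + n) ≠ 1 := by
    rw [← zpow_zero (qh q)]
    intro h2
    have := qh_zpow_injective q h2
    omega
  have h2 : (qh q ^ (-x.weight + n) - 1) * haar q (star (pw q x) * t) = 0 := by
    rw [sub_mul, h, one_mul, sub_self]
  exact (mul_eq_zero.1 h2).resolve_left (sub_ne_zero.2 h1)

/-- The coefficient at a basis vector x is proportional to h(x^*t), which vanishes for different
weights because h is invariant under ∂(k). -/
lemma mem_span_pw_of_actK {t : SUq q} {n : ℤ} (ht : actK q t = qh q ^ n • t) :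
    t ∈ Submodule.span ℂ (pw q '' {x | x.weight = n}) := by
  have hmem : t ∈ Submodule.span ℂ (Set.range (pw q)) := by rw [span_pw]; trivial
  obtain ⟨c, rfl⟩ := Finsupp.mem_span_range_iff_exists_finsupp.1 hmem
  refine Submodule.sum_mem _ fun x hx => Submodule.smul_mem _ _ (Submodule.subset_span ⟨x, ?_, rfl⟩)
  by_contra hw
  have h := haar_star_pw_mul_of_weight_ne ht hw
  rw [Finsupp.sum, Finset.mul_sum, map_sum, Finset.sum_eq_single x] at h
  · rw [mul_smul_comm, map_smul, smul_eq_mul] at h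
    exact (mul_ne_zero (Finsupp.mem_support_iff.1 hx) (haar_star_pw_mul_pos x).ne') h
  · intro y _ hy
    rw [mul_smul_comm, map_smul, haar_star_pw_mul_of_ne hy.symm, smul_zero]
  · exact fun h => absurd hx h

end SUq

/-! ## Eigenspinors -/

/-- The index set of the eigenbasis: `(n, s, j)` stands for the eigenvalue `±[2][n + 1]`. -/
abbrev EigIndex : Type := Σ n : ℕ, Bool × Fin (2 * (n + 1))

/-- The eigenvalue belonging to an index. -/
def eigVal (q : Param) (i : EigIndex) : ℝ :=
  (if i.2.1 then 1 else -1) * (qnum q 2 * qnum q (i.1 + 1))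

/-- The Peter–Weyl index of the first component of an eigenspinor. -/
def lowIndex (n : ℕ) (j : Fin (2 * (n + 1))) : PWIndex :=
  ⟨(j, 2 * n + 1 - j, n + 1), by have := j.2; dsimp only; omega⟩

/-- The Peter–Weyl index of the second component of an eigenspinor. -/
def highIndex (n : ℕ) (j : Fin (2 * (n + 1))) : PWIndex :=
  ⟨(j, 2 * n + 1 - j, n), by have := j.2; dsimp only; omega⟩

/-- Weights are counted in units of 1/2. Invariance of a spinor forces -1 in the first component and
1 in the second, so only chains of odd degree 2n + 1 contribute. -/
lemma lowIndex_weight (n : ℕ) (j : Fin (2 * (n + 1))) : (lowIndex n j).weight = -1 := by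
  have := j.2
  simp only [PWIndex.weight, lowIndex]
  omega

lemma highIndex_weight (n : ℕ) (j : Fin (2 * (n + 1))) : (highIndex n j).weight = 1 := by
  have := j.2
  simp only [PWIndex.weight, highIndex]
  omega

lemma exists_lowIndex {x : PWIndex} (hx : x.weight = -1) : ∃ n j, x = lowIndex n j := by
  obtain ⟨⟨i, j, m⟩, h⟩ := x
  simp only [PWIndex.weight] at hx
  dsimp only at h
  -- Weight -1 means 2m = i + j + 1, so m ≥ 1 and the subtraction is not truncated.
  refine ⟨m - 1, ⟨i, by omega⟩, Subtype.ext ?_⟩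
  simp only [lowIndex, Prod.mk.injEq, true_and]
  omega

lemma exists_highIndex {x : PWIndex} (hx : x.weight = 1) : ∃ n j, x = highIndex n j := by
  obtain ⟨⟨i, j, m⟩, h⟩ := x
  simp only [PWIndex.weight] at hx
  dsimp only at h
  refine ⟨m, ⟨i, by omega⟩, Subtype.ext ?_⟩
  simp only [highIndex, Prod.mk.injEq, true_and, and_true]
  omega

lemma lowIndex_injective {n n' : ℕ} {j : Fin (2 * (n + 1))} {j' : Fin (2 * (n' + 1))}
    (h : lowIndex n j = lowIndex n' j') : (⟨n, j⟩ : Σ n : ℕ, Fin (2 * (n + 1))) = ⟨n', j'⟩ := by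
  have h1 := congrArg Subtype.val h
  simp only [lowIndex, Prod.mk.injEq] at h1
  obtain rfl : n = n' := by omega
  rw [Fin.ext h1.1]

lemma highIndex_injective {n n' : ℕ} {j : Fin (2 * (n + 1))} {j' : Fin (2 * (n' + 1))}
    (h : highIndex n j = highIndex n' j') : (⟨n, j⟩ : Σ n : ℕ, Fin (2 * (n + 1))) = ⟨n', j'⟩ := by
  have h1 := congrArg Subtype.val h
  simp only [highIndex, Prod.mk.injEq] at h1
  obtain rfl : n = n' := by omega
  rw [Fin.ext h1.1]

lemma actF_highIndex (n : ℕ) (j : Fin (2 * (n + 1))) :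
    actF q (pw q (highIndex n j)) = pw q (lowIndex n j) := by
  rw [pw, pw, ← Module.End.mul_apply]
  simp only [highIndex, lowIndex, pow_succ']

lemma actE_lowIndex (n : ℕ) (j : Fin (2 * (n + 1))) :
    actE q (pw q (lowIndex n j)) = (qnumc q (n + 1) ^ 2) • pw q (highIndex n j) := by
  have h : (j : ℕ) + (2 * n + 1 - j) = 2 * n + 1 := by have := j.2; omega
  have := actE_actF_pow (actE_mono (q := q) j (2 * n + 1 - j)) (actK_mono' _ _) n
  rw [h, casimirCoeff_self] at this
  rw [qnumc, ← Complex.ofReal_pow]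
  exact this

/-- This norm ratio is compensated by the factor [n+1] in the second component of `eigSpinor`, which
makes the eigenspinors for opposite signs orthogonal. -/
lemma haar_lowIndex (n : ℕ) (j : Fin (2 * (n + 1))) :
    haar q (star (pw q (lowIndex n j)) * pw q (lowIndex n j)) =
      qnumc q (n + 1) ^ 2 * haar q (star (pw q (highIndex n j)) * pw q (highIndex n j)) := by
  conv_lhs => rw [← actF_highIndex, ← (haar_isActInvariant q).star_mul_actE, actF_highIndex,
    actE_lowIndex, mul_smul_comm, map_smul, smul_eq_mul]

/-- The sign of an index, as a complex number. -/
def eigSign (s : Bool) : ℂ := if s then 1 else -1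

/-- The (unnormalized) eigenspinors. -/
def eigSpinor (q : Param) (i : EigIndex) : InvSpinors q :=
  ⟨![pw q (lowIndex i.1 i.2.2),
    (eigSign i.2.1 * qnumc q (i.1 + 1)) • pw q (highIndex i.1 i.2.2)], by
    have h0 := qh_ne q
    rw [mem_invSpinors]
    simp only [Matrix.cons_val_zero, Matrix.cons_val_one, map_smul, actK_pw, lowIndex_weight,
      highIndex_weight, smul_smul]
    constructor
    · simp [h0]
    · rw [zpow_one, mul_comm _ (qh q), inv_mul_cancel_left₀ h0]⟩

lemma eigSpinor_val_zero (i : EigIndex) :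
    (eigSpinor q i).val 0 = pw q (lowIndex i.1 i.2.2) := rfl

lemma eigSpinor_val_one (i : EigIndex) : (eigSpinor q i).val 1 =
    (eigSign i.2.1 * qnumc q (i.1 + 1)) • pw q (highIndex i.1 i.2.2) := rfl

lemma qnum_ge (q : Param) (n : ℕ) : ((q : ℝ)⁻¹) ^ n ≤ qnum q (n + 1) := by
  have hq := q.2.1
  have h1 : (q : ℝ) - (q : ℝ)⁻¹ < 0 := by
    simpa using sub_inv_neg_of_pos (q := q) (n := 1) one_pos
  have h2 : (q : ℝ) ^ n ≤ 1 := pow_le_one₀ hq.le q.2.2.le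
  have h3 : 1 ≤ ((q : ℝ) ^ n)⁻¹ := (one_le_inv₀ (pow_pos hq n)).2 h2
  rw [qnum, le_div_iff_of_neg h1, pow_succ, mul_inv, inv_pow, mul_sub]
  gcongr
  exact h2.trans h3

lemma qnum_pos (q : Param) (n : ℕ) : 0 < qnum q (n + 1) :=
  (pow_pos (inv_pos.2 q.2.1) n).trans_le (qnum_ge q n)

lemma eigVal_eq (i : EigIndex) :
    (eigVal q i : ℂ) = eigSign i.2.1 * (qnumc q 2 * qnumc q (i.1 + 1)) := by
  rw [eigVal, eigSign, qnumc, qnumc]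
  split_ifs <;> push_cast <;> rfl

lemma eigSign_mul_self (s : Bool) : eigSign s * eigSign s = 1 := by
  cases s <;> simp [eigSign]

lemma star_eigSign (s : Bool) : star (eigSign s) = eigSign s := by
  cases s <;> simp [eigSign]

/-- On the pair of chain vectors, ∂(f) has coefficient 1 and ∂(e) has coefficient [n+1]²; weighting
the second component by ±[n+1] balances the two. -/
lemma dirac_eigSpinor (i : EigIndex) :
    dirac q (eigSpinor q i) = (eigVal q i : ℂ) • eigSpinor q i := by
  apply InvSpinors.val_injective
  rw [map_smul, eigVal_eq]
  refine funext (Fin.forall_fin_two.2 ⟨?_, ?_⟩)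
  · rw [dirac_val_zero, Pi.smul_apply, eigSpinor_val_one, eigSpinor_val_zero, map_smul,
      actF_highIndex, smul_smul]
    congr 1
    ring
  · rw [dirac_val_one, Pi.smul_apply, eigSpinor_val_one, eigSpinor_val_zero, actE_lowIndex,
      smul_smul, smul_smul]
    congr 1
    linear_combination (-qnumc q 2 * qnumc q (i.1 + 1) ^ 2) * eigSign_mul_self i.2.1

lemma inner_eigSpinor (i j : EigIndex) : inner ℂ (eigSpinor q i) (eigSpinor q j) =
    haar q (star (pw q (lowIndex i.1 i.2.2)) * pw q (lowIndex j.1 j.2.2)) +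
    eigSign i.2.1 * eigSign j.2.1 * (qnumc q (i.1 + 1) * qnumc q (j.1 + 1)) *
      haar q (star (pw q (highIndex i.1 i.2.2)) * pw q (highIndex j.1 j.2.2)) := by
  rw [inner_invSpinors, eigSpinor_val_zero, eigSpinor_val_zero, eigSpinor_val_one,
    eigSpinor_val_one, star_smul, smul_mul_smul_comm, map_smul, star_mul', star_eigSign, star_qnumc,
    smul_eq_mul]
  ring

lemma inner_eigSpinor_of_ne {i j : EigIndex} (h : i ≠ j) :
    inner ℂ (eigSpinor q i) (eigSpinor q j) = 0 := by
  obtain ⟨n, s, k⟩ := i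
  obtain ⟨n', s', k'⟩ := j
  rw [inner_eigSpinor]
  dsimp only
  by_cases hk : (⟨n, k⟩ : Σ n : ℕ, Fin (2 * (n + 1))) = ⟨n', k'⟩
  · cases hk
    have hs : eigSign s * eigSign s' = -1 := by
      have : s ≠ s' := by rintro rfl; exact h rfl
      cases s <;> cases s' <;> simp_all [eigSign]
    rw [hs, haar_lowIndex]
    ring
  · rw [haar_star_pw_mul_of_ne fun e => hk (lowIndex_injective e),
      haar_star_pw_mul_of_ne fun e => hk (highIndex_injective e), mul_zero, add_zero]

lemma eigSpinor_ne_zero (i : EigIndex) : eigSpinor q i ≠ 0 := by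
  intro h
  have h1 : pw q (lowIndex i.1 i.2.2) = 0 := congrFun (congrArg InvSpinors.val h) 0
  have h2 := haar_star_pw_mul_pos (q := q) (lowIndex i.1 i.2.2)
  rw [h1, mul_zero, map_zero] at h2
  exact lt_irrefl _ h2

lemma norm_eigSpinor_ne_zero (i : EigIndex) : ‖eigSpinor q i‖ ≠ 0 :=
  fun h => eigSpinor_ne_zero i (norm_eq_zero_invSpinors h)

/-- Sums and differences of the eigenspinors for the two signs isolate each component, and the chain
vectors of weight -1 and 1 span the respective weight spaces. -/
lemma span_eigSpinor (q : Param) : Submodule.span ℂ (Set.range (eigSpinor q)) = ⊤ := by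
  set W := Submodule.span ℂ (Set.range (eigSpinor q)) with hW
  have hmem : ∀ i, eigSpinor q i ∈ W := fun i => Submodule.subset_span ⟨i, rfl⟩
  have hlow : ∀ n j, Pi.single 0 (pw q (lowIndex n j)) ∈ W.map InvSpinors.val := by
    intro n j
    have h := W.smul_mem (2⁻¹ : ℂ) (W.add_mem (hmem ⟨n, true, j⟩) (hmem ⟨n, false, j⟩))
    refine ⟨_, h, funext (Fin.forall_fin_two.2 ⟨?_, ?_⟩)⟩
    · rw [map_smul, map_add, Pi.smul_apply, Pi.add_apply, eigSpinor_val_zero, eigSpinor_val_zero,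
        Pi.single_eq_same]
      module
    · rw [map_smul, map_add, Pi.smul_apply, Pi.add_apply, eigSpinor_val_one, eigSpinor_val_one]
      simp [eigSign]
  have hhigh : ∀ n j, Pi.single 1 (pw q (highIndex n j)) ∈ W.map InvSpinors.val := by
    intro n j
    have hn : qnumc q (n + 1) ≠ 0 := Complex.ofReal_ne_zero.2 (qnum_pos q n).ne'
    have h := W.smul_mem ((2 * qnumc q (n + 1))⁻¹ : ℂ)
      (W.sub_mem (hmem ⟨n, true, j⟩) (hmem ⟨n, false, j⟩))
    refine ⟨_, h, funext (Fin.forall_fin_two.2 ⟨?_, ?_⟩)⟩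
    · rw [map_smul, map_sub, Pi.smul_apply, Pi.sub_apply, eigSpinor_val_zero, eigSpinor_val_zero]
      simp
    · rw [map_smul, map_sub, Pi.smul_apply, Pi.sub_apply, eigSpinor_val_one, eigSpinor_val_one,
        Pi.single_eq_same, ← sub_smul, smul_smul]
      have : (2 * qnumc q (n + 1))⁻¹ * (eigSign true * qnumc q (n + 1) -
          eigSign false * qnumc q (n + 1)) = 1 := by
        simp only [eigSign]; field_simp; norm_num
      rw [this, one_smul]
  have h0 : ∀ x, actK q x = qh q ^ (-1 : ℤ) • x → Pi.single 0 x ∈ W.map InvSpinors.val := by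
    intro x hx
    have : Submodule.span ℂ (pw q '' {x | x.weight = -1}) ≤
        (W.map InvSpinors.val).comap (LinearMap.single ℂ (fun _ : Fin 2 => SUq q) 0) := by
      refine Submodule.span_le.2 ?_
      rintro _ ⟨y, hy, rfl⟩
      obtain ⟨n, j, rfl⟩ := exists_lowIndex hy
      exact hlow n j
    exact this (mem_span_pw_of_actK hx)
  have h1 : ∀ x, actK q x = qh q ^ (1 : ℤ) • x → Pi.single 1 x ∈ W.map InvSpinors.val := by
    intro x hx
    have : Submodule.span ℂ (pw q '' {x | x.weight = 1}) ≤
        (W.map InvSpinors.val).comap (LinearMap.single ℂ (fun _ : Fin 2 => SUq q) 1) := by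
      refine Submodule.span_le.2 ?_
      rintro _ ⟨y, hy, rfl⟩
      obtain ⟨n, j, rfl⟩ := exists_highIndex hy
      exact hhigh n j
    exact this (mem_span_pw_of_actK hx)
  rw [eq_top_iff]
  intro ψ _
  have e : ψ.val = Pi.single 0 (ψ.val 0) + Pi.single 1 (ψ.val 1) :=
    funext (Fin.forall_fin_two.2 ⟨by simp, by simp⟩)
  have hψ : ψ.val ∈ W.map InvSpinors.val := by
    rw [e]
    exact add_mem (h0 _ (by rw [actK_val_zero, zpow_neg_one]))
      (h1 _ (by rw [actK_val_one, zpow_one]))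
  obtain ⟨φ, hφ, h⟩ := hψ
  rwa [InvSpinors.val_injective h] at hφ

/-! ### The Hilbert basis of eigenvectors -/

/-- The normalized eigenvectors. -/
def eigVec (q : Param) (i : EigIndex) : HilbertInv q :=
  toH q (((‖eigSpinor q i‖ : ℂ))⁻¹ • eigSpinor q i)

lemma orthonormal_eigVec (q : Param) : Orthonormal ℂ (eigVec q) := by
  refine ⟨fun i => ?_, fun i j hij => ?_⟩
  · have h := norm_eigSpinor_ne_zero (q := q) i
    change ‖toH q _‖ = 1
    rw [norm_toH, norm_smul, norm_inv, Complex.norm_real, norm_norm, inv_mul_cancel₀ h]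
  · change inner ℂ (toH q _) (toH q _) = 0
    rw [inner_toH, inner_smul_left, inner_smul_right, inner_eigSpinor_of_ne hij,
      mul_zero, mul_zero]

lemma dense_span_eigVec (q : Param) :
    ⊤ ≤ (Submodule.span ℂ (Set.range (eigVec q))).topologicalClosure := by
  have h : LinearMap.range (toH q) ≤ Submodule.span ℂ (Set.range (eigVec q)) := by
    rw [LinearMap.range_eq_map, ← span_eigSpinor, Submodule.map_span_le]
    rintro _ ⟨i, rfl⟩
    have hi : (‖eigSpinor q i‖ : ℂ)⁻¹ ≠ 0 :=
      inv_ne_zero (Complex.ofReal_ne_zero.2 (norm_eigSpinor_ne_zero i))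
    refine (Submodule.smul_mem_iff _ hi).1 ?_
    rw [← map_smul]
    exact Submodule.subset_span ⟨i, rfl⟩
  intro x _
  exact closure_mono h (denseRange_toH q x)

/-- The orthonormal basis of eigenvectors. -/
def eigBasis (q : Param) : HilbertBasis EigIndex ℂ (HilbertInv q) :=
  HilbertBasis.mk (orthonormal_eigVec q) (dense_span_eigVec q)

lemma eigBasis_apply (i : EigIndex) : eigBasis q i =
    toH q (((‖eigSpinor q i‖ : ℂ))⁻¹ • eigSpinor q i) := by
  rw [eigBasis, HilbertBasis.coe_mk]; rfl

/-! ## Summability of the eigenvalues -/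

lemma summable_pow_eigIndex {r : ℝ} (h0 : 0 ≤ r) (h1 : r < 1) :
    Summable fun i : EigIndex => r ^ i.1 := by
  rw [summable_sigma_of_nonneg fun i => pow_nonneg h0 _]
  refine ⟨fun n => Summable.of_finite, ?_⟩
  have hs := (summable_pow_mul_geometric_of_norm_lt_one 1
    (by rwa [Real.norm_of_nonneg h0] : ‖r‖ < 1)).add (summable_geometric_of_lt_one h0 h1)
  -- Two signs and 2(n+1) values of j give 4(n+1) indices over n.
  refine (hs.mul_left 4).congr fun n => ?_
  rw [tsum_fintype]
  simp
  ring

/-- Since |λ| ≥ q^{-n} over n, each term is at most (q^p)^n; the linear multiplicity cannot spoil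
geometric decay. -/
lemma summable_eigVal {p : ℝ} (hp : 0 < p) :
    Summable fun i => (1 + eigVal q i ^ 2) ^ (-p / 2) := by
  have hq := q.2.1
  have hr0 : (0 : ℝ) ≤ (q : ℝ) ^ p := Real.rpow_nonneg hq.le p
  refine Summable.of_nonneg_of_le (fun i => by positivity) (fun i => ?_)
    (summable_pow_eigIndex hr0 (Real.rpow_lt_one hq.le q.2.2 hp))
  have h1 := qnum_ge q i.1
  have h2 := qnum_ge q 1
  have h3 : 1 ≤ (q : ℝ)⁻¹ := (one_le_inv₀ hq).2 q.2.2.le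
  rw [pow_one] at h2
  have hpos : 0 < ((q : ℝ)⁻¹) ^ i.1 := pow_pos (inv_pos.2 hq) _
  have h4 : ((q : ℝ)⁻¹) ^ i.1 ≤ qnum q 2 * qnum q (i.1 + 1) := by
    rw [← one_mul ((q : ℝ)⁻¹ ^ i.1)]
    exact mul_le_mul (h3.trans h2) h1 hpos.le (by linarith)
  have h5 : eigVal q i ^ 2 = (qnum q 2 * qnum q (i.1 + 1)) ^ 2 := by
    rw [eigVal]; split_ifs <;> ring
  have h6 : (((q : ℝ)⁻¹) ^ i.1) ^ 2 ≤ 1 + eigVal q i ^ 2 := by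
    rw [h5]
    have := pow_le_pow_left₀ hpos.le h4 2
    linarith
  refine (Real.rpow_le_rpow_of_nonpos (pow_pos hpos 2) h6 (by linarith)).trans (le_of_eq ?_)
  rw [← pow_mul, ← Real.rpow_natCast, ← Real.rpow_mul (inv_pos.2 hq).le, Real.inv_rpow hq.le,
    ← Real.rpow_neg hq.le, ← Real.rpow_natCast, ← Real.rpow_mul hq.le]
  congr 1
  push_cast
  ring

/-! ## The closure of the Dirac operator -/

/-- The closure of the algebraic Dirac operator. -/
def diracOp (q : Param) : HilbertInv q →ₗ.[ℂ] HilbertInv q := diagOp (eigBasis q) (eigVal q)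

lemma diracGraph_le (q : Param) : diracGraph q ≤ diagGraph (eigBasis q) (eigVal q) := by
  rintro _ ⟨ψ, rfl⟩ i
  change inner ℂ _ (toH q (dirac q ψ)) = _ * inner ℂ _ (toH q ψ)
  rw [eigBasis_apply, inner_toH, inner_toH, inner_dirac, map_smul, dirac_eigSpinor, smul_comm,
    inner_smul_left, Complex.conj_ofReal]

lemma eigBasis_mem_diracGraph (i : EigIndex) :
    (eigBasis q i, (eigVal q i : ℂ) • eigBasis q i) ∈ diracGraph q := by
  refine ⟨((‖eigSpinor q i‖ : ℂ))⁻¹ • eigSpinor q i, ?_⟩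
  change (toH q _, toH q (dirac q _)) = _
  rw [eigBasis_apply, map_smul (dirac q), dirac_eigSpinor, smul_comm,
    map_smul (toH q) (eigVal q i : ℂ)]

lemma diagGraph_eigBasis (q : Param) :
    diagGraph (eigBasis q) (eigVal q) = (diracGraph q).topologicalClosure :=
  diagGraph_eq_closure _ _ (diracGraph_le q) eigBasis_mem_diracGraph

/-- Domain preservation and the operator identity for the closure become one statement about a
bounded map on pairs, checked on the algebraic graph and extended by continuity. -/
lemma mapsTo_diagGraph {Φ : HilbertInv q × HilbertInv q →L[ℂ] HilbertInv q × HilbertInv q}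
    (h : ∀ ψ, Φ (toH q ψ, toH q (dirac q ψ)) ∈ diagGraph (eigBasis q) (eigVal q))
    {x : HilbertInv q × HilbertInv q} (hx : x ∈ diagGraph (eigBasis q) (eigVal q)) :
    Φ x ∈ diagGraph (eigBasis q) (eigVal q) := by
  have : (diracGraph q).topologicalClosure ≤
      (diagGraph (eigBasis q) (eigVal q)).comap Φ.toLinearMap := by
    refine Submodule.topologicalClosure_minimal _ ?_
      ((isClosed_diagGraph _ _).preimage Φ.continuous)
    rintro _ ⟨ψ, rfl⟩
    exact h ψ
  rw [diagGraph_eigBasis] at hx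
  exact this hx

lemma toH_mem_diagGraph (ψ : InvSpinors q) :
    (toH q ψ, toH q (dirac q ψ)) ∈ diagGraph (eigBasis q) (eigVal q) :=
  diracGraph_le q ⟨ψ, rfl⟩

/-! ### The spectral triple axioms for the closure -/

lemma diracOp_commutator (t : podles q) : ∃ C : HilbertInv q →L[ℂ] HilbertInv q,
    ∀ x : (diracOp q).domain, ∃ hx : podlesRep q t x ∈ (diracOp q).domain,
      diracOp q ⟨podlesRep q t x, hx⟩ - podlesRep q t (diracOp q x) = C x := by
  refine ⟨extendOp (diracComm t), fun x => ?_⟩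
  -- The map is (x, y) ↦ (tx, ty + Cx) with C the bounded commutator; preserving the graph means
  -- D(tx) = tDx + Cx.
  have h := mapsTo_diagGraph (q := q)
    (Φ := (podlesRep q t ∘L ContinuousLinearMap.fst ℂ _ _).prod
      (podlesRep q t ∘L ContinuousLinearMap.snd ℂ _ _ +
        extendOp (diracComm t) ∘L ContinuousLinearMap.fst ℂ _ _)) (fun ψ => by
      change (podlesRep q t (toH q ψ), podlesRep q t (toH q (dirac q ψ)) +
        extendOp (diracComm t) (toH q ψ)) ∈ _
      have e : podlesMul q t (dirac q ψ) + diracComm t ψ = dirac q (podlesMul q t ψ) :=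
        add_sub_cancel _ _
      rw [podlesRep_toH, podlesRep_toH, extendOp_toH (isBddOp_diracComm t), ← map_add, e]
      exact toH_mem_diagGraph _) (diagOp_mem_graph _ _ x)
  obtain ⟨hx, e⟩ := mem_diagOp_domain _ _ h
  exact ⟨hx, (congrArg (· - podlesRep q t (diracOp q x)) e).trans (add_sub_cancel_left _ _)⟩

lemma diracOp_chirality (x : (diracOp q).domain) :
    ∃ hx : chiralityOp q x ∈ (diracOp q).domain,
      chiralityOp q (diracOp q x) + diracOp q ⟨chiralityOp q x, hx⟩ = 0 := by
  -- Here the map is (x, y) ↦ (γx, -γy), which encodes anticommutation.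
  have h := mapsTo_diagGraph (q := q)
    (Φ := (chiralityOp q ∘L ContinuousLinearMap.fst ℂ _ _).prod
      (-(chiralityOp q ∘L ContinuousLinearMap.snd ℂ _ _))) (fun ψ => by
      change (chiralityOp q (toH q ψ), -chiralityOp q (toH q (dirac q ψ))) ∈ _
      rw [chiralityOp_toH, chiralityOp_toH, ← map_neg,
        neg_eq_of_add_eq_zero_right (chirality_dirac ψ)]
      exact toH_mem_diagGraph _) (diagOp_mem_graph _ _ x)
  obtain ⟨hx, e⟩ := mem_diagOp_domain _ _ h
  exact ⟨hx, (congrArg (chiralityOp q (diracOp q x) + ·) e).trans (add_neg_cancel _)⟩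

lemma separableSpace_hilbertInv (q : Param) : TopologicalSpace.SeparableSpace (HilbertInv q) := by
  rw [← TopologicalSpace.isSeparable_univ_iff]
  have h := ((Set.countable_range (eigBasis q)).isSeparable.span (R := ℂ)).closure
  rwa [← Submodule.topologicalClosure_coe, (eigBasis q).dense_span] at h

lemma isEvenSpectralTriple (q : Param) :
    IsEvenSpectralTriple (podlesRep q) (diracOp q) (chiralityOp q) where
  separable := separableSpace_hilbertInv q
  faithful := podlesRep_injective q
  dense_domain := diagOp_dense _ _
  selfAdjoint := diagOp_isSelfAdjoint _ _
  commutator := diracOp_commutator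
  compact_resolvent := diagOp_compact_resolvent _ _ (summable_eigVal one_pos)
  chirality_selfAdjoint := chiralityOp_isSelfAdjoint q
  chirality_sq := chiralityOp_sq q
  chirality_comm := chiralityOp_comm
  chirality_anticomm := diracOp_chirality

lemma isZeroSummable_diracOp (q : Param) : IsZeroSummable (diracOp q) := fun _ hp =>
  ⟨EigIndex, eigBasis q, eigVal q, diagOp_basis _ _, summable_eigVal hp⟩

lemma dirac_val_eq_matAct (ψ : InvSpinors q) : (dirac q ψ).val =
    matAct q (qnumc q 2 • !![0, Uq.of q .f; Uq.of q .e, 0]) ψ.val := by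
  rw [dirac_val]
  ext i
  fin_cases i <;> simp [matAct, act_e, act_f]

end QSphere

end

theorem mainTheorem4 (q : QSphere.Param) :
    -- the functional `haar q` is the Haar state
    SUq.IsHaarState (SUq.haar q) ∧
    -- on invariant spinors the projected Dirac operator is `[2] ∂ ((0, f), (e, 0))`
    (∀ ψ : InvSpinors q, (dirac q ψ).val =
      matAct q (qnumc q 2 • !![0, Uq.of q .f; Uq.of q .e, 0]) ψ.val) ∧
    ∃ (ρ : podles q →⋆ₐ[ℂ] (HilbertInv q →L[ℂ] HilbertInv q))
      (D : HilbertInv q →ₗ.[ℂ] HilbertInv q)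
      (γ : HilbertInv q →L[ℂ] HilbertInv q),
      -- `ρ` is left multiplication, `D` is the closure of `dirac q`, and `γ = Diag(1, -1)`
      (∀ (t : podles q) (ψ : InvSpinors q), ρ t (toH q ψ) = toH q (podlesMul q t ψ)) ∧
      D.graph = (diracGraph q).topologicalClosure ∧
      (∀ ψ : InvSpinors q, γ (toH q ψ) = toH q (chirality q ψ)) ∧
      IsEvenSpectralTriple ρ D γ ∧
      IsZeroSummable D ∧
      -- the spectrum: eigenvalues `[2][n]` and `-[2][n]` of multiplicity `2n` for `n ≥ 1`
      ∃ v : HilbertBasis (Σ n : ℕ, Bool × Fin (2 * (n + 1))) ℂ (HilbertInv q),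
        ∀ i, ∃ hi : v i ∈ D.domain,
          D ⟨v i, hi⟩ = ((if i.2.1 then 1 else -1) * (qnumc q 2 * qnumc q (i.1 + 1))) • v i := by
  refine ⟨SUq.haar_isHaarState q, dirac_val_eq_matAct, podlesRep q, diracOp q, chiralityOp q,
    podlesRep_toH, (diagOp_graph _ _).trans (diagGraph_eigBasis q), chiralityOp_toH,
    isEvenSpectralTriple q, isZeroSummable_diracOp q, eigBasis q, fun i => ?_⟩
  obtain ⟨hi, h⟩ := diagOp_basis (eigBasis q) (eigVal q) i
  exact ⟨hi, h.trans (congrArg (· • eigBasis q i) (eigVal_eq i))⟩
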